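/- For positive integers $m,d$ let $v_1,\dots,v_m$ be i.i.d. samples from $\mathcal N(0,\frac1d I_d)$ on $\mathbb R^d$. Define $\eta\in\mathbb R^m$ by $\eta_i=\|v_i\|_2^2-1$, let $1_m\in\mathbb R^m$ be the all-ones vector, and define $M\in\mathbb R^{m\times m}$ by $M[i,j]=\langle v_i,v_j\rangle^2$. Let $$A=M_\alpha+M_\beta+M_D+\Bigl(1+\frac1d\Bigr)I_m,$$ where $M_\alpha,M_\beta$ have zero diagonal, $M_D$ is diagonal, and $$M_\alpha[i,j]=\sum_{a\ne b\in[d]}v_i[a]v_i[b]v_j[a]v_j[b],\qquad M_\beta[i,j]=\sum_{a\in[d]}\Bigl(v_i[a]^2-\frac1d\Bigr)\Bigl(v_j[a]^2-\frac1d\Bigr)\quad(i\ne j),$$ $$M_D[i,i]=\|v_i\|_2^4-\frac2d\|v_i\|_2^2-1 .$$ Put $U=\frac1{\sqrt d}\begin{bmatrix}1_m&\eta\end{bmatrix}\in\mathbb R^{m\times2}$ and $C=\begin{bmatrix}1&1\\1&0\end{bmatrix}$, so that $M=A+UCU^T$; when $A$ is invertible let $$r=\frac{1_m^TA^{-1}1_m}{d},\qquad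 s=1+\frac{\eta^TA^{-1}1_m}{d},\qquad u=-1+\frac{\eta^TA^{-1}\eta}{d},$$ which are the entries of the Woodbury capacitance matrix: $C^{-1}+U^TA^{-1}U=\begin{bmatrix}r&s\\s&u\end{bmatrix}$. There are absolute constants $c,\kappa>0$ and sequences $\varepsilon_d\to0$, $\delta_d\to0$ (as $d\to\infty$) such that for all $m,d$ with $m\le c\,d^2$, with probability at least $1-\delta_d$ all of the following hold simultaneously: the matrix $A$ is invertible (so that $r,s,u$ are defined); 1. $r\in\frac md\cdot[2/3,\,2]$; 2. $|s|\le1+\varepsilon_d$; 3. $u\in[-1,\,-1/2]$; moreover $s^2-ru\ge\kappa\,\frac md$, and $M=A+UCU^T$ is invertible. -/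

import Mathlib

open MeasureTheory ProbabilityTheory Filter Topology Matrix
open scoped BigOperators

namespace EllipsoidFitting

noncomputable section

/-- The Gaussian law `N(0, I_d / d)` on `ℝ^d`. -/
def sampleLaw (d : ℕ) : Measure (EuclideanSpace ℝ (Fin d)) :=
  multivariateGaussian 0 ((1 / (d : ℝ)) • (1 : Matrix (Fin d) (Fin d) ℝ))

/-- The matrix `M` with entries `M[i,j] = ⟨v_i, v_j⟩²`. -/
def matM {m d : ℕ} (v : Fin m → EuclideanSpace ℝ (Fin d)) : Matrix (Fin m) (Fin m) ℝ :=
  Matrix.of fun i j => (inner ℝ (v i) (v j)) ^ 2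

/-- The vector `η` with entries `η_i = ‖v_i‖² - 1`. -/
def eta {m d : ℕ} (v : Fin m → EuclideanSpace ℝ (Fin d)) : Fin m → ℝ :=
  fun i => ‖v i‖ ^ 2 - 1

/-- The matrix `M_α`: off the diagonal, the sum over ordered pairs `a ≠ b` in `[d]` of
`v_i[a] v_i[b] v_j[a] v_j[b]`; zero on the diagonal. -/
def matMalpha {m d : ℕ} (v : Fin m → EuclideanSpace ℝ (Fin d)) : Matrix (Fin m) (Fin m) ℝ :=
  Matrix.of fun i j =>
    if i = j then 0
    else ∑ a : Fin d, ∑ b : Fin d, if a = b then 0 else v i a * v i b * v j a * v j b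

/-- The matrix `M_β`: off the diagonal, `∑_a (v_i[a]² - 1/d) (v_j[a]² - 1/d)`;
zero on the diagonal. -/
def matMbeta {m d : ℕ} (v : Fin m → EuclideanSpace ℝ (Fin d)) : Matrix (Fin m) (Fin m) ℝ :=
  Matrix.of fun i j =>
    if i = j then 0
    else ∑ a : Fin d, ((v i a) ^ 2 - 1 / (d : ℝ)) * ((v j a) ^ 2 - 1 / (d : ℝ))

/-- The diagonal matrix `M_D` with entries `‖v_i‖⁴ - (2/d) ‖v_i‖² - 1`. -/
def matMD {m d : ℕ} (v : Fin m → EuclideanSpace ℝ (Fin d)) : Matrix (Fin m) (Fin m) ℝ :=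
  Matrix.diagonal fun i => ‖v i‖ ^ 4 - 2 / (d : ℝ) * ‖v i‖ ^ 2 - 1

/-- The matrix `A = M_α + M_β + M_D + (1 + 1/d) I_m`. -/
def matA {m d : ℕ} (v : Fin m → EuclideanSpace ℝ (Fin d)) : Matrix (Fin m) (Fin m) ℝ :=
  matMalpha v + matMbeta v + matMD v + (1 + 1 / (d : ℝ)) • (1 : Matrix (Fin m) (Fin m) ℝ)

/-- The `m × 2` matrix `U = (1/√d) [1_m  η]`. -/
def matU {m d : ℕ} (v : Fin m → EuclideanSpace ℝ (Fin d)) : Matrix (Fin m) (Fin 2) ℝ :=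
  (1 / Real.sqrt (d : ℝ)) • Matrix.of fun i => ![1, eta v i]

/-- The `2 × 2` matrix `C`. -/
def matC : Matrix (Fin 2) (Fin 2) ℝ := !![1, 1; 1, 0]

/-- The Woodbury capacitance matrix `C⁻¹ + Uᵀ A⁻¹ U`. -/
def capacitance {m d : ℕ} (v : Fin m → EuclideanSpace ℝ (Fin d)) : Matrix (Fin 2) (Fin 2) ℝ :=
  matC⁻¹ + (matU v)ᵀ * (matA v)⁻¹ * matU v

/-- `r = 1_mᵀ A⁻¹ 1_m / d`. -/
def rr {m d : ℕ} (v : Fin m → EuclideanSpace ℝ (Fin d)) : ℝ :=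
  ((fun _ => 1) ⬝ᵥ ((matA v)⁻¹ *ᵥ fun _ => 1)) / (d : ℝ)

/-- `s = 1 + ηᵀ A⁻¹ 1_m / d`. -/
def ss {m d : ℕ} (v : Fin m → EuclideanSpace ℝ (Fin d)) : ℝ :=
  1 + (eta v ⬝ᵥ ((matA v)⁻¹ *ᵥ fun _ => 1)) / (d : ℝ)

/-- `u = -1 + ηᵀ A⁻¹ η / d`. -/
def uu {m d : ℕ} (v : Fin m → EuclideanSpace ℝ (Fin d)) : ℝ :=
  -1 + (eta v ⬝ᵥ ((matA v)⁻¹ *ᵥ eta v)) / (d : ℝ)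

end

end EllipsoidFitting

open EllipsoidFitting

set_option linter.unusedSectionVars false
set_option linter.unusedSimpArgs false

namespace EllipsoidFitting

/-! ### Rank-one perturbations and the trace of a cube -/

section RankOne

variable {ι : Type*} [Fintype ι] [DecidableEq ι]

/-! Write `x i = √d • v i` (standard Gaussian) and ρ_i = ‖v_i‖². Then A is the Gram matrix of the
features (x xᵀ - I)/d, M that of x xᵀ/d, and the Gram matrix K of the traceless features x xᵀ/d -
(ρ/d) I satisfies A = K + ηηᵀ/d. The three differ only in the coordinates (a, a). A lower bound 1/2
on the Gram matrix built from coordinates a ≠ b alone (`SpectralGap`) therefore makes A, M and K all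
at least 1/2 (`SpectralGap.shifted`), and A and M are invertible.

The gap. Split the coordinates modulo 4. Products of a coordinate in class p with one outside it
form an outer product of two independent Gaussian vectors, an isotropic feature with norm near 3/16
(squared). Each of these four Gram matrices is at least 1/8 with high probability, and the four
bounds add up to 1/2. The bound 1/8 comes from a barrier argument: rows are added one at a time
while the level l slowly drops, and tr (G - l)⁻³ is kept below N = d². This forces ‖(G - l)⁻¹‖ ≤ L =
N^(1/3) = d^(2/3). The exponent 3 is large enough to give L ≪ d, so that the chaos tail exp(-c d/L)
beats a union bound over m ≤ d² steps, while the accumulated variance m L²/N² still tends to zero.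
The increase of the trace is compensated in mean by lowering l, and its fluctuations are controlled
by the expected square of the truncated excess (`integral_barrierPotential_cons_le`).

The bounds on r and u. From A ≥ 1/2 come 1ᵀA⁻¹1 ≤ 2m and ηᵀA⁻¹η ≤ 2‖η‖², and ‖η‖² < d/64 by
Chebyshev. From below, m² ≤ (1ᵀA1)(1ᵀA⁻¹1), and 1ᵀA1 ≤ 3m/2 because the off-diagonal part is a
centred sum with small variance (`CentredFeature.pairSum_sq`).

The bound on s. Removing ηηᵀ/d divides ηᵀK⁻¹1 by 1 + ηᵀK⁻¹η/d ≥ 1, so ηᵀK⁻¹1 has to be bounded. Here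
K = DBD with D = diag ρ and B depending on the directions only. With a_i = 1 - 1/ρ_i and w = B⁻¹1
this gives ηᵀK⁻¹1 = a·w - aᵀB⁻¹a. Lengths and directions are independent, so given w the sum a·w
concentrates around (E a)(1ᵀB⁻¹1), where -O(1/d) ≤ E a ≤ 0. Both non-fluctuating contributions are
thus nonpositive and at least -d in total, while the fluctuation is below d^(3/4)
(`eta_inverse_form_bounds`). Hence s lies between -d^(-1/4) and 1 + d^(-1/4).

Finally s² - ru ≥ r(-u) ≥ (2/3)(1/2) m/d. -/

theorem vecMulVec_mul_mul_vecMulVec (w : ι → ℝ) (S : Matrix ι ι ℝ) :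
    vecMulVec w w * S * vecMulVec w w = (w ⬝ᵥ S *ᵥ w) • vecMulVec w w := by
  rw [Matrix.vecMulVec_mul, Matrix.vecMulVec_mul_vecMulVec, Matrix.dotProduct_mulVec, vecMulVec_smul]

theorem vecMulVec_mul_self (w : ι → ℝ) :
    vecMulVec w w * vecMulVec w w = (w ⬝ᵥ w) • vecMulVec w w := by
  rw [Matrix.vecMulVec_mul_vecMulVec, vecMulVec_smul]

theorem trace_mul_vecMulVec_self (S : Matrix ι ι ℝ) (w : ι → ℝ) :
    (S * vecMulVec w w).trace = w ⬝ᵥ S *ᵥ w := by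
  rw [Matrix.mul_vecMulVec, Matrix.trace_vecMulVec, dotProduct_comm]

/-- Expand the cube: a rank-one V satisfies VSV = (wᵀSw)V and V² = (w·w)V, and cyclicity of the
trace merges the remaining words. -/
theorem trace_add_smul_vecMulVec_pow_three (S : Matrix ι ι ℝ) (t : ℝ) (w : ι → ℝ) :
    ((S + t • vecMulVec w w) ^ 3).trace =
      (S ^ 3).trace + 3 * t * (w ⬝ᵥ (S ^ 2) *ᵥ w) + 3 * t ^ 2 * ((w ⬝ᵥ S *ᵥ w) * (w ⬝ᵥ w))
        + t ^ 3 * (w ⬝ᵥ w) ^ 3 := by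
  set V := vecMulVec w w with hV
  have hexp : (S + t • V) ^ 3 = S ^ 3 + t • (S ^ 2 * V) + t • (S * V * S) + t • (V * S * S)
      + (t ^ 2) • (S * (V * V)) + (t ^ 2) • (V * S * V) + (t ^ 2) • ((V * V) * S)
      + (t ^ 3) • (V * V * V) := by
    simp only [pow_succ, pow_zero, one_mul, add_mul, mul_add, smul_mul_assoc, mul_smul_comm,
      smul_smul, mul_assoc, smul_add]
    abel
  have h1 : (S * V * S).trace = w ⬝ᵥ (S ^ 2) *ᵥ w := by
    rw [Matrix.trace_mul_cycle, ← pow_two, trace_mul_vecMulVec_self]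
  have h2 : (V * S * S).trace = w ⬝ᵥ (S ^ 2) *ᵥ w := by
    rw [mul_assoc, Matrix.trace_mul_comm, ← pow_two, trace_mul_vecMulVec_self]
  have hVV : V * V = (w ⬝ᵥ w) • V := vecMulVec_mul_self w
  have hVSV : V * S * V = (w ⬝ᵥ S *ᵥ w) • V := vecMulVec_mul_mul_vecMulVec w S
  have hV0 : V.trace = w ⬝ᵥ w := by rw [hV, Matrix.trace_vecMulVec]
  have h3 : (V * S).trace = w ⬝ᵥ S *ᵥ w := by
    rw [Matrix.trace_mul_comm, trace_mul_vecMulVec_self]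
  have h4 : ∀ Y : Matrix ι ι ℝ, (Y * V).trace = w ⬝ᵥ Y *ᵥ w :=
    fun Y => trace_mul_vecMulVec_self Y w
  rw [hexp, hVV, hVSV]
  simp only [Matrix.trace_add, Matrix.trace_smul, h1, h2, hVV, hV0, h3, Matrix.mul_smul,
    Matrix.smul_mul, h4, smul_eq_mul]
  ring

end RankOne

/-! ### Bordered matrices and Schur complements -/

section Bordered

variable {ι : Type*} [Fintype ι] [DecidableEq ι]

/-- The matrix `[[G, b], [bᵀ, α]]`. -/
def bordered (G : Matrix ι ι ℝ) (b : ι → ℝ) (α : ℝ) : Matrix (ι ⊕ Unit) (ι ⊕ Unit) ℝ :=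
  fromBlocks G (replicateCol Unit b) (replicateRow Unit b) (Matrix.of fun _ _ => α)

theorem isSymm_of_posDef {G : Matrix ι ι ℝ} (hG : G.PosDef) : Gᵀ = G := by
  have := hG.isHermitian
  rwa [Matrix.IsHermitian, Matrix.conjTranspose_eq_transpose_of_trivial] at this

theorem mulVec_dotProduct_of_symm {R : Matrix ι ι ℝ} (hR : Rᵀ = R) (x y : ι → ℝ) :
    (R *ᵥ x) ⬝ᵥ y = x ⬝ᵥ R *ᵥ y := by
  rw [dotProduct_mulVec, ← mulVec_transpose, hR]

/-- Complete the square: at (y, t) the form is that of G at y + tG⁻¹b plus t² times the Schur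
complement. -/
theorem bordered_posDef {G : Matrix ι ι ℝ} (hG : G.PosDef) (b : ι → ℝ) {α : ℝ}
    (hσ : 0 < α - b ⬝ᵥ G⁻¹ *ᵥ b) : (bordered G b α).PosDef := by
  have hsG := isSymm_of_posDef hG
  refine Matrix.PosDef.of_dotProduct_mulVec_pos ?_ ?_
  · rw [Matrix.IsHermitian, Matrix.conjTranspose_eq_transpose_of_trivial]
    ext (i | i) (j | j)
    · exact congrFun (congrFun hsG i) j
    · simp [bordered]
    · simp [bordered]
    · simp [bordered]
  · intro x hx
    have hdet : IsUnit G.det := (Matrix.isUnit_iff_isUnit_det G).1 hG.isUnit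
    set y : ι → ℝ := fun i => x (Sum.inl i) with hy
    set t : ℝ := x (Sum.inr ()) with ht
    have hR : (G⁻¹)ᵀ = G⁻¹ := isSymm_of_posDef hG.inv
    have hGR : G *ᵥ (G⁻¹ *ᵥ b) = b := by
      rw [mulVec_mulVec, Matrix.mul_nonsing_inv _ hdet, one_mulVec]
    have hform : star x ⬝ᵥ bordered G b α *ᵥ x =
        (y + t • (G⁻¹ *ᵥ b)) ⬝ᵥ G *ᵥ (y + t • (G⁻¹ *ᵥ b)) + t ^ 2 * (α - b ⬝ᵥ G⁻¹ *ᵥ b) := by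
      have hx' : x = Sum.elim y (fun _ => t) := by
        ext (i | i) <;> rfl
      have e1 : star x ⬝ᵥ bordered G b α *ᵥ x =
          y ⬝ᵥ G *ᵥ y + 2 * t * (y ⬝ᵥ b) + t ^ 2 * α := by
        rw [hx', bordered, fromBlocks_mulVec]
        simp only [star_trivial, sumElim_dotProduct_sumElim, Function.comp_def, Sum.elim_inl,
          Sum.elim_inr]
        have h1 : (replicateCol Unit b *ᵥ fun _ => t) = t • b := by
          ext i; simp [mulVec, dotProduct, mul_comm]
        have h2 : (replicateRow Unit b *ᵥ fun i => y i) = fun _ => b ⬝ᵥ y := by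
          ext i; simp [mulVec, dotProduct]
        rw [h1, h2]
        have h3 : ((fun _ : Unit => t) ⬝ᵥ ((fun _ => b ⬝ᵥ y) +
            (Matrix.of fun (_ : Unit) (_ : Unit) => α) *ᵥ fun _ => t)) = t * (b ⬝ᵥ y + α * t) := by
          simp [dotProduct, mulVec]
        rw [h3, dotProduct_add, dotProduct_smul, dotProduct_comm b y]
        simp only [smul_eq_mul]
        ring_nf
      rw [e1, mulVec_add, mulVec_smul, hGR, add_dotProduct, dotProduct_add, dotProduct_add,
        dotProduct_smul, smul_dotProduct, smul_dotProduct, dotProduct_smul,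
        ← mulVec_dotProduct_of_symm hsG (G⁻¹ *ᵥ b) y, hGR, dotProduct_comm b y,
        dotProduct_comm (G⁻¹ *ᵥ b) b]
      simp only [smul_eq_mul]
      ring
    rw [hform]
    have hnn : ∀ z : ι → ℝ, 0 ≤ z ⬝ᵥ G *ᵥ z := fun z => by
      simpa using hG.posSemidef.dotProduct_mulVec_nonneg z
    by_cases ht0 : t = 0
    · have hy0 : y ≠ 0 := by
        intro h0
        apply hx
        ext (i | i)
        · exact congrFun h0 i
        · exact ht0
      have := hG.dotProduct_mulVec_pos hy0
      simpa [ht0] using this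
    · have h2 : 0 < t ^ 2 * (α - b ⬝ᵥ G⁻¹ *ᵥ b) := mul_pos (by positivity) hσ
      linarith [hnn (y + t • (G⁻¹ *ᵥ b))]

/-- The block inverse is arranged as padded old inverse plus a rank-one term, which is the shape the
cubic trace expansion takes. -/
theorem bordered_inv {G : Matrix ι ι ℝ} (hG : G.PosDef) (b : ι → ℝ) {α : ℝ}
    (hσ : 0 < α - b ⬝ᵥ G⁻¹ *ᵥ b) :
    (bordered G b α)⁻¹ = fromBlocks G⁻¹ 0 0 0 + (α - b ⬝ᵥ G⁻¹ *ᵥ b)⁻¹ •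
      vecMulVec (Sum.elim (G⁻¹ *ᵥ b) (fun _ : Unit => (-1 : ℝ)))
        (Sum.elim (G⁻¹ *ᵥ b) (fun _ : Unit => (-1 : ℝ))) := by
  apply Matrix.inv_eq_right_inv
  have hdet : IsUnit G.det := (Matrix.isUnit_iff_isUnit_det G).1 hG.isUnit
  have hR : (G⁻¹)ᵀ = G⁻¹ := isSymm_of_posDef hG.inv
  set σ := α - b ⬝ᵥ G⁻¹ *ᵥ b with hσd
  have hw : bordered G b α *ᵥ (Sum.elim (G⁻¹ *ᵥ b) (fun _ : Unit => (-1 : ℝ))) =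
      Sum.elim (0 : ι → ℝ) (fun _ : Unit => -σ) := by
    rw [bordered, fromBlocks_mulVec]
    simp only [Function.comp_def, Sum.elim_inl, Sum.elim_inr]
    congr 1
    · have h1 : (replicateCol Unit b *ᵥ fun _ => (-1 : ℝ)) = -b := by
        ext i; simp [mulVec, dotProduct]
      rw [h1]
      change G *ᵥ (G⁻¹ *ᵥ b) + -b = 0
      rw [mulVec_mulVec, Matrix.mul_nonsing_inv _ hdet, one_mulVec, add_neg_cancel]
    · ext i
      simp [mulVec, dotProduct, hσd]
      ring
  rw [mul_add, Matrix.mul_smul, Matrix.mul_vecMulVec, hw, bordered, fromBlocks_multiply,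
    Matrix.mul_nonsing_inv _ hdet]
  have hrow : replicateRow Unit b * G⁻¹ = replicateRow Unit (G⁻¹ *ᵥ b) := by
    ext i j
    rw [replicateRow_apply, ← congrArg (· *ᵥ b) hR, mulVec_transpose]
    simp [Matrix.mul_apply, vecMul, dotProduct, hR]
  simp only [Matrix.mul_zero, add_zero, hrow]
  ext (i | i) (j | j)
  · simp [vecMulVec_apply, Matrix.one_apply]
  · simp [vecMulVec_apply]
  · simp only [Matrix.add_apply, fromBlocks_apply₂₁, replicateRow_apply, Matrix.smul_apply, vecMulVec_apply,
      Sum.elim_inr, Sum.elim_inl, smul_eq_mul]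
    field_simp
    simp
  · simp only [Matrix.add_apply, fromBlocks_apply₂₂, Matrix.smul_apply, vecMulVec_apply,
      Sum.elim_inr, smul_eq_mul]
    have : i = j := Subsingleton.elim _ _
    field_simp
    simp [this]

theorem trace_bordered_inv_pow_three {G : Matrix ι ι ℝ} (hG : G.PosDef) (b : ι → ℝ) {α : ℝ}
    (hσ : 0 < α - b ⬝ᵥ G⁻¹ *ᵥ b) :
    ((bordered G b α)⁻¹ ^ 3).trace = (G⁻¹ ^ 3).trace
      + 3 * (α - b ⬝ᵥ G⁻¹ *ᵥ b)⁻¹ * (b ⬝ᵥ (G⁻¹ ^ 4) *ᵥ b)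
      + 3 * (α - b ⬝ᵥ G⁻¹ *ᵥ b)⁻¹ ^ 2 *
        ((b ⬝ᵥ (G⁻¹ ^ 3) *ᵥ b) * (1 + b ⬝ᵥ (G⁻¹ ^ 2) *ᵥ b))
      + (α - b ⬝ᵥ G⁻¹ *ᵥ b)⁻¹ ^ 3 * (1 + b ⬝ᵥ (G⁻¹ ^ 2) *ᵥ b) ^ 3 := by
  rw [bordered_inv hG b hσ, trace_add_smul_vecMulVec_pow_three]
  have hR : (G⁻¹)ᵀ = G⁻¹ := isSymm_of_posDef hG.inv
  set R := G⁻¹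
  have hp2 : (fromBlocks R 0 0 0 : Matrix (ι ⊕ Unit) (ι ⊕ Unit) ℝ) ^ 2
      = fromBlocks (R ^ 2) 0 0 0 := by
    rw [pow_two, fromBlocks_multiply, pow_two]; simp
  have hp3 : (fromBlocks R 0 0 0 : Matrix (ι ⊕ Unit) (ι ⊕ Unit) ℝ) ^ 3
      = fromBlocks (R ^ 3) 0 0 0 := by
    rw [pow_succ, hp2, fromBlocks_multiply, pow_succ R 2]; simp
  have hq : ∀ S : Matrix ι ι ℝ, (Sum.elim (R *ᵥ b) (fun _ : Unit => (-1 : ℝ))) ⬝ᵥ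
      (fromBlocks S 0 0 0 : Matrix (ι ⊕ Unit) (ι ⊕ Unit) ℝ) *ᵥ
        (Sum.elim (R *ᵥ b) (fun _ : Unit => (-1 : ℝ))) = b ⬝ᵥ (R * S * R) *ᵥ b := by
    intro S
    rw [fromBlocks_mulVec, sumElim_dotProduct_sumElim]
    simp only [zero_mulVec, add_zero, dotProduct_zero, Sum.elim_comp_inl]
    rw [mulVec_dotProduct_of_symm hR, mulVec_mulVec, mulVec_mulVec]
  have hw : (Sum.elim (R *ᵥ b) (fun _ : Unit => (-1 : ℝ))) ⬝ᵥ
      (Sum.elim (R *ᵥ b) (fun _ : Unit => (-1 : ℝ))) = 1 + b ⬝ᵥ (R ^ 2) *ᵥ b := by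
    rw [sumElim_dotProduct_sumElim, mulVec_dotProduct_of_symm hR, mulVec_mulVec, ← pow_two]
    simp [dotProduct, add_comm]
  have ht : (fromBlocks (R ^ 3) 0 0 0 : Matrix (ι ⊕ Unit) (ι ⊕ Unit) ℝ).trace = (R ^ 3).trace := by
    simp [Matrix.trace]
  rw [hp2, hp3, hq, hq, hw, ht]
  have e4 : R * R ^ 2 * R = R ^ 4 := by noncomm_ring
  have e3 : R * R * R = R ^ 3 := by noncomm_ring
  rw [e4, e3]

end Bordered

/-! ### Scalar inequalities for resolvents in an eigenbasis -/

section Resolvent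

variable {ι : Type*} [Fintype ι] [DecidableEq ι]

theorem exists_orthogonal_diagonal {A : Matrix ι ι ℝ} (hA : Aᵀ = A) :
    ∃ (U : Matrix ι ι ℝ) (lam : ι → ℝ), U * Uᵀ = 1 ∧ Uᵀ * U = 1 ∧ A = U * diagonal lam * Uᵀ := by
  have hH : A.IsHermitian := by
    rw [Matrix.IsHermitian, Matrix.conjTranspose_eq_transpose_of_trivial, hA]
  refine ⟨hH.eigenvectorUnitary, hH.eigenvalues, ?_, ?_, ?_⟩
  · have := (Matrix.mem_unitaryGroup_iff).1 hH.eigenvectorUnitary.2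
    rwa [Matrix.star_eq_conjTranspose, Matrix.conjTranspose_eq_transpose_of_trivial] at this
  · have := (Matrix.mem_unitaryGroup_iff').1 hH.eigenvectorUnitary.2
    rwa [Matrix.star_eq_conjTranspose, Matrix.conjTranspose_eq_transpose_of_trivial] at this
  · have h := hH.spectral_theorem
    rw [Unitary.conjStarAlgAut_apply] at h
    rw [Matrix.star_eq_conjTranspose, Matrix.conjTranspose_eq_transpose_of_trivial] at h
    exact h

theorem diagonal_conj_pow {U : Matrix ι ι ℝ} (hU : Uᵀ * U = 1) (hU' : U * Uᵀ = 1)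
    (f : ι → ℝ) (p : ℕ) :
    (U * diagonal f * Uᵀ) ^ p = U * diagonal (fun i => f i ^ p) * Uᵀ := by
  induction p with
  | zero => simp [hU']
  | succ p ih =>
    rw [pow_succ, ih]
    calc U * diagonal (fun i => f i ^ p) * Uᵀ * (U * diagonal f * Uᵀ)
        = U * diagonal (fun i => f i ^ p) * (Uᵀ * U) * diagonal f * Uᵀ := by
          simp only [Matrix.mul_assoc]
      _ = _ := by
          rw [hU, Matrix.mul_one, Matrix.mul_assoc U, diagonal_mul_diagonal]
          simp only [pow_succ]

theorem trace_diagonal_conj {U : Matrix ι ι ℝ} (hU : Uᵀ * U = 1) (f : ι → ℝ) :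
    (U * diagonal f * Uᵀ).trace = ∑ i, f i := by
  rw [Matrix.trace_mul_comm, ← Matrix.mul_assoc, hU, Matrix.one_mul, trace_diagonal]

theorem dotProduct_diagonal_conj (U : Matrix ι ι ℝ) (f : ι → ℝ) (x : ι → ℝ) :
    x ⬝ᵥ (U * diagonal f * Uᵀ) *ᵥ x = ∑ i, f i * (Uᵀ *ᵥ x) i ^ 2 := by
  rw [← mulVec_mulVec, ← mulVec_mulVec, dotProduct_mulVec, ← mulVec_transpose]
  simp only [dotProduct, mulVec_diagonal]
  exact Finset.sum_congr rfl fun i _ => by ring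

/-- A single eigenbasis serves every level l' ≤ l and every power, so resolvents at two levels can
be compared eigenvalue by eigenvalue. -/
theorem exists_resolvent_diagonal {A : Matrix ι ι ℝ} (hA : Aᵀ = A) {l : ℝ}
    (hl : (A - l • (1 : Matrix ι ι ℝ)).PosDef) :
    ∃ (U : Matrix ι ι ℝ) (lam : ι → ℝ), Uᵀ * U = 1 ∧ (∀ i, l < lam i) ∧
      ∀ l' ≤ l, ∀ p : ℕ, ((A - l' • (1 : Matrix ι ι ℝ))⁻¹) ^ p =
        U * diagonal (fun i => ((lam i - l')⁻¹) ^ p) * Uᵀ := by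
  obtain ⟨U, lam, hU1, hU2, hAd⟩ := exists_orthogonal_diagonal hA
  have hsub : ∀ l' : ℝ, A - l' • (1 : Matrix ι ι ℝ) = U * diagonal (fun i => lam i - l') * Uᵀ := by
    intro l'
    have : diagonal (fun i => lam i - l') = diagonal lam - l' • (1 : Matrix ι ι ℝ) := by
      ext i j; by_cases h : i = j <;> simp [h, diagonal_apply, Matrix.one_apply]
    rw [this, Matrix.mul_sub, Matrix.sub_mul, ← hAd, Matrix.mul_smul, Matrix.smul_mul,
      Matrix.mul_one, hU1]
  have hlam : ∀ i, l < lam i := by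
    intro i
    -- Testing positivity on the i-th eigenvector isolates lam i - l.
    set e : ι → ℝ := U *ᵥ Pi.single i 1 with he
    have hUe : Uᵀ *ᵥ e = Pi.single i 1 := by rw [he, mulVec_mulVec, hU2, one_mulVec]
    have hne : e ≠ 0 := by
      intro h0
      rw [h0, mulVec_zero] at hUe
      have := congrFun hUe i
      simp at this
    have h1 := hl.dotProduct_mulVec_pos hne
    rw [star_trivial, hsub, dotProduct_diagonal_conj, hUe] at h1
    rw [Finset.sum_eq_single i (fun j _ hj => by simp [hj]) (by simp)] at h1
    simp at h1
    exact h1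
  refine ⟨U, lam, hU2, hlam, fun l' hl' p => ?_⟩
  have hinv : (A - l' • (1 : Matrix ι ι ℝ))⁻¹ = U * diagonal (fun i => (lam i - l')⁻¹) * Uᵀ := by
    apply Matrix.inv_eq_right_inv
    rw [hsub]
    calc U * diagonal (fun i => lam i - l') * Uᵀ * (U * diagonal (fun i => (lam i - l')⁻¹) * Uᵀ)
        = U * diagonal (fun i => lam i - l') * (Uᵀ * U) *
            diagonal (fun i => (lam i - l')⁻¹) * Uᵀ := by simp only [Matrix.mul_assoc]
      _ = _ := by
          rw [hU2, Matrix.mul_one, Matrix.mul_assoc U, diagonal_mul_diagonal]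
          have : (fun i => (lam i - l') * (lam i - l')⁻¹) = fun _ => (1 : ℝ) := by
            funext i
            exact mul_inv_cancel₀ (by linarith [hlam i])
          rw [this, diagonal_one, Matrix.mul_one, hU1]
  rw [hinv, diagonal_conj_pow hU2 hU1]

theorem posDef_sub_smul_one_mono {A : Matrix ι ι ℝ} {l l' : ℝ} (hl' : l' ≤ l)
    (hl : (A - l • (1 : Matrix ι ι ℝ)).PosDef) : (A - l' • (1 : Matrix ι ι ℝ)).PosDef := by
  have h : A - l' • (1 : Matrix ι ι ℝ) = (A - l • (1 : Matrix ι ι ℝ)) + (l - l') • 1 := by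
    rw [sub_smul]; abel
  rw [h]
  exact hl.add_posSemidef (PosSemidef.one.smul (by linarith))

/-- The convex function t⁻³ lies above its tangent at t + δ. The tr R⁴ term is the gain from
lowering the level, and it pays for the next row. -/
theorem trace_resolvent_shift {A : Matrix ι ι ℝ} (hA : Aᵀ = A) {l δ : ℝ} (hδ : 0 ≤ δ)
    (hl : (A - l • (1 : Matrix ι ι ℝ)).PosDef) :
    (((A - (l - δ) • (1 : Matrix ι ι ℝ))⁻¹) ^ 3).trace +
      3 * δ * (((A - (l - δ) • (1 : Matrix ι ι ℝ))⁻¹) ^ 4).trace ≤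
      (((A - l • (1 : Matrix ι ι ℝ))⁻¹) ^ 3).trace := by
  obtain ⟨U, lam, hU, hlam, hR⟩ := exists_resolvent_diagonal hA hl
  rw [hR _ (by linarith), hR _ (by linarith), hR _ le_rfl, trace_diagonal_conj hU,
    trace_diagonal_conj hU, trace_diagonal_conj hU, Finset.mul_sum, ← Finset.sum_add_distrib]
  refine Finset.sum_le_sum fun i _ => ?_
  have hp : 0 < lam i - l := by linarith [hlam i]
  set a := lam i - l with ha
  have hb : lam i - (l - δ) = a + δ := by rw [ha]; ring
  rw [hb]
  have h1 : (a + δ)⁻¹ ^ 3 + 3 * δ * (a + δ)⁻¹ ^ 4 = (a + 4 * δ) / (a + δ) ^ 4 := by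
    field_simp; ring
  rw [h1, inv_pow, ← one_div, div_le_div_iff₀ (by positivity) (by positivity)]
  nlinarith [mul_nonneg hp.le (pow_nonneg hδ 3), pow_nonneg hδ 4,
    mul_nonneg (sq_nonneg a) (sq_nonneg δ)]

/-- Eigenvalue by eigenvalue, r ≤ 1 + r³ and r³ ≤ 1 + r⁴ for r > 0. -/
theorem resolvent_trace_bounds {A : Matrix ι ι ℝ} (hA : Aᵀ = A) {l : ℝ}
    (hl : (A - l • (1 : Matrix ι ι ℝ)).PosDef) :
    (((A - l • (1 : Matrix ι ι ℝ))⁻¹)).trace ≤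
        Fintype.card ι + (((A - l • (1 : Matrix ι ι ℝ))⁻¹) ^ 3).trace ∧
      (((A - l • (1 : Matrix ι ι ℝ))⁻¹) ^ 3).trace ≤
        Fintype.card ι + (((A - l • (1 : Matrix ι ι ℝ))⁻¹) ^ 4).trace ∧
      0 ≤ (((A - l • (1 : Matrix ι ι ℝ))⁻¹) ^ 3).trace ∧
      0 ≤ (((A - l • (1 : Matrix ι ι ℝ))⁻¹) ^ 4).trace := by
  obtain ⟨U, lam, hU, hlam, hR⟩ := exists_resolvent_diagonal hA hl
  have h1 := hR l le_rfl 1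
  rw [pow_one] at h1
  rw [hR l le_rfl, hR l le_rfl, h1]
  simp only [trace_diagonal_conj hU, pow_one]
  have hcard : (Fintype.card ι : ℝ) = ∑ _i : ι, (1 : ℝ) := by simp
  have hr : ∀ i, 0 < (lam i - l)⁻¹ := fun i => inv_pos.2 (by linarith [hlam i])
  rw [hcard, ← Finset.sum_add_distrib, ← Finset.sum_add_distrib]
  refine ⟨Finset.sum_le_sum fun i _ => ?_, Finset.sum_le_sum fun i _ => ?_,
    Finset.sum_nonneg fun i _ => by have := hr i; positivity,
    Finset.sum_nonneg fun i _ => by have := hr i; positivity⟩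
  · set r := (lam i - l)⁻¹
    have hr0 : 0 < r := hr i
    rcases le_total r 1 with h | h
    · have : 0 ≤ r ^ 3 := by positivity
      linarith
    · have : r ≤ r ^ 3 := le_self_pow₀ h (by norm_num)
      linarith
  · set r := (lam i - l)⁻¹
    have hr0 : 0 < r := hr i
    rcases le_total r 1 with h | h
    · have : r ^ 3 ≤ 1 := pow_le_one₀ hr0.le h
      have : 0 ≤ r ^ 4 := by positivity
      linarith
    · have : r ^ 3 ≤ r ^ 4 := pow_le_pow_right₀ h (by norm_num)
      linarith

/-- The cube of one eigenvalue of the resolvent is at most the trace of the cube, so every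
eigenvalue is at most L. -/
theorem resolvent_norm_bounds {A : Matrix ι ι ℝ} (hA : Aᵀ = A) {l L : ℝ} (hL : 0 ≤ L)
    (hl : (A - l • (1 : Matrix ι ι ℝ)).PosDef)
    (hB : (((A - l • (1 : Matrix ι ι ℝ))⁻¹) ^ 3).trace ≤ L ^ 3) :
    (((A - l • (1 : Matrix ι ι ℝ))⁻¹) ^ 4).trace ≤
        L * (((A - l • (1 : Matrix ι ι ℝ))⁻¹) ^ 3).trace ∧
      ∀ x : ι → ℝ, x ⬝ᵥ ((A - l • (1 : Matrix ι ι ℝ))⁻¹ ^ 2) *ᵥ x ≤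
        L * (x ⬝ᵥ ((A - l • (1 : Matrix ι ι ℝ))⁻¹) *ᵥ x) := by
  obtain ⟨U, lam, hU, hlam, hR⟩ := exists_resolvent_diagonal hA hl
  have h1 := hR l le_rfl 1
  rw [pow_one] at h1
  rw [hR l le_rfl] at hB
  rw [hR l le_rfl, hR l le_rfl, hR l le_rfl, h1]
  simp only [trace_diagonal_conj hU, pow_one, dotProduct_diagonal_conj] at hB ⊢
  have hr : ∀ i, 0 < (lam i - l)⁻¹ := fun i => inv_pos.2 (by linarith [hlam i])
  have hrL : ∀ i, (lam i - l)⁻¹ ≤ L := by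
    intro i
    have : ((lam i - l)⁻¹) ^ 3 ≤ L ^ 3 :=
      le_trans (Finset.single_le_sum (f := fun i => ((lam i - l)⁻¹) ^ 3)
        (fun j _ => by have := hr j; positivity) (Finset.mem_univ i)) hB
    exact le_of_pow_le_pow_left₀ (by norm_num) hL this
  refine ⟨?_, fun x => ?_⟩
  · rw [Finset.mul_sum]
    refine Finset.sum_le_sum fun i _ => ?_
    have := hr i
    rw [pow_succ _ 3, mul_comm]
    exact mul_le_mul_of_nonneg_right (hrL i) (by positivity)
  · rw [Finset.mul_sum]
    refine Finset.sum_le_sum fun i _ => ?_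
    rw [← mul_assoc]
    refine mul_le_mul_of_nonneg_right ?_ (sq_nonneg _)
    rw [pow_two]
    exact mul_le_mul_of_nonneg_right (hrL i) (hr i).le

/-- Cauchy–Schwarz in the eigenbasis: the moments xᵀRᵖx are log-convex in p. -/
theorem resolvent_form_bounds {A : Matrix ι ι ℝ} (hA : Aᵀ = A) {l : ℝ}
    (hl : (A - l • (1 : Matrix ι ι ℝ)).PosDef) (x : ι → ℝ) :
    let c := fun p : ℕ => x ⬝ᵥ ((A - l • (1 : Matrix ι ι ℝ))⁻¹ ^ p) *ᵥ x
    (∀ p, 0 ≤ c p) ∧ c 2 ^ 2 ≤ c 1 * c 3 ∧ c 3 ^ 2 ≤ c 2 * c 4 := by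
  obtain ⟨U, lam, hU, hlam, hR⟩ := exists_resolvent_diagonal hA hl
  have hr : ∀ i, 0 < (lam i - l)⁻¹ := fun i => inv_pos.2 (by linarith [hlam i])
  intro c
  have hc : ∀ p, c p = ∑ i, ((lam i - l)⁻¹) ^ p * (Uᵀ *ᵥ x) i ^ 2 := by
    intro p
    simp only [c]
    rw [hR l le_rfl, dotProduct_diagonal_conj]
  refine ⟨fun p => ?_, ?_, ?_⟩
  · rw [hc]
    exact Finset.sum_nonneg fun i _ => by have := hr i; positivity
  · rw [hc, hc, hc]
    refine Finset.sum_sq_le_sum_mul_sum_of_sq_le_mul _ (fun i _ => ?_) (fun i _ => ?_)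
      (fun i _ => ?_)
    · have := hr i; positivity
    · have := hr i; positivity
    · exact le_of_eq (by ring)
  · rw [hc, hc, hc]
    refine Finset.sum_sq_le_sum_mul_sum_of_sq_le_mul _ (fun i _ => ?_) (fun i _ => ?_)
      (fun i _ => ?_)
    · have := hr i; positivity
    · have := hr i; positivity
    · exact le_of_eq (by ring)

end Resolvent

/-- Here c_p stands for bᵀRᵖb and s for the inverse Schur complement. Since c1 ≤ 1, log-convexity
gives c2² ≤ c3, c2c3 ≤ c4, c2³ ≤ c4 and c3 ≤ 1 + c4. The cubic update is then affine in c4 alone,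
whose mean and second moment are accessible. The leading constant is 4 · 64³ = 2²⁰. -/
theorem rank_one_update_scalar_bound {s c1 c2 c3 c4 : ℝ} (hs0 : 0 ≤ s) (hs : s ≤ 64)
    (h1' : c1 ≤ 1) (h2 : 0 ≤ c2) (h3 : 0 ≤ c3) (h4 : 0 ≤ c4)
    (h23 : c2 ^ 2 ≤ c1 * c3) (h34 : c3 ^ 2 ≤ c2 * c4) :
    3 * s * c4 + 3 * s ^ 2 * (c3 * (1 + c2)) + s ^ 3 * (1 + c2) ^ 3 ≤ 2 ^ 21 * (1 + c4) := by
  have e1 : c2 ^ 2 ≤ c3 := h23.trans (by nlinarith)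
  have e23 : c2 * c3 ≤ c4 := by
    rcases eq_or_lt_of_le (mul_nonneg h2 h3) with h0 | hpos
    · rw [← h0]; exact h4
    · have : (c2 * c3) * (c2 * c3) ≤ (c2 * c3) * c4 := by
        calc (c2 * c3) * (c2 * c3) = c2 ^ 2 * c3 ^ 2 := by ring
          _ ≤ c3 * (c2 * c4) := mul_le_mul e1 h34 (sq_nonneg _) h3
          _ = _ := by ring
      exact le_of_mul_le_mul_left this hpos
  have e222 : c2 ^ 3 ≤ c4 := by
    calc c2 ^ 3 = c2 * c2 ^ 2 := by ring
      _ ≤ c2 * c3 := mul_le_mul_of_nonneg_left e1 h2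
      _ ≤ c4 := e23
  have e3 : c3 ≤ 1 + c4 := by
    rcases le_total c3 1 with h | h
    · linarith
    · -- for `c3 ≥ 1`: `c3 ^ 4 ≤ c2 ^ 2 * c4 ^ 2 ≤ c3 * c4 ^ 2`
      have : c3 ^ 2 ≤ c4 ^ 2 := by
        have a1 : (c3 ^ 2) ^ 2 ≤ (c2 * c4) ^ 2 := pow_le_pow_left₀ (sq_nonneg _) h34 2
        have a2 : (c2 * c4) ^ 2 ≤ c3 * c4 ^ 2 := by
          rw [mul_pow]; exact mul_le_mul_of_nonneg_right e1 (sq_nonneg _)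
        have a3 : c3 * c3 ^ 3 ≤ c3 * c4 ^ 2 := by nlinarith
        have a4 : c3 ^ 3 ≤ c4 ^ 2 := le_of_mul_le_mul_left a3 (by linarith)
        exact (pow_le_pow_right₀ h (by norm_num)).trans a4
      have := le_of_pow_le_pow_left₀ (by norm_num) h4 this
      linarith
  have e2 : (1 + c2) ^ 3 ≤ 4 * (1 + c2 ^ 3) := by
    nlinarith [mul_nonneg (by linarith : (0:ℝ) ≤ 1 + c2) (sq_nonneg (c2 - 1))]
  have hs2 : s ^ 2 ≤ 64 ^ 2 := pow_le_pow_left₀ hs0 hs 2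
  have hs3 : s ^ 3 ≤ 64 ^ 3 := pow_le_pow_left₀ hs0 hs 3
  have f1 : s * c4 ≤ 64 * c4 := mul_le_mul_of_nonneg_right hs h4
  have f2 : s ^ 2 * (c3 * (1 + c2)) ≤ 64 ^ 2 * (1 + 2 * c4) :=
    mul_le_mul hs2 (by nlinarith) (by positivity) (by norm_num)
  have f3 : s ^ 3 * (1 + c2) ^ 3 ≤ 64 ^ 3 * (4 * (1 + c4)) :=
    mul_le_mul hs3 (by linarith) (by positivity) (by norm_num)
  linarith

/-! ### The effect of one bordering step -/

section Step

variable {ι κ : Type*} [Fintype ι] [DecidableEq ι] [Fintype κ] [DecidableEq κ]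

theorem gram_symm (X : Matrix ι κ ℝ) : (X * Xᵀ)ᵀ = X * Xᵀ := by
  rw [transpose_mul, transpose_transpose]

theorem resolvent_symm {A : Matrix ι ι ℝ} (hA : Aᵀ = A) (l : ℝ) :
    ((A - l • (1 : Matrix ι ι ℝ))⁻¹)ᵀ = (A - l • (1 : Matrix ι ι ℝ))⁻¹ := by
  rw [Matrix.transpose_nonsing_inv, transpose_sub, transpose_smul, transpose_one, hA]

/-- The effect of bordering on the cubic resolvent trace. -/
theorem trace_bordered_resolvent_le {A : Matrix ι ι ℝ} (hA : Aᵀ = A) {l : ℝ}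
    (hl : (A - l • (1 : Matrix ι ι ℝ)).PosDef) (b : ι → ℝ) (α : ℝ)
    (hσ : 1 / 64 ≤ α - b ⬝ᵥ (A - l • (1 : Matrix ι ι ℝ))⁻¹ *ᵥ b)
    (hb : b ⬝ᵥ (A - l • (1 : Matrix ι ι ℝ))⁻¹ *ᵥ b ≤ 1) :
    (bordered (A - l • (1 : Matrix ι ι ℝ)) b α).PosDef ∧
    ((bordered (A - l • (1 : Matrix ι ι ℝ)) b α)⁻¹ ^ 3).trace ≤
      ((A - l • (1 : Matrix ι ι ℝ))⁻¹ ^ 3).trace +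
        2 ^ 21 * (1 + b ⬝ᵥ ((A - l • (1 : Matrix ι ι ℝ))⁻¹ ^ 4) *ᵥ b) := by
  have hσ0 : 0 < α - b ⬝ᵥ (A - l • (1 : Matrix ι ι ℝ))⁻¹ *ᵥ b := by linarith
  refine ⟨bordered_posDef hl b hσ0, ?_⟩
  rw [trace_bordered_inv_pow_three hl b hσ0]
  obtain ⟨hnn, h23, h34⟩ := resolvent_form_bounds hA hl b
  have h1 := hnn 1
  simp only [pow_one] at h1 h23
  have := rank_one_update_scalar_bound (inv_nonneg.2 hσ0.le)
    (by rw [inv_le_comm₀ hσ0 (by norm_num)]; linarith) hb (hnn 2) (hnn 3) (hnn 4) h23 h34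
  linarith

/-- The form `Xᵀ (X Xᵀ - l)⁻¹ X` is bounded by `1 + l L` if the resolvent is bounded by `L`. -/
theorem form_resolvent_le (X : Matrix ι κ ℝ) {l L : ℝ} (hl0 : 0 ≤ l) (hL : 0 ≤ L)
    (hl : (X * Xᵀ - l • (1 : Matrix ι ι ℝ)).PosDef)
    (hB : ∀ x : ι → ℝ, x ⬝ᵥ ((X * Xᵀ - l • (1 : Matrix ι ι ℝ))⁻¹ ^ 2) *ᵥ x ≤
        L * (x ⬝ᵥ ((X * Xᵀ - l • (1 : Matrix ι ι ℝ))⁻¹) *ᵥ x)) (ξ : κ → ℝ) :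
    (X *ᵥ ξ) ⬝ᵥ ((X * Xᵀ - l • (1 : Matrix ι ι ℝ))⁻¹) *ᵥ (X *ᵥ ξ) ≤
      (1 + l * L) * (ξ ⬝ᵥ ξ) := by
  set R := (X * Xᵀ - l • (1 : Matrix ι ι ℝ))⁻¹ with hR
  have hRs : Rᵀ = R := resolvent_symm (gram_symm X) l
  have hdet : IsUnit (X * Xᵀ - l • (1 : Matrix ι ι ℝ)).det :=
    (Matrix.isUnit_iff_isUnit_det _).1 hl.isUnit
  have hRAR : R * (X * Xᵀ) * R = R + l • R ^ 2 := by
    have h1 : R * (X * Xᵀ - l • (1 : Matrix ι ι ℝ)) * R = R := by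
      rw [hR, Matrix.nonsing_inv_mul _ hdet, Matrix.one_mul]
    have h2 : R * (X * Xᵀ - l • (1 : Matrix ι ι ℝ)) * R = R * (X * Xᵀ) * R - l • R ^ 2 := by
      rw [Matrix.mul_sub, Matrix.sub_mul, Matrix.mul_smul, Matrix.smul_mul, Matrix.mul_one, pow_two]
    rw [h2] at h1
    exact sub_eq_iff_eq_add.1 h1
  set b := X *ᵥ ξ with hb
  set q := b ⬝ᵥ R *ᵥ b with hq
  set u := Xᵀ *ᵥ (R *ᵥ b) with hu
  have hq0 : 0 ≤ q := by simpa using hl.inv.posSemidef.dotProduct_mulVec_nonneg b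
  have e1 : q = ξ ⬝ᵥ u := by
    rw [hq, hu, hb, dotProduct_mulVec ξ, vecMul_transpose]
  have e2 : u ⬝ᵥ u = q + l * (b ⬝ᵥ (R ^ 2) *ᵥ b) := by
    have : u ⬝ᵥ u = b ⬝ᵥ (R * (X * Xᵀ) * R) *ᵥ b := by
      rw [← mulVec_mulVec, ← mulVec_mulVec, ← mulVec_mulVec, ← mulVec_dotProduct_of_symm hRs,
        hu, dotProduct_mulVec _ X, ← mulVec_transpose]
    rw [this, hRAR, add_mulVec, dotProduct_add, smul_mulVec, dotProduct_smul, smul_eq_mul]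
  have e3 : u ⬝ᵥ u ≤ (1 + l * L) * q := by
    rw [e2]
    nlinarith [mul_le_mul_of_nonneg_left (hB b) hl0]
  -- Since u·u ≤ (1 + lL)q, Cauchy–Schwarz bounds q² by (1 + lL)(ξ·ξ)q, and one factor q cancels.
  have cs : q ^ 2 ≤ (ξ ⬝ᵥ ξ) * (u ⬝ᵥ u) := by
    rw [e1]
    have := Finset.sum_mul_sq_le_sq_mul_sq Finset.univ ξ u
    simpa [dotProduct, pow_two] using this
  have hξ : 0 ≤ ξ ⬝ᵥ ξ := by
    simpa [dotProduct] using Finset.sum_nonneg fun i (_ : i ∈ Finset.univ) => mul_self_nonneg (ξ i)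
  rcases eq_or_lt_of_le hq0 with h0 | hpos
  · rw [← h0]; positivity
  · have : q * q ≤ q * ((1 + l * L) * (ξ ⬝ᵥ ξ)) := by nlinarith
    exact le_of_mul_le_mul_left this hpos

end Step

/-! ### Measurability and the truncated barrier potential -/

instance matrixMeasurableSpace {ι κ : Type*} : MeasurableSpace (Matrix ι κ ℝ) :=
  inferInstanceAs (MeasurableSpace (ι → κ → ℝ))

instance matrixBorelSpace {ι κ : Type*} [Countable ι] [Countable κ] :
    BorelSpace (Matrix ι κ ℝ) :=
  inferInstanceAs (BorelSpace (ι → κ → ℝ))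

section Potential

variable {ι : Type*} [Fintype ι] [DecidableEq ι]

open Classical in
/-- The truncated squared barrier potential of the symmetric matrix `A` at level `l`. -/
noncomputable def barrierPotential (W C l : ℝ) (A : Matrix ι ι ℝ) : ℝ :=
  if (A - l • (1 : Matrix ι ι ℝ)).PosDef then
    min 1 ((max 0 ((((A - l • (1 : Matrix ι ι ℝ))⁻¹) ^ 3).trace - C)) ^ 2 / W ^ 2)
  else 1

theorem barrierPotential_nonneg (W C l : ℝ) (A : Matrix ι ι ℝ) : 0 ≤ barrierPotential W C l A := by
  unfold barrierPotential
  split_ifs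
  · exact le_min zero_le_one (by positivity)
  · exact zero_le_one

theorem barrierPotential_le_one (W C l : ℝ) (A : Matrix ι ι ℝ) : barrierPotential W C l A ≤ 1 := by
  unfold barrierPotential
  split_ifs
  · exact min_le_left _ _
  · exact le_rfl

/-- Inversion is discontinuous at singular matrices. The formula det⁻¹ • adjugate, with junk value
0, is nevertheless measurable. -/
theorem measurable_matrix_inv :
    Measurable (fun A : Matrix ι ι ℝ => A⁻¹) := by
  have h : (fun A : Matrix ι ι ℝ => A⁻¹) = fun A => A.det⁻¹ • A.adjugate := by
    funext A
    rw [Matrix.inv_def, Ring.inverse_eq_inv']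
  rw [h]
  have hdet : Measurable (fun A : Matrix ι ι ℝ => A.det) :=
    (Continuous.matrix_det continuous_id).measurable
  refine measurable_pi_lambda _ fun i => measurable_pi_lambda _ fun j => ?_
  have hadj : Measurable (fun A : Matrix ι ι ℝ => A.adjugate i j) :=
    ((Continuous.matrix_adjugate continuous_id).matrix_elem i j).measurable
  exact hdet.inv.mul hadj

/-- Positive definite means positive semidefinite (a closed condition) with nonzero determinant (an
open one). -/
theorem measurableSet_posDef : MeasurableSet {A : Matrix ι ι ℝ | A.PosDef} := by
  have h : {A : Matrix ι ι ℝ | A.PosDef} =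
      ({A : Matrix ι ι ℝ | Aᵀ = A} ∩ ⋂ x : ι → ℝ, {A | 0 ≤ x ⬝ᵥ A *ᵥ x}) ∩ {A | A.det ≠ 0} := by
    ext A
    simp only [Set.mem_ofPred_eq, Set.mem_inter_iff, Set.mem_iInter]
    constructor
    · intro hA
      exact ⟨⟨isSymm_of_posDef hA, fun x => by
        simpa using hA.posSemidef.dotProduct_mulVec_nonneg x⟩,
        ((Matrix.isUnit_iff_isUnit_det A).1 hA.isUnit).ne_zero⟩
    · rintro ⟨⟨h1, h2⟩, h3⟩
      have hps : A.PosSemidef := by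
        refine Matrix.PosSemidef.of_dotProduct_mulVec_nonneg ?_ (fun x => by simpa using h2 x)
        rw [Matrix.IsHermitian, Matrix.conjTranspose_eq_transpose_of_trivial, h1]
      exact (hps.posDef_iff_isUnit).2 ((Matrix.isUnit_iff_isUnit_det A).2 h3.isUnit)
  rw [h]
  refine MeasurableSet.inter (IsClosed.measurableSet (IsClosed.inter ?_ ?_)) ?_
  · exact isClosed_eq (Continuous.matrix_transpose continuous_id) continuous_id
  · refine isClosed_iInter fun x => isClosed_le continuous_const ?_
    exact continuous_const.dotProduct (continuous_id.matrix_mulVec continuous_const)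
  · exact (isOpen_ne_fun (Continuous.matrix_det continuous_id) continuous_const).measurableSet

theorem measurable_barrierPotential (W C l : ℝ) :
    Measurable (fun A : Matrix ι ι ℝ => barrierPotential W C l A) := by
  have hsub : Measurable (fun A : Matrix ι ι ℝ => A - l • (1 : Matrix ι ι ℝ)) :=
    (continuous_id.sub continuous_const).measurable
  unfold barrierPotential
  refine Measurable.ite (hsub measurableSet_posDef) ?_ measurable_const
  have htr : Measurable (fun A : Matrix ι ι ℝ => (A ^ 3).trace) :=
    (Continuous.matrix_trace (continuous_id.pow 3)).measurable
  have := htr.comp (measurable_matrix_inv.comp hsub)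
  exact measurable_const.min (((measurable_const.max (this.sub measurable_const)).pow_const 2).div
    measurable_const)

theorem barrierPotential_reindex {ι' : Type*} [Fintype ι'] [DecidableEq ι'] (W C l : ℝ)
    (A : Matrix ι ι ℝ) (e : ι' ≃ ι) :
    barrierPotential W C l (A.submatrix e e) = barrierPotential W C l A := by
  have h1 : A.submatrix e e - l • (1 : Matrix ι' ι' ℝ) =
      (A - l • (1 : Matrix ι ι ℝ)).submatrix e e := by
    ext i j
    simp [Matrix.one_apply]
  have h2 : ((A - l • (1 : Matrix ι ι ℝ)).submatrix e e).PosDef ↔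
      (A - l • (1 : Matrix ι ι ℝ)).PosDef := by
    constructor
    · intro h
      have := h.submatrix (e := e.symm) e.symm.injective
      simpa using this
    · intro h
      exact h.submatrix e.injective
  have h3 : ∀ B : Matrix ι ι ℝ, ((B.submatrix e e) ^ 3).trace = (B ^ 3).trace := by
    intro B
    rw [pow_succ, pow_two, Matrix.submatrix_mul_equiv, Matrix.submatrix_mul_equiv,
      pow_succ, pow_two]
    simp only [Matrix.trace, Matrix.diag, Matrix.submatrix_apply]
    exact e.sum_comp (fun i => (B * B * B) i i)
  unfold barrierPotential
  rw [h1, Matrix.inv_submatrix_equiv]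
  by_cases h : (A - l • (1 : Matrix ι ι ℝ)).PosDef
  · rw [if_pos h, if_pos (h2.2 h), h3]
  · rw [if_neg h, if_neg (fun h' => h (h2.1 h'))]

end Potential

/-! ### Feature Gram matrices and moments of quadratic statistics -/

section Barrier

variable {V κ : Type*} [MeasurableSpace V] [Fintype κ] [DecidableEq κ]

/-- The matrix whose rows are the features of the points `v i`. -/
def featureMatrix {ι : Type*} (f : V → κ → ℝ) (v : ι → V) : Matrix ι κ ℝ :=
  Matrix.of fun i => f (v i)

/-- The Gram matrix of the features of the points `v i`. -/
def featureGram {ι : Type*} (f : V → κ → ℝ) (v : ι → V) : Matrix ι ι ℝ :=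
  featureMatrix f v * (featureMatrix f v)ᵀ

theorem featureGram_apply {ι : Type*} (f : V → κ → ℝ) (v : ι → V) (i j : ι) :
    featureGram f v i j = f (v i) ⬝ᵥ f (v j) := by
  simp [featureGram, featureMatrix, Matrix.mul_apply, dotProduct]

theorem featureGram_symm {ι : Type*} (f : V → κ → ℝ) (v : ι → V) :
    (featureGram f v)ᵀ = featureGram f v := by
  rw [featureGram, transpose_mul, transpose_transpose]

theorem measurable_featureGram {k : ℕ} {f : V → κ → ℝ} (hf : Measurable f) :
    Measurable (fun v : Fin k → V => featureGram f v) := by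
  refine measurable_pi_lambda _ fun i => measurable_pi_lambda _ fun j => ?_
  simp only [featureGram_apply, dotProduct]
  refine Finset.measurable_sum _ fun a _ => ?_
  exact (((measurable_pi_apply a).comp hf).comp (measurable_pi_apply i)).mul
    (((measurable_pi_apply a).comp hf).comp (measurable_pi_apply j))

/-- The equivalence putting the first index last. -/
def finSumUnitEquiv (k : ℕ) : Fin k ⊕ Unit ≃ Fin (k + 1) :=
  ((finSuccEquiv k).trans (Equiv.optionEquivSumPUnit (Fin k))).symm

@[simp] theorem finSumUnitEquiv_inl (k : ℕ) (i : Fin k) : finSumUnitEquiv k (Sum.inl i) = i.succ := by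
  simp [finSumUnitEquiv]

@[simp] theorem finSumUnitEquiv_inr (k : ℕ) (i : Unit) : finSumUnitEquiv k (Sum.inr i) = 0 := by
  simp [finSumUnitEquiv]

theorem featureGram_cons_submatrix {k : ℕ} (f : V → κ → ℝ) (v : Fin k → V) (x : V) (l : ℝ) :
    (featureGram f (Fin.cons x v : Fin (k + 1) → V)).submatrix (finSumUnitEquiv k)
        (finSumUnitEquiv k) - l • (1 : Matrix (Fin k ⊕ Unit) (Fin k ⊕ Unit) ℝ) =
      bordered (featureGram f v - l • (1 : Matrix (Fin k) (Fin k) ℝ)) (featureMatrix f v *ᵥ f x)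
        (f x ⬝ᵥ f x - l) := by
  ext (i | i) (j | j)
  · simp [bordered, featureGram_apply, Matrix.one_apply]
  · simp [bordered, featureGram_apply, featureMatrix, mulVec]
  · simp [bordered, featureGram_apply, featureMatrix, mulVec, dotProduct_comm]
  · simp [bordered, featureGram_apply]

/-- Change of the barrier potential when a row is added, on the good event. -/
theorem barrierPotential_cons_le {k : ℕ} (f : V → κ → ℝ) (v : Fin k → V) (x : V)
    {W C C' l δ E : ℝ} (hδ : 0 ≤ δ)
    (hl : (featureGram f v - l • (1 : Matrix (Fin k) (Fin k) ℝ)).PosDef)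
    (hσ : 1 / 64 ≤ f x ⬝ᵥ f x - (l - δ) - (featureMatrix f v *ᵥ f x) ⬝ᵥ
      (featureGram f v - (l - δ) • (1 : Matrix (Fin k) (Fin k) ℝ))⁻¹ *ᵥ (featureMatrix f v *ᵥ f x))
    (hb : (featureMatrix f v *ᵥ f x) ⬝ᵥ
      (featureGram f v - (l - δ) • (1 : Matrix (Fin k) (Fin k) ℝ))⁻¹ *ᵥ (featureMatrix f v *ᵥ f x)
      ≤ 1)
    (hE : 2 ^ 21 * (1 + E) ≤ 3 * δ *
        (((featureGram f v - (l - δ) • (1 : Matrix (Fin k) (Fin k) ℝ))⁻¹) ^ 4).trace + (C' - C)) :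
    barrierPotential W C' (l - δ) (featureGram f (Fin.cons x v : Fin (k + 1) → V)) ≤
      (max 0 ((((featureGram f v - l • (1 : Matrix (Fin k) (Fin k) ℝ))⁻¹) ^ 3).trace - C) +
        2 ^ 21 * ((featureMatrix f v *ᵥ f x) ⬝ᵥ
          ((featureGram f v - (l - δ) • (1 : Matrix (Fin k) (Fin k) ℝ))⁻¹ ^ 4) *ᵥ
            (featureMatrix f v *ᵥ f x) - E)) ^ 2 / W ^ 2 := by
  have hA := featureGram_symm f v
  have hl' := posDef_sub_smul_one_mono (by linarith : l - δ ≤ l) hl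
  obtain ⟨hpd, htr⟩ := trace_bordered_resolvent_le hA hl' (featureMatrix f v *ᵥ f x) _ hσ hb
  have hshift := trace_resolvent_shift hA hδ hl
  rw [← barrierPotential_reindex _ _ _ _ (finSumUnitEquiv k)]
  unfold barrierPotential
  rw [featureGram_cons_submatrix, if_pos hpd]
  refine (min_le_right _ _).trans ?_
  refine div_le_div_of_nonneg_right ?_ (sq_nonneg _)
  set Φ := (((featureGram f v - l • (1 : Matrix (Fin k) (Fin k) ℝ))⁻¹) ^ 3).trace
  rcases le_total (((bordered (featureGram f v - (l - δ) • (1 : Matrix (Fin k) (Fin k) ℝ))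
    (featureMatrix f v *ᵥ f x) (f x ⬝ᵥ f x - (l - δ)))⁻¹ ^ 3).trace - C') 0 with h0 | h0
  · rw [max_eq_left h0]
    simp only [ne_eq, OfNat.ofNat_ne_zero, not_false_eq_true, zero_pow]
    positivity
  · rw [max_eq_right h0]
    refine pow_le_pow_left₀ h0 ?_ 2
    have := le_max_right 0 (Φ - C)
    linarith

/-- Second moment bound for a sum of squares of linear statistics. -/
theorem sum_sq_moments {ι : Type*} [Fintype ι] {μ : Measure V} [IsProbabilityMeasure μ]
    {f : V → κ → ℝ} {N B : ℝ} (hB : 0 ≤ B)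
    (h4i : ∀ ℓ : κ → ℝ, Integrable (fun x => (ℓ ⬝ᵥ f x) ^ 4) μ)
    (hf : Measurable f)
    (h2 : ∀ ℓ : κ → ℝ, ∫ x, (ℓ ⬝ᵥ f x) ^ 2 ∂μ = (ℓ ⬝ᵥ ℓ) / N)
    (h4 : ∀ ℓ : κ → ℝ, ∫ x, (ℓ ⬝ᵥ f x) ^ 4 ∂μ ≤ B * ((ℓ ⬝ᵥ ℓ) / N) ^ 2)
    (ℓ : ι → κ → ℝ) :
    Integrable (fun x => (∑ i, (ℓ i ⬝ᵥ f x) ^ 2) ^ 2) μ ∧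
    Integrable (fun x => ∑ i, (ℓ i ⬝ᵥ f x) ^ 2) μ ∧
    ∫ x, ∑ i, (ℓ i ⬝ᵥ f x) ^ 2 ∂μ = (∑ i, ℓ i ⬝ᵥ ℓ i) / N ∧
    ∫ x, (∑ i, (ℓ i ⬝ᵥ f x) ^ 2) ^ 2 ∂μ ≤ B * ((∑ i, ℓ i ⬝ᵥ ℓ i) / N) ^ 2 := by
  have hm : ∀ ℓ : κ → ℝ, Measurable (fun x => ℓ ⬝ᵥ f x) := by
    intro ℓ
    simp only [dotProduct]
    exact Finset.measurable_sum _ fun a _ => measurable_const.mul ((measurable_pi_apply a).comp hf)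
  have hL : ∀ ℓ : κ → ℝ, MemLp (fun x => (ℓ ⬝ᵥ f x) ^ 2) 2 μ := by
    intro ℓ
    rw [memLp_two_iff_integrable_sq ((hm ℓ).pow_const 2).aestronglyMeasurable]
    refine (h4i ℓ).congr (ae_of_all _ fun x => ?_)
    simp only
    ring
  have hSL : MemLp (fun x => ∑ i, (ℓ i ⬝ᵥ f x) ^ 2) 2 μ :=
    memLp_finsetSum _ fun i _ => hL (ℓ i)
  have hnn : ∀ ℓ : κ → ℝ, 0 ≤ ℓ ⬝ᵥ ℓ := fun ℓ => by
    simpa [dotProduct] using Finset.sum_nonneg fun i (_ : i ∈ Finset.univ) => mul_self_nonneg (ℓ i)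
  have hnnN : ∀ ℓ : κ → ℝ, 0 ≤ (ℓ ⬝ᵥ ℓ) / N := fun ℓ => by
    rw [← h2]; exact integral_nonneg fun x => sq_nonneg _
  refine ⟨hSL.integrable_sq, hSL.integrable one_le_two, ?_, ?_⟩
  · rw [integral_finsetSum _ fun i _ => (hL (ℓ i)).integrable one_le_two]
    simp only [h2, Finset.sum_div]
  · have hprod : ∀ i j, Integrable (fun x => (ℓ i ⬝ᵥ f x) ^ 2 * (ℓ j ⬝ᵥ f x) ^ 2) μ :=
      fun i j => (hL (ℓ i)).integrable_mul (hL (ℓ j))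
    have hcs : ∀ i j, ∫ x, (ℓ i ⬝ᵥ f x) ^ 2 * (ℓ j ⬝ᵥ f x) ^ 2 ∂μ ≤
        B * ((ℓ i ⬝ᵥ ℓ i) / N * ((ℓ j ⬝ᵥ ℓ j) / N)) := by
      intro i j
      set a := (ℓ i ⬝ᵥ ℓ i) / N with ha
      set b := (ℓ j ⬝ᵥ ℓ j) / N with hb
      have ha0 : 0 ≤ a := hnnN _
      have hb0 : 0 ≤ b := hnnN _
      -- AM-GM with a free parameter
      have key : ∀ t : ℝ, 0 < t → ∫ x, (ℓ i ⬝ᵥ f x) ^ 2 * (ℓ j ⬝ᵥ f x) ^ 2 ∂μ ≤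
          B / 2 * (t * a ^ 2 + t⁻¹ * b ^ 2) := by
        intro t ht
        calc ∫ x, (ℓ i ⬝ᵥ f x) ^ 2 * (ℓ j ⬝ᵥ f x) ^ 2 ∂μ
            ≤ ∫ x, (t / 2 * (ℓ i ⬝ᵥ f x) ^ 4 + t⁻¹ / 2 * (ℓ j ⬝ᵥ f x) ^ 4) ∂μ := by
              refine integral_mono (hprod i j)
                (((h4i _).const_mul _).add ((h4i _).const_mul _)) fun x => ?_
              simp only
              have : 0 ≤ t⁻¹ / 2 * (t * (ℓ i ⬝ᵥ f x) ^ 2 - (ℓ j ⬝ᵥ f x) ^ 2) ^ 2 := by positivity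
              have e : t⁻¹ / 2 * (t * (ℓ i ⬝ᵥ f x) ^ 2 - (ℓ j ⬝ᵥ f x) ^ 2) ^ 2 =
                  t / 2 * (ℓ i ⬝ᵥ f x) ^ 4 + t⁻¹ / 2 * (ℓ j ⬝ᵥ f x) ^ 4 -
                    (ℓ i ⬝ᵥ f x) ^ 2 * (ℓ j ⬝ᵥ f x) ^ 2 := by
                field_simp; ring
              linarith
          _ = t / 2 * ∫ x, (ℓ i ⬝ᵥ f x) ^ 4 ∂μ + t⁻¹ / 2 * ∫ x, (ℓ j ⬝ᵥ f x) ^ 4 ∂μ := by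
              rw [integral_add ((h4i _).const_mul _) ((h4i _).const_mul _), integral_const_mul,
                integral_const_mul]
          _ ≤ t / 2 * (B * a ^ 2) + t⁻¹ / 2 * (B * b ^ 2) := by
              gcongr
              · exact h4 _
              · exact h4 _
          _ = _ := by ring
      -- The optimal parameter b/a is undefined when a or b vanishes, so both are raised by s and s
      -- tends to 0.
      have hlim : ∀ s : ℝ, 0 < s → ∫ x, (ℓ i ⬝ᵥ f x) ^ 2 * (ℓ j ⬝ᵥ f x) ^ 2 ∂μ ≤
          B * ((a + s) * (b + s)) := by
        intro s hs
        have has : 0 < a + s := by linarith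
        have hbs : 0 < b + s := by linarith
        refine (key ((b + s) / (a + s)) (div_pos hbs has)).trans ?_
        have h1 : (b + s) / (a + s) * a ^ 2 ≤ (b + s) / (a + s) * (a + s) ^ 2 := by
          refine mul_le_mul_of_nonneg_left (pow_le_pow_left₀ ha0 (by linarith) 2) (by positivity)
        have h2 : ((b + s) / (a + s))⁻¹ * b ^ 2 ≤ ((b + s) / (a + s))⁻¹ * (b + s) ^ 2 := by
          refine mul_le_mul_of_nonneg_left (pow_le_pow_left₀ hb0 (by linarith) 2) (by positivity)
        have h3 : (b + s) / (a + s) * (a + s) ^ 2 = (a + s) * (b + s) := by field_simp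
        have h4 : ((b + s) / (a + s))⁻¹ * (b + s) ^ 2 = (a + s) * (b + s) := by field_simp
        have h5 : (b + s) / (a + s) * a ^ 2 + ((b + s) / (a + s))⁻¹ * b ^ 2 ≤
            2 * ((a + s) * (b + s)) := by linarith
        have h6 := mul_le_mul_of_nonneg_left h5 (by positivity : (0 : ℝ) ≤ B / 2)
        linarith
      have htend : Tendsto (fun s : ℝ => B * ((a + s) * (b + s))) (𝓝[>] 0)
          (𝓝 (B * ((a + 0) * (b + 0)))) := by
        have : Continuous (fun s : ℝ => B * ((a + s) * (b + s))) := by fun_prop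
        exact (this.tendsto 0).mono_left nhdsWithin_le_nhds
      have := ge_of_tendsto htend (by
        filter_upwards [self_mem_nhdsWithin] with s hs using hlim s hs)
      simpa using this
    calc ∫ x, (∑ i, (ℓ i ⬝ᵥ f x) ^ 2) ^ 2 ∂μ
        = ∫ x, ∑ i, ∑ j, (ℓ i ⬝ᵥ f x) ^ 2 * (ℓ j ⬝ᵥ f x) ^ 2 ∂μ := by
          refine integral_congr_ae (ae_of_all _ fun x => ?_)
          simp only
          rw [pow_two, Finset.sum_mul_sum]
      _ = ∑ i, ∑ j, ∫ x, (ℓ i ⬝ᵥ f x) ^ 2 * (ℓ j ⬝ᵥ f x) ^ 2 ∂μ := by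
          rw [integral_finsetSum _ fun i _ => integrable_finsetSum _ fun j _ => hprod i j]
          refine Finset.sum_congr rfl fun i _ => ?_
          rw [integral_finsetSum _ fun j _ => hprod i j]
      _ ≤ ∑ i, ∑ j, B * ((ℓ i ⬝ᵥ ℓ i) / N * ((ℓ j ⬝ᵥ ℓ j) / N)) :=
          Finset.sum_le_sum fun i _ => Finset.sum_le_sum fun j _ => hcs i j
      _ = _ := by
          simp only [← Finset.mul_sum]
          rw [← Finset.sum_mul, pow_two, Finset.sum_div]

end Barrier

/-! ### The barrier argument for isotropic features -/

section BarrierStep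

variable {V κ : Type*} [MeasurableSpace V] [Fintype κ] [DecidableEq κ]

/-- Isotropic features at scale `N` with a fourth moment bound, and tail probability `p` for
quadratic forms of norm at most `2 L` and small trace. -/
structure IsotropicFeature (μ : Measure V) (f : V → κ → ℝ) (N L p : ℝ) : Prop where
  measurable : Measurable f
  integrable_four : ∀ ℓ : κ → ℝ, Integrable (fun x => (ℓ ⬝ᵥ f x) ^ 4) μ
  moment_two : ∀ ℓ : κ → ℝ, ∫ x, (ℓ ⬝ᵥ f x) ^ 2 ∂μ = (ℓ ⬝ᵥ ℓ) / N
  moment_four : ∀ ℓ : κ → ℝ, ∫ x, (ℓ ⬝ᵥ f x) ^ 4 ∂μ ≤ 9 * ((ℓ ⬝ᵥ ℓ) / N) ^ 2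
  tail : ∀ Q : Matrix κ κ ℝ, Q.PosSemidef → (∀ ξ : κ → ℝ, ξ ⬝ᵥ Q *ᵥ ξ ≤ 2 * L * (ξ ⬝ᵥ ξ)) →
    Q.trace ≤ N / 512 →
    μ.real {x | 1 / 64 < f x ⬝ᵥ Q *ᵥ f x ∨ f x ⬝ᵥ f x < 11 / 64} ≤ p

theorem measurable_dotProduct_feature {f : V → κ → ℝ} (hf : Measurable f) (ℓ : κ → ℝ) :
    Measurable (fun x => ℓ ⬝ᵥ f x) := by
  simp only [dotProduct]
  exact Finset.measurable_sum _ fun a _ => measurable_const.mul ((measurable_pi_apply a).comp hf)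

/-- The form that drives the update becomes a sum of squares of linear statistics of the new
feature, to which the second and fourth moment hypotheses apply. -/
theorem resolvent_form_four_eq {ι : Type*} [Fintype ι] [DecidableEq ι] (X : Matrix ι κ ℝ) (l : ℝ)
    (ξ : κ → ℝ) :
    (X *ᵥ ξ) ⬝ᵥ ((X * Xᵀ - l • (1 : Matrix ι ι ℝ))⁻¹ ^ 4) *ᵥ (X *ᵥ ξ) =
      ∑ i, (((X * Xᵀ - l • (1 : Matrix ι ι ℝ))⁻¹ ^ 2 * X : Matrix ι κ ℝ) i ⬝ᵥ ξ) ^ 2 := by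
  set R := (X * Xᵀ - l • (1 : Matrix ι ι ℝ))⁻¹ with hR
  have hRs : Rᵀ = R := resolvent_symm (gram_symm X) l
  have hR2 : (R ^ 2)ᵀ = R ^ 2 := by rw [transpose_pow, hRs]
  have h1 : R ^ 4 = R ^ 2 * R ^ 2 := by rw [← pow_add]
  rw [h1, ← mulVec_mulVec, ← mulVec_dotProduct_of_symm hR2, mulVec_mulVec]
  simp only [dotProduct, mulVec, pow_two]

/-- From XXᵀR = 1 + lR. Divided by N, this is the conditional mean of the quartic form bᵀR⁴b. -/
theorem resolvent_rows_norm {ι : Type*} [Fintype ι] [DecidableEq ι] (X : Matrix ι κ ℝ) {l : ℝ}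
    (hl : (X * Xᵀ - l • (1 : Matrix ι ι ℝ)).PosDef) :
    ∑ i, ((X * Xᵀ - l • (1 : Matrix ι ι ℝ))⁻¹ ^ 2 * X : Matrix ι κ ℝ) i ⬝ᵥ
        ((X * Xᵀ - l • (1 : Matrix ι ι ℝ))⁻¹ ^ 2 * X : Matrix ι κ ℝ) i =
      ((X * Xᵀ - l • (1 : Matrix ι ι ℝ))⁻¹ ^ 3).trace +
        l * ((X * Xᵀ - l • (1 : Matrix ι ι ℝ))⁻¹ ^ 4).trace := by
  set R := (X * Xᵀ - l • (1 : Matrix ι ι ℝ))⁻¹ with hR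
  have hRs : Rᵀ = R := resolvent_symm (gram_symm X) l
  have hdet : IsUnit (X * Xᵀ - l • (1 : Matrix ι ι ℝ)).det :=
    (Matrix.isUnit_iff_isUnit_det _).1 hl.isUnit
  have hAR : (X * Xᵀ) * R = 1 + l • R := by
    have h1 : (X * Xᵀ - l • (1 : Matrix ι ι ℝ)) * R = 1 := Matrix.mul_nonsing_inv _ hdet
    rw [Matrix.sub_mul, Matrix.smul_mul, Matrix.one_mul] at h1
    exact sub_eq_iff_eq_add.1 h1
  have h1 : ∑ i, (R ^ 2 * X : Matrix ι κ ℝ) i ⬝ᵥ (R ^ 2 * X : Matrix ι κ ℝ) i = ((R ^ 2 * X) * (R ^ 2 * X)ᵀ).trace := by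
    generalize R ^ 2 * X = Y
    simp [Matrix.trace, Matrix.mul_apply, dotProduct]
  have h2 : (R ^ 2 * X) * (R ^ 2 * X)ᵀ = R ^ 2 * ((X * Xᵀ) * R) * R := by
    rw [transpose_mul, transpose_pow, hRs, pow_two]
    simp only [Matrix.mul_assoc]
  have h3 : R ^ 2 * (1 + l • R) * R = R ^ 3 + l • R ^ 4 := by
    rw [Matrix.mul_add, Matrix.add_mul, Matrix.mul_one, Matrix.mul_smul, Matrix.smul_mul,
      ← pow_succ, ← pow_succ]
  rw [h1, h2, hAR, h3, Matrix.trace_add, Matrix.trace_smul, smul_eq_mul]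

theorem trace_resolvent_feature_form {ι : Type*} [Fintype ι] [DecidableEq ι] (X : Matrix ι κ ℝ)
    {l : ℝ} (hl : (X * Xᵀ - l • (1 : Matrix ι ι ℝ)).PosDef) :
    (Xᵀ * (X * Xᵀ - l • (1 : Matrix ι ι ℝ))⁻¹ * X).trace =
      Fintype.card ι + l * ((X * Xᵀ - l • (1 : Matrix ι ι ℝ))⁻¹).trace := by
  set R := (X * Xᵀ - l • (1 : Matrix ι ι ℝ))⁻¹ with hR
  have hdet : IsUnit (X * Xᵀ - l • (1 : Matrix ι ι ℝ)).det :=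
    (Matrix.isUnit_iff_isUnit_det _).1 hl.isUnit
  have hAR : (X * Xᵀ) * R = 1 + l • R := by
    have h1 : (X * Xᵀ - l • (1 : Matrix ι ι ℝ)) * R = 1 := Matrix.mul_nonsing_inv _ hdet
    rw [Matrix.sub_mul, Matrix.smul_mul, Matrix.one_mul] at h1
    exact sub_eq_iff_eq_add.1 h1
  rw [Matrix.trace_mul_comm, ← Matrix.mul_assoc, hAR, Matrix.trace_add, Matrix.trace_smul,
    Matrix.trace_one, smul_eq_mul]

set_option maxHeartbeats 1000000 in
-- Off a bad event of probability at most p, the excess Ψ of the cubic trace over its allowance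
-- becomes at most Ψ + 2²¹(c4 - E), where E is the mean of c4. The fluctuation is centred, so the
-- expected square grows only by its variance. The truncation at 1 absorbs the bad event and the
-- case in which the barrier has already failed.
theorem integral_barrierPotential_cons_le {μ : Measure V} [IsProbabilityMeasure μ]
    {f : V → κ → ℝ} {N L p : ℝ} (hF : IsotropicFeature μ f N L p) (hL : 1 ≤ L) (hLN : L ^ 3 = N)
    {k : ℕ} (hk : (k : ℝ) ≤ N / 2 ^ 33) {l : ℝ} (hl1 : l ≤ 9 / 64) (hl0 : 0 ≤ l - 2 ^ 21 / N)
    (v : Fin k → V) :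
    ∫ x, barrierPotential (N / 2 ^ 11) (2 ^ 22 * ((k + 1 : ℕ) : ℝ)) (l - 2 ^ 21 / N)
        (featureGram f (Fin.cons x v : Fin (k + 1) → V)) ∂μ ≤
      barrierPotential (N / 2 ^ 11) (2 ^ 22 * (k : ℝ)) l (featureGram f v) +
        (p + 36 * 2 ^ 64 * (L ^ 2 / N ^ 2)) := by
  have hN1 : 1 ≤ N := by rw [← hLN]; exact one_le_pow₀ hL
  have hN0 : 0 < N := by linarith
  have hp0 : 0 ≤ p := by
    refine le_trans measureReal_nonneg (hF.tail 0 PosSemidef.zero (fun ξ => ?_) ?_)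
    · have : 0 ≤ ξ ⬝ᵥ ξ := by
        simpa [dotProduct] using
          Finset.sum_nonneg fun i (_ : i ∈ Finset.univ) => mul_self_nonneg (ξ i)
      simp only [zero_mulVec, dotProduct_zero]
      positivity
    · simp; positivity
  set l' := l - 2 ^ 21 / N with hl'
  set W := N / 2 ^ 11 with hW
  have hW0 : 0 < W := by positivity
  have hmeas : Measurable (fun x => barrierPotential W (2 ^ 22 * ((k + 1 : ℕ) : ℝ)) l'
        (featureGram f (Fin.cons x v : Fin (k + 1) → V))) := by
    refine (measurable_barrierPotential _ _ _).comp
      ((measurable_featureGram hF.measurable).comp ?_)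
    refine measurable_pi_lambda _ fun i => ?_
    refine Fin.cases ?_ (fun j => ?_) i
    · simpa using measurable_id'
    · simp
  have hint : Integrable (fun x => barrierPotential W (2 ^ 22 * ((k + 1 : ℕ) : ℝ)) l'
        (featureGram f (Fin.cons x v : Fin (k + 1) → V))) μ := by
    refine Integrable.of_bound hmeas.aestronglyMeasurable 1 (ae_of_all _ fun x => ?_)
    rw [Real.norm_of_nonneg (barrierPotential_nonneg _ _ _ _)]
    exact barrierPotential_le_one _ _ _ _
  have hle1 : ∫ x, barrierPotential W (2 ^ 22 * ((k + 1 : ℕ) : ℝ)) l'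
        (featureGram f (Fin.cons x v : Fin (k + 1) → V)) ∂μ ≤ 1 := by
    calc _ ≤ ∫ _x, (1 : ℝ) ∂μ := integral_mono hint (integrable_const _)
          fun x => barrierPotential_le_one _ _ _ _
      _ = 1 := by simp
  have herr : 0 ≤ p + 36 * 2 ^ 64 * (L ^ 2 / N ^ 2) := by positivity
  -- Once the potential is saturated nothing is left to prove. Otherwise the level is valid and Ψ <
  -- W, which gives tr R³ ≤ 2W ≤ L³.
  by_cases hone : barrierPotential W (2 ^ 22 * (k : ℝ)) l (featureGram f v) = 1
  · rw [hone]; exact hle1.trans (le_add_of_nonneg_right herr)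
  have hpd : (featureGram f v - l • (1 : Matrix (Fin k) (Fin k) ℝ)).PosDef := by
    by_contra h
    exact hone (by unfold barrierPotential; rw [if_neg h])
  set X := featureMatrix f v with hX
  have hGX : featureGram f v = X * Xᵀ := rfl
  set Φ := (((featureGram f v - l • (1 : Matrix (Fin k) (Fin k) ℝ))⁻¹) ^ 3).trace with hΦ
  set Ψ := max 0 (Φ - 2 ^ 22 * (k : ℝ)) with hΨ
  have hΨ0 : 0 ≤ Ψ := le_max_left _ _
  have hpot : barrierPotential W (2 ^ 22 * (k : ℝ)) l (featureGram f v) = min 1 (Ψ ^ 2 / W ^ 2) := by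
    unfold barrierPotential
    rw [if_pos hpd]
  have hlt : Ψ ^ 2 / W ^ 2 < 1 := by
    by_contra h
    rw [hpot, min_eq_left (not_lt.1 h)] at hone
    exact hone rfl
  have hpot' : barrierPotential W (2 ^ 22 * (k : ℝ)) l (featureGram f v) = Ψ ^ 2 / W ^ 2 := by
    rw [hpot, min_eq_right hlt.le]
  have hΨW : Ψ < W := by
    rw [div_lt_one (by positivity)] at hlt
    exact lt_of_pow_lt_pow_left₀ 2 hW0.le hlt
  have hkW : 2 ^ 22 * (k : ℝ) ≤ W := by
    rw [hW]
    have : (2 : ℝ) ^ 22 * (k : ℝ) ≤ 2 ^ 22 * (N / 2 ^ 33) := by gcongr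
    refine this.trans (le_of_eq ?_)
    ring
  have hΦW : Φ ≤ 2 * W := by
    have := le_max_right 0 (Φ - 2 ^ 22 * (k : ℝ))
    linarith
  have hA := featureGram_symm f v
  have hδ : (0 : ℝ) ≤ 2 ^ 21 / N := by positivity
  have hpd' : (X * Xᵀ - l' • (1 : Matrix (Fin k) (Fin k) ℝ)).PosDef :=
    posDef_sub_smul_one_mono (by linarith) hpd
  have hshift : ((X * Xᵀ - l' • (1 : Matrix (Fin k) (Fin k) ℝ))⁻¹ ^ 3).trace +
      3 * (2 ^ 21 / N) * ((X * Xᵀ - l' • (1 : Matrix (Fin k) (Fin k) ℝ))⁻¹ ^ 4).trace ≤ Φ :=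
    trace_resolvent_shift hA hδ hpd
  set R := (X * Xᵀ - l' • (1 : Matrix (Fin k) (Fin k) ℝ))⁻¹ with hR
  obtain ⟨ht1, ht3, h3nn, h4nn⟩ := resolvent_trace_bounds (gram_symm X) hpd'
  rw [← hR] at ht1 ht3 h3nn h4nn
  rw [Fintype.card_fin] at ht1 ht3
  have h3Φ : (R ^ 3).trace ≤ Φ := by
    have : 0 ≤ 3 * (2 ^ 21 / N) * (R ^ 4).trace := mul_nonneg (mul_nonneg zero_le_three hδ) h4nn
    linarith
  have h3L : (R ^ 3).trace ≤ L ^ 3 := by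
    rw [hLN]
    have : 2 * W ≤ N := by rw [hW]; linarith
    linarith
  obtain ⟨h4L, h2L⟩ := resolvent_norm_bounds (gram_symm X) (by linarith) hpd' h3L
  rw [← hR] at h4L h2L
  have hl'1 : l' ≤ 9 / 64 := by linarith
  -- the expected quartic form
  set ℓ : Fin k → κ → ℝ := fun i => (R ^ 2 * X : Matrix (Fin k) κ ℝ) i with hℓ
  set c4 : V → ℝ := fun x => ∑ i, (ℓ i ⬝ᵥ f x) ^ 2 with hc4
  set E := (∑ i, ℓ i ⬝ᵥ ℓ i) / N with hE
  obtain ⟨hi2, hi1, hm1, hm2⟩ := sum_sq_moments (by norm_num) hF.integrable_four hF.measurable hF.moment_two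
    hF.moment_four ℓ
  have hrows : ∑ i, ℓ i ⬝ᵥ ℓ i = (R ^ 3).trace + l' * (R ^ 4).trace :=
    resolvent_rows_norm X hpd'
  have hE1 : N * E ≤ k + 2 * (R ^ 4).trace := by
    have h1 : N * E = (R ^ 3).trace + l' * (R ^ 4).trace := by
      rw [hE, hrows]; field_simp
    have h2 : l' * (R ^ 4).trace ≤ 1 * (R ^ 4).trace :=
      mul_le_mul_of_nonneg_right (by linarith) h4nn
    rw [h1]
    linarith
  have hE0 : 0 ≤ E := by
    rw [hE, hrows]
    exact div_nonneg (add_nonneg h3nn (mul_nonneg hl0 h4nn)) hN0.le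
  have hE2 : E ≤ 2 * L := by
    have h1 : (R ^ 4).trace ≤ L * (2 * W) :=
      h4L.trans (mul_le_mul_of_nonneg_left (h3Φ.trans hΦW) (by linarith))
    have h2 : N * E ≤ N * (2 * L) := by
      refine hE1.trans ?_
      have h3 : (k : ℝ) ≤ N * L :=
        le_trans (by linarith) (le_mul_of_one_le_right hN0.le hL)
      have h4 : 2 * (L * (2 * W)) ≤ N * L := by
        have h5 : 4 * W * L ≤ N * L := mul_le_mul_of_nonneg_right (by linarith) (by linarith)
        linarith
      linarith
    exact le_of_mul_le_mul_left h2 hN0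
  -- Compensation: E is at most 1 + 2 tr R⁴/N. The level drop 2²¹/N covers the tr R⁴ part, and the
  -- allowance of 2²² per row covers the constant part.
  have hdrift : 2 ^ 21 * (1 + E) ≤ 3 * (2 ^ 21 / N) * (R ^ 4).trace +
      (2 ^ 22 * ((k + 1 : ℕ) : ℝ) - 2 ^ 22 * (k : ℝ)) := by
    have h1 : E ≤ k / N + 2 * ((R ^ 4).trace / N) := by
      have : N * E / N ≤ (k + 2 * (R ^ 4).trace) / N := div_le_div_of_nonneg_right hE1 hN0.le
      rw [mul_div_cancel_left₀ _ hN0.ne', add_div, mul_div_assoc] at this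
      exact this
    have h2 : (k : ℝ) / N ≤ 1 := by
      rw [div_le_one hN0]; linarith
    have h3 : 3 * (2 ^ 21 / N) * (R ^ 4).trace = 2 ^ 21 * (3 * ((R ^ 4).trace / N)) := by ring
    have h4 : 0 ≤ (R ^ 4).trace / N := div_nonneg h4nn hN0.le
    rw [h3]
    push_cast
    linarith
  -- the bad event
  set Q := Xᵀ * R * X with hQ
  have hQform : ∀ ξ : κ → ℝ, ξ ⬝ᵥ Q *ᵥ ξ = (X *ᵥ ξ) ⬝ᵥ R *ᵥ (X *ᵥ ξ) := by
    intro ξ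
    rw [hQ, ← mulVec_mulVec, ← mulVec_mulVec, dotProduct_mulVec ξ Xᵀ, vecMul_transpose]
  have hQps : Q.PosSemidef := by
    have := hpd'.inv.posSemidef.conjTranspose_mul_mul_same X
    rwa [Matrix.conjTranspose_eq_transpose_of_trivial] at this
  have hQnorm : ∀ ξ : κ → ℝ, ξ ⬝ᵥ Q *ᵥ ξ ≤ 2 * L * (ξ ⬝ᵥ ξ) := by
    intro ξ
    rw [hQform]
    refine (form_resolvent_le X hl0 (by linarith) hpd' h2L ξ).trans ?_
    refine mul_le_mul_of_nonneg_right ?_ ?_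
    · have : l' * L ≤ 1 * L := mul_le_mul_of_nonneg_right (by linarith) (by linarith)
      linarith
    · simpa [dotProduct] using
        Finset.sum_nonneg fun i (_ : i ∈ Finset.univ) => mul_self_nonneg (ξ i)
  have hQtr : Q.trace ≤ N / 512 := by
    rw [hQ, hR, trace_resolvent_feature_form X hpd', ← hR, Fintype.card_fin]
    have h1 : R.trace ≤ k + 2 * W := by linarith
    have h0 : 0 ≤ R.trace := hpd'.inv.posSemidef.trace_nonneg
    have h2 : l' * R.trace ≤ 1 * R.trace := mul_le_mul_of_nonneg_right (by linarith) h0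
    have h3 : (k : ℝ) ≤ W / 2 := by linarith [(Nat.cast_nonneg k : (0 : ℝ) ≤ k)]
    have h4 : 4 * W = N / 512 := by rw [hW]; ring
    linarith
  have htail := hF.tail Q hQps hQnorm hQtr
  set bad := {x | 1 / 64 < f x ⬝ᵥ Q *ᵥ f x ∨ f x ⬝ᵥ f x < 11 / 64} with hbad
  have hfm : ∀ a, Measurable fun x => f x a := fun a => (measurable_pi_apply a).comp hF.measurable
  have hbadm : MeasurableSet bad := by
    have m1 : Measurable (fun x => f x ⬝ᵥ Q *ᵥ f x) := by
      simp only [dotProduct, mulVec]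
      exact Finset.measurable_sum _ fun a _ => (hfm a).mul
        (Finset.measurable_sum _ fun b _ => measurable_const.mul (hfm b))
    have m2 : Measurable (fun x => f x ⬝ᵥ f x) := by
      simp only [dotProduct]
      exact Finset.measurable_sum _ fun a _ => (hfm a).mul (hfm a)
    exact (measurableSet_lt measurable_const m1).union (measurableSet_lt m2 measurable_const)
  have hpoint : ∀ x, barrierPotential W (2 ^ 22 * ((k + 1 : ℕ) : ℝ)) l'
        (featureGram f (Fin.cons x v : Fin (k + 1) → V)) ≤
      bad.indicator (fun _ => (1 : ℝ)) x + (Ψ + 2 ^ 21 * (c4 x - E)) ^ 2 / W ^ 2 := by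
    intro x
    by_cases hx : x ∈ bad
    · rw [Set.indicator_of_mem hx]
      have : 0 ≤ (Ψ + 2 ^ 21 * (c4 x - E)) ^ 2 / W ^ 2 := div_nonneg (sq_nonneg _) (sq_nonneg _)
      exact (barrierPotential_le_one W (2 ^ 22 * ((k + 1 : ℕ) : ℝ)) l'
        (featureGram f (Fin.cons x v : Fin (k + 1) → V))).trans (le_add_of_nonneg_right this)
    · rw [Set.indicator_of_notMem hx, zero_add]
      have hx' : ¬ (1 / 64 < f x ⬝ᵥ Q *ᵥ f x ∨ f x ⬝ᵥ f x < 11 / 64) := hx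
      rw [not_or, not_lt, not_lt, hQform] at hx'
      -- The Schur complement on the good event is at least 11/64 - 9/64 - 1/64 = 1/64.
      have hc4x : c4 x = (X *ᵥ f x) ⬝ᵥ (R ^ 4) *ᵥ (X *ᵥ f x) := (resolvent_form_four_eq X l' _).symm
      rw [hc4x]
      exact barrierPotential_cons_le f v x hδ hpd
        (by
          change 1 / 64 ≤ f x ⬝ᵥ f x - l' - (X *ᵥ f x) ⬝ᵥ R *ᵥ (X *ᵥ f x)
          linarith [hx'.1, hx'.2])
        (by
          change (X *ᵥ f x) ⬝ᵥ R *ᵥ (X *ᵥ f x) ≤ 1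
          linarith [hx'.1]) hdrift
  have hsq : ∀ x, (Ψ + 2 ^ 21 * (c4 x - E)) ^ 2 / W ^ 2 =
      (2 ^ 42 / W ^ 2) * (c4 x) ^ 2 + (2 * 2 ^ 21 * (Ψ - 2 ^ 21 * E) / W ^ 2) * c4 x +
        (Ψ - 2 ^ 21 * E) ^ 2 / W ^ 2 := by
    intro x; ring
  have hj2 : Integrable (fun x => (2 ^ 42 / W ^ 2) * (c4 x) ^ 2) μ := hi2.const_mul _
  have hj1 : Integrable (fun x => (2 * 2 ^ 21 * (Ψ - 2 ^ 21 * E) / W ^ 2) * c4 x) μ :=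
    hi1.const_mul _
  have hj12 : Integrable (fun x => (2 ^ 42 / W ^ 2) * (c4 x) ^ 2 +
      (2 * 2 ^ 21 * (Ψ - 2 ^ 21 * E) / W ^ 2) * c4 x) μ := hj2.add hj1
  have hm1' : ∫ x, c4 x ∂μ = E := hm1
  have hisq : Integrable (fun x => (Ψ + 2 ^ 21 * (c4 x - E)) ^ 2 / W ^ 2) μ := by
    simp only [hsq]
    exact hj12.add (integrable_const _)
  have hval : ∫ x, (Ψ + 2 ^ 21 * (c4 x - E)) ^ 2 / W ^ 2 ∂μ =
      (2 ^ 42 / W ^ 2) * ∫ x, (c4 x) ^ 2 ∂μ + (2 * 2 ^ 21 * (Ψ - 2 ^ 21 * E) / W ^ 2) * E +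
        (Ψ - 2 ^ 21 * E) ^ 2 / W ^ 2 := by
    simp only [hsq]
    rw [integral_add hj12 (integrable_const _), integral_add hj2 hj1, integral_const_mul,
      integral_const_mul, hm1', integral_const]
    simp
  calc ∫ x, barrierPotential W (2 ^ 22 * ((k + 1 : ℕ) : ℝ)) l'
        (featureGram f (Fin.cons x v : Fin (k + 1) → V)) ∂μ
      ≤ ∫ x, (bad.indicator (fun _ => (1 : ℝ)) x + (Ψ + 2 ^ 21 * (c4 x - E)) ^ 2 / W ^ 2) ∂μ :=
        integral_mono hint (((integrable_const _).indicator hbadm).add hisq) hpoint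
    _ = μ.real bad + ∫ x, (Ψ + 2 ^ 21 * (c4 x - E)) ^ 2 / W ^ 2 ∂μ := by
        rw [integral_add ((integrable_const _).indicator hbadm) hisq, integral_indicator_const _ hbadm]
        simp
    _ ≤ p + (Ψ ^ 2 / W ^ 2 + 36 * 2 ^ 64 * (L ^ 2 / N ^ 2)) := by
        refine add_le_add htail ?_
        rw [hval]
        have h1 : ∫ x, (c4 x) ^ 2 ∂μ ≤ 36 * L ^ 2 := by
          refine hm2.trans ?_
          have : E ^ 2 ≤ (2 * L) ^ 2 := pow_le_pow_left₀ hE0 hE2 2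
          linarith
        have h2 : (2 ^ 42 / W ^ 2) * ∫ x, (c4 x) ^ 2 ∂μ ≤ (2 ^ 42 / W ^ 2) * (36 * L ^ 2) :=
          mul_le_mul_of_nonneg_left h1 (div_nonneg (by norm_num) (sq_nonneg _))
        -- The factor 36 is 9 · 2², from the fourth moment constant and E ≤ 2L. The power 2⁶⁴ is 2⁴²
        -- · 2²², from (2²¹)² and W = N/2¹¹.
        have h3 : (2 ^ 42 / W ^ 2) * (36 * L ^ 2) = 36 * 2 ^ 64 * (L ^ 2 / N ^ 2) := by
          rw [hW]; field_simp
        have h4 : (2 * 2 ^ 21 * (Ψ - 2 ^ 21 * E) / W ^ 2) * E + (Ψ - 2 ^ 21 * E) ^ 2 / W ^ 2 =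
            Ψ ^ 2 / W ^ 2 - 2 ^ 42 * E ^ 2 / W ^ 2 := by ring
        have h5 : 0 ≤ 2 ^ 42 * E ^ 2 / W ^ 2 :=
          div_nonneg (mul_nonneg (by norm_num) (sq_nonneg _)) (sq_nonneg _)
        linarith
    _ = _ := by rw [hpot']; ring

/-- Induction on the number of rows: each one lowers the level by 2²¹/N and raises the allowance by
2²². -/
theorem integral_barrierPotential_le {μ : Measure V} [IsProbabilityMeasure μ]
    {f : V → κ → ℝ} {N L p : ℝ} (hF : IsotropicFeature μ f N L p) (hL : 1 ≤ L) (hLN : L ^ 3 = N)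
    (k : ℕ) (hk : (k : ℝ) ≤ N / 2 ^ 33) :
    ∫ v, barrierPotential (N / 2 ^ 11) (2 ^ 22 * (k : ℝ)) (9 / 64 - k * (2 ^ 21 / N))
        (featureGram f v) ∂(Measure.pi fun _ : Fin k => μ) ≤
      k * (p + 36 * 2 ^ 64 * (L ^ 2 / N ^ 2)) := by
  have hN1 : 1 ≤ N := by rw [← hLN]; exact one_le_pow₀ hL
  have hN0 : 0 < N := by linarith
  induction k with
  | zero =>
    refine le_of_eq ?_
    have : ∀ v : Fin 0 → V, barrierPotential (N / 2 ^ 11) (2 ^ 22 * ((0 : ℕ) : ℝ))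
        (9 / 64 - (0 : ℕ) * (2 ^ 21 / N)) (featureGram f v) = 0 := by
      intro v
      unfold barrierPotential
      -- The empty matrix is positive definite at every level and has trace 0, so the potential
      -- starts at 0.
      rw [if_pos (by
        refine Matrix.PosDef.of_dotProduct_mulVec_pos (Subsingleton.elim _ _) fun x hx => ?_
        exact absurd (Subsingleton.elim x 0) hx)]
      simp [Matrix.trace]
    rw [integral_congr_ae (ae_of_all _ this)]
    simp
  | succ k ih =>
    have hk' : (k : ℝ) ≤ N / 2 ^ 33 := by
      refine le_trans ?_ hk
      push_cast; linarith
    have ih := ih hk'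
    set B : (Fin (k + 1) → V) → ℝ := fun v => barrierPotential (N / 2 ^ 11)
      (2 ^ 22 * ((k + 1 : ℕ) : ℝ)) (9 / 64 - (k + 1 : ℕ) * (2 ^ 21 / N)) (featureGram f v) with hB
    have hBm : Measurable B :=
      (measurable_barrierPotential _ _ _).comp (measurable_featureGram hF.measurable)
    have hB0m : Measurable (fun v : Fin k → V => barrierPotential (N / 2 ^ 11)
      (2 ^ 22 * (k : ℝ)) (9 / 64 - k * (2 ^ 21 / N)) (featureGram f v)) :=
      (measurable_barrierPotential _ _ _).comp (measurable_featureGram hF.measurable)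
    have hmp := (measurePreserving_piFinSuccAbove (fun _ : Fin (k + 1) => μ) 0).symm
    have h1 : ∫ v, B v ∂(Measure.pi fun _ : Fin (k + 1) => μ) =
        ∫ z : V × (Fin k → V), B (Fin.cons z.1 z.2) ∂(μ.prod (Measure.pi fun _ : Fin k => μ)) := by
      rw [← hmp.integral_comp']
      refine integral_congr_ae (ae_of_all _ fun z => ?_)
      simp only [MeasurableEquiv.piFinSuccAbove_symm_apply, Fin.insertNthEquiv_zero]
      rfl
    have hcons : Measurable (fun z : V × (Fin k → V) => (Fin.cons z.1 z.2 : Fin (k + 1) → V)) := by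
      refine measurable_pi_lambda _ fun i => ?_
      refine Fin.cases ?_ (fun j => ?_) i
      · simpa using measurable_fst
      · simp only [Fin.cons_succ]
        exact (measurable_pi_apply j).comp measurable_snd
    have hBi : Integrable (fun z : V × (Fin k → V) => B (Fin.cons z.1 z.2))
        (μ.prod (Measure.pi fun _ : Fin k => μ)) := by
      refine Integrable.of_bound (hBm.comp hcons).aestronglyMeasurable 1 (ae_of_all _ fun x => ?_)
      rw [Real.norm_of_nonneg (barrierPotential_nonneg _ _ _ _)]
      exact barrierPotential_le_one _ _ _ _
    rw [h1, integral_prod_symm _ hBi]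
    -- The total descent over N/2³³ rows is at most 2⁻¹², so the level stays nonnegative throughout.
    have hkN : (k + 1 : ℝ) * (2 ^ 21 / N) ≤ 1 / 2 ^ 12 := by
      have : (k + 1 : ℝ) ≤ N / 2 ^ 33 := by exact_mod_cast hk
      calc (k + 1 : ℝ) * (2 ^ 21 / N) ≤ N / 2 ^ 33 * (2 ^ 21 / N) := by gcongr
        _ = 1 / 2 ^ 12 := by field_simp
    have hd0 : 0 ≤ 2 ^ 21 / N := by positivity
    have hstep : ∀ v : Fin k → V, ∫ x, B (Fin.cons x v) ∂μ ≤
        barrierPotential (N / 2 ^ 11) (2 ^ 22 * (k : ℝ)) (9 / 64 - k * (2 ^ 21 / N))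
          (featureGram f v) + (p + 36 * 2 ^ 64 * (L ^ 2 / N ^ 2)) := by
      intro v
      have hlev : 9 / 64 - ((k + 1 : ℕ) : ℝ) * (2 ^ 21 / N) =
          (9 / 64 - k * (2 ^ 21 / N)) - 2 ^ 21 / N := by push_cast; ring
      simp only [hB, hlev]
      refine integral_barrierPotential_cons_le hF hL hLN hk' ?_ ?_ v
      · have : 0 ≤ (k : ℝ) * (2 ^ 21 / N) := by positivity
        linarith
      · rw [← hlev]
        push_cast
        linarith
    have hBi0 : Integrable (fun v : Fin k → V => barrierPotential (N / 2 ^ 11)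
      (2 ^ 22 * (k : ℝ)) (9 / 64 - k * (2 ^ 21 / N)) (featureGram f v))
        (Measure.pi fun _ : Fin k => μ) := by
      refine Integrable.of_bound hB0m.aestronglyMeasurable 1 (ae_of_all _ fun x => ?_)
      rw [Real.norm_of_nonneg (barrierPotential_nonneg _ _ _ _)]
      exact barrierPotential_le_one _ _ _ _
    calc ∫ v, ∫ x, B (Fin.cons x v) ∂μ ∂(Measure.pi fun _ : Fin k => μ)
        ≤ ∫ v, (barrierPotential (N / 2 ^ 11) (2 ^ 22 * (k : ℝ)) (9 / 64 - k * (2 ^ 21 / N))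
          (featureGram f v) + (p + 36 * 2 ^ 64 * (L ^ 2 / N ^ 2)))
            ∂(Measure.pi fun _ : Fin k => μ) :=
          integral_mono hBi.integral_prod_right (hBi0.add (integrable_const _)) hstep
      _ = ∫ v, barrierPotential (N / 2 ^ 11) (2 ^ 22 * (k : ℝ)) (9 / 64 - k * (2 ^ 21 / N))
          (featureGram f v) ∂(Measure.pi fun _ : Fin k => μ) +
            (p + 36 * 2 ^ 64 * (L ^ 2 / N ^ 2)) := by
          rw [integral_add hBi0 (integrable_const _)]
          simp
      _ ≤ k * (p + 36 * 2 ^ 64 * (L ^ 2 / N ^ 2)) + (p + 36 * 2 ^ 64 * (L ^ 2 / N ^ 2)) := by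
          linarith
      _ = _ := by push_cast; ring

/-- The Gram matrix of few isotropic features is bounded below with high probability. -/
theorem measure_not_posDef_featureGram_le {μ : Measure V} [IsProbabilityMeasure μ]
    {f : V → κ → ℝ} {N L p : ℝ} (hF : IsotropicFeature μ f N L p) (hL : 1 ≤ L) (hLN : L ^ 3 = N)
    (m : ℕ) (hm : (m : ℝ) ≤ N / 2 ^ 33) :
    (Measure.pi fun _ : Fin m => μ).real
        {v | ¬ (featureGram f v - (1 / 8 : ℝ) • (1 : Matrix (Fin m) (Fin m) ℝ)).PosDef} ≤
      m * (p + 36 * 2 ^ 64 * (L ^ 2 / N ^ 2)) := by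
  have hN1 : 1 ≤ N := by rw [← hLN]; exact one_le_pow₀ hL
  have hN0 : 0 < N := by linarith
  refine le_trans ?_ (integral_barrierPotential_le hF hL hLN m hm)
  set l := 9 / 64 - m * (2 ^ 21 / N) with hl
  have hl8 : 1 / 8 ≤ l := by
    have : (m : ℝ) * (2 ^ 21 / N) ≤ 1 / 2 ^ 12 := by
      calc (m : ℝ) * (2 ^ 21 / N) ≤ N / 2 ^ 33 * (2 ^ 21 / N) := by gcongr
        _ = 1 / 2 ^ 12 := by field_simp
    rw [hl]; linarith
  have hmeas : MeasurableSet
      {v : Fin m → V | ¬ (featureGram f v - (1 / 8 : ℝ) • (1 : Matrix (Fin m) (Fin m) ℝ)).PosDef} := by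
    have h1 : Measurable (fun A : Matrix (Fin m) (Fin m) ℝ =>
        A - (1 / 8 : ℝ) • (1 : Matrix (Fin m) (Fin m) ℝ)) :=
      (continuous_id.sub continuous_const).measurable
    exact ((h1.comp (measurable_featureGram hF.measurable)) measurableSet_posDef).compl
  have hBm : Measurable (fun v : Fin m → V => barrierPotential (N / 2 ^ 11)
      (2 ^ 22 * (m : ℝ)) l (featureGram f v)) :=
    (measurable_barrierPotential _ _ _).comp (measurable_featureGram hF.measurable)
  have hBi : Integrable (fun v : Fin m → V => barrierPotential (N / 2 ^ 11)
      (2 ^ 22 * (m : ℝ)) l (featureGram f v)) (Measure.pi fun _ : Fin m => μ) := by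
    refine Integrable.of_bound hBm.aestronglyMeasurable 1 (ae_of_all _ fun x => ?_)
    rw [Real.norm_of_nonneg (barrierPotential_nonneg _ _ _ _)]
    exact barrierPotential_le_one _ _ _ _
  rw [← mul_one ((Measure.pi fun _ : Fin m => μ).real _), ← smul_eq_mul,
    ← integral_indicator_const _ hmeas]
  refine integral_mono ((integrable_const _).indicator hmeas) hBi fun v => ?_
  by_cases hv : v ∈ {v : Fin m → V |
      ¬ (featureGram f v - (1 / 8 : ℝ) • (1 : Matrix (Fin m) (Fin m) ℝ)).PosDef}
  · rw [Set.indicator_of_mem hv]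
    unfold barrierPotential
    -- Failure at level 1/8 implies failure at the final level l ≥ 1/8, where the potential equals
    -- 1; the claim is then Markov's inequality.
    rw [if_neg fun h => hv (posDef_sub_smul_one_mono hl8 h)]
  · rw [Set.indicator_of_notMem hv]
    exact barrierPotential_nonneg _ _ _ _

end BarrierStep

/-! ### Standard Gaussian vectors: linear statistics and rotation invariance -/

section StdGaussianPi

variable {ι : Type*} [Fintype ι] [DecidableEq ι]

/-- The law of a vector of independent standard normal variables. -/
noncomputable def stdPi (ι : Type*) [Fintype ι] : Measure (ι → ℝ) :=
  Measure.pi fun _ => gaussianReal 0 1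

instance isProbabilityMeasure_stdPi : IsProbabilityMeasure (stdPi ι) := by
  unfold stdPi; infer_instance

theorem stdPi_map_toLp : (stdPi ι).map (WithLp.toLp 2) = stdGaussian (EuclideanSpace ℝ ι) :=
  map_pi_eq_stdGaussian

theorem stdPi_map_dotProduct (ℓ : ι → ℝ) :
    (stdPi ι).map (fun x => ℓ ⬝ᵥ x) = gaussianReal 0 (ℓ ⬝ᵥ ℓ).toNNReal := by
  set L : StrongDual ℝ (EuclideanSpace ℝ ι) := innerSL ℝ (WithLp.toLp 2 ℓ) with hL
  have h1 : (fun x : ι → ℝ => ℓ ⬝ᵥ x) = L ∘ WithLp.toLp 2 := by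
    funext x
    simp [hL, PiLp.inner_apply, dotProduct, mul_comm]
  have hn : ‖L‖ ^ 2 = ℓ ⬝ᵥ ℓ := by
    rw [hL, innerSL_apply_norm, EuclideanSpace.real_norm_sq_eq]
    simp [dotProduct, pow_two]
  rw [h1, ← Measure.map_map L.continuous.measurable (by fun_prop), stdPi_map_toLp,
    IsGaussian.map_eq_gaussianReal, integral_strongDual_stdGaussian, variance_dual_stdGaussian, hn]

/-- Fourth derivative at 0 of the moment generating function e^(t²/2). Each derivative of
p(t)e^(t²/2) has the same form, with p replaced by p' + tp. -/
theorem integral_pow_four_gaussianReal : ∫ x, x ^ 4 ∂(gaussianReal 0 1) = 3 := by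
  have hmem : (0 : ℝ) ∈ interior (integrableExpSet id (gaussianReal 0 1)) := by
    rw [integrableExpSet_id_gaussianReal]; simp
  have h := iteratedDeriv_mgf_zero hmem 4
  have e0 : mgf id (gaussianReal 0 1) = fun t => Real.exp (t ^ 2 / 2) := by
    rw [mgf_id_gaussianReal]; funext t; simp
  have key : ∀ (p q : ℝ → ℝ), (∀ t, HasDerivAt p (q t - t * p t) t) →
      deriv (fun t => p t * Real.exp (t ^ 2 / 2)) = fun t => q t * Real.exp (t ^ 2 / 2) := by
    intro p q hp
    funext t
    have h1 : HasDerivAt (fun t : ℝ => t ^ 2 / 2) t t := by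
      have := ((hasDerivAt_pow 2 t).div_const 2)
      simpa using this
    exact (((hp t).mul h1.exp).congr_deriv (by ring) : HasDerivAt _ (q t * Real.exp (t ^ 2 / 2)) t).deriv
  have d1 : deriv (fun t => Real.exp (t ^ 2 / 2)) = fun t => t * Real.exp (t ^ 2 / 2) := by
    have := key (fun _ => 1) (fun t => t) (fun t => by simpa using hasDerivAt_const t (1 : ℝ))
    simpa using this
  have d2 := key (fun t => t) (fun t => 1 + t ^ 2) (fun t =>
    (hasDerivAt_id' t).congr_deriv (by ring))
  have d3 := key (fun t => 1 + t ^ 2) (fun t => 3 * t + t ^ 3) (fun t =>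
    ((hasDerivAt_pow 2 t).const_add 1).congr_deriv (by push_cast; ring))
  have d4 := key (fun t => 3 * t + t ^ 3) (fun t => 3 + 6 * t ^ 2 + t ^ 4) (fun t =>
    (((hasDerivAt_id' t).const_mul 3).add (hasDerivAt_pow 3 t)).congr_deriv (by push_cast; ring))
  rw [e0, iteratedDeriv_succ, iteratedDeriv_succ, iteratedDeriv_succ, iteratedDeriv_succ,
    iteratedDeriv_zero, d1, d2, d3, d4] at h
  simpa using h.symm

theorem integral_pow_two_gaussianReal : ∫ x, x ^ 2 ∂(gaussianReal 0 1) = 1 := by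
  have h := variance_fun_id_gaussianReal (μ := 0) (v := 1)
  rw [variance_eq_integral aemeasurable_id'] at h
  simpa using h

theorem integrable_pow_gaussianReal (m : ℝ) (v : NNReal) (n : ℕ) :
    Integrable (fun x => x ^ n) (gaussianReal m v) := by
  have := (memLp_id_gaussianReal (μ := m) (v := v) n).integrable_norm_pow'
  refine (integrable_norm_iff (by fun_prop)).1 ?_
  refine this.congr (ae_of_all _ fun x => ?_)
  simp

theorem gaussianReal_map_std (v : NNReal) :
    gaussianReal 0 v = (gaussianReal 0 1).map (fun x => Real.sqrt v * x) := by
  rw [gaussianReal_map_const_mul]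
  congr 1
  · simp
  · ext; simp [Real.sq_sqrt]

theorem integral_pow_gaussianReal_eq (v : NNReal) (n : ℕ) :
    ∫ x, x ^ n ∂(gaussianReal 0 v) = Real.sqrt v ^ n * ∫ x, x ^ n ∂(gaussianReal 0 1) := by
  rw [gaussianReal_map_std, integral_map (by fun_prop) (by fun_prop)]
  simp only [mul_pow]
  rw [integral_const_mul]

theorem dotProduct_self_nonneg_real (ℓ : ι → ℝ) : 0 ≤ ℓ ⬝ᵥ ℓ := by
  simpa [dotProduct] using Finset.sum_nonneg fun i (_ : i ∈ Finset.univ) => mul_self_nonneg (ℓ i)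

theorem measurable_dotProduct_right (ℓ : ι → ℝ) : Measurable (fun x : ι → ℝ => ℓ ⬝ᵥ x) := by
  simp only [dotProduct]; fun_prop

theorem integrable_dotProduct_pow_stdPi (ℓ : ι → ℝ) (n : ℕ) :
    Integrable (fun x => (ℓ ⬝ᵥ x) ^ n) (stdPi ι) := by
  have h := integrable_pow_gaussianReal 0 (ℓ ⬝ᵥ ℓ).toNNReal n
  rw [← stdPi_map_dotProduct] at h
  exact h.comp_measurable (measurable_dotProduct_right ℓ)

theorem integral_dotProduct_pow_stdPi (ℓ : ι → ℝ) (n : ℕ) :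
    ∫ x, (ℓ ⬝ᵥ x) ^ n ∂(stdPi ι) = Real.sqrt (ℓ ⬝ᵥ ℓ) ^ n * ∫ x, x ^ n ∂(gaussianReal 0 1) := by
  have h := integral_pow_gaussianReal_eq (ℓ ⬝ᵥ ℓ).toNNReal n
  rw [← stdPi_map_dotProduct, integral_map (measurable_dotProduct_right ℓ).aemeasurable
    (by fun_prop), Real.coe_toNNReal _ (dotProduct_self_nonneg_real ℓ)] at h
  exact h

theorem integral_dotProduct_sq_stdPi (ℓ : ι → ℝ) :
    ∫ x, (ℓ ⬝ᵥ x) ^ 2 ∂(stdPi ι) = ℓ ⬝ᵥ ℓ := by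
  rw [integral_dotProduct_pow_stdPi, integral_pow_two_gaussianReal,
    Real.sq_sqrt (dotProduct_self_nonneg_real ℓ), mul_one]

theorem integral_dotProduct_pow_four_stdPi (ℓ : ι → ℝ) :
    ∫ x, (ℓ ⬝ᵥ x) ^ 4 ∂(stdPi ι) = 3 * (ℓ ⬝ᵥ ℓ) ^ 2 := by
  rw [integral_dotProduct_pow_stdPi, integral_pow_four_gaussianReal,
    show (4 : ℕ) = 2 * 2 from rfl, pow_mul, Real.sq_sqrt (dotProduct_self_nonneg_real ℓ)]
  ring

/-- Rotation invariance. -/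
theorem stdPi_map_mulVec {U : Matrix ι ι ℝ} (hU : U * Uᵀ = 1) :
    (stdPi ι).map (fun x => U *ᵥ x) = stdPi ι := by
  have hU2 : Measurable (fun x : ι → ℝ => U *ᵥ x) :=
    (continuous_const.matrix_mulVec continuous_id).measurable
  set e := MeasurableEquiv.toLp 2 (ι → ℝ)
  have heq : ((stdPi ι).map (fun x => U *ᵥ x)).map (WithLp.toLp 2) =
      (stdPi ι).map (WithLp.toLp 2) := by
    apply Measure.ext_of_charFun
    funext t
    rw [Measure.map_map (by fun_prop) hU2, charFun_apply, charFun_apply,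
      integral_map (by fun_prop) (by fun_prop)]
    have h1 : ∀ x : ι → ℝ, inner ℝ ((WithLp.toLp 2 ∘ fun x => U *ᵥ x) x) t =
        inner ℝ (WithLp.toLp 2 x) (WithLp.toLp 2 (Uᵀ *ᵥ (WithLp.ofLp t))) := by
      intro x
      rw [EuclideanSpace.inner_eq_star_dotProduct, EuclideanSpace.inner_eq_star_dotProduct]
      simp only [Function.comp, star_trivial]
      rw [dotProduct_mulVec, ← mulVec_transpose, dotProduct_comm]
    simp only [h1]
    have h2 : ∀ s : EuclideanSpace ℝ ι, ∫ x, Complex.exp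
        ((inner ℝ (WithLp.toLp 2 x) s : ℝ) * Complex.I) ∂(stdPi ι) =
        Complex.exp (- ‖s‖ ^ 2 / 2) := by
      intro s
      rw [← charFun_stdGaussian, ← stdPi_map_toLp, charFun_apply,
        integral_map (by fun_prop) (by fun_prop)]
    rw [h2, ← charFun_apply, stdPi_map_toLp, charFun_stdGaussian]
    congr 3
    norm_cast
    rw [EuclideanSpace.real_norm_sq_eq, EuclideanSpace.real_norm_sq_eq]
    have h3 : ∀ y : ι → ℝ, ∑ i, y i ^ 2 = y ⬝ᵥ y := fun y => by simp [dotProduct, pow_two]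
    rw [h3, h3]
    simp only
    rw [dotProduct_mulVec, ← mulVec_transpose, transpose_transpose, mulVec_mulVec, hU, one_mulVec]
  have hinj := congrArg (fun μ => μ.map e.symm) heq
  have he : ∀ μ : Measure (ι → ℝ), (μ.map (WithLp.toLp 2)).map e.symm = μ := by
    intro μ
    have := e.map_symm_map (μ := μ)
    exact this
  rwa [he, he] at hinj

end StdGaussianPi

/-! ### Exponential moments and tails of Gaussian quadratic forms -/

/-- First-order Taylor expansion of log (1 - 2t) with quadratic remainder. The left side is the
exponential moment of a squared standard normal. -/
theorem inv_sqrt_one_sub_le {t : ℝ} (ht : |t| ≤ 1 / 4) :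
    (Real.sqrt (1 - 2 * t))⁻¹ ≤ Real.exp (t + 4 * t ^ 2) := by
  obtain ⟨h1, h2⟩ := abs_le.1 ht
  have hu : |2 * t| ≤ 1 / 2 := by rw [abs_mul, abs_two]; linarith
  have hpos : 0 < 1 - 2 * t := by linarith
  have h := Real.abs_log_sub_add_sum_range_le (x := 2 * t) (by linarith) 1
  simp only [Finset.sum_range_one, zero_add, pow_one, Nat.cast_zero, div_one] at h
  have h3 : |2 * t| ^ (1 + 1) / (1 - |2 * t|) ≤ 2 * (2 * t) ^ 2 := by
    rw [div_le_iff₀ (by linarith), show (1 + 1 : ℕ) = 2 from rfl, sq_abs]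
    nlinarith [sq_nonneg (2 * t)]
  have h4 := (abs_le.1 (h.trans h3)).1
  have h5 : -(t + 4 * t ^ 2) ≤ Real.log (1 - 2 * t) / 2 := by linarith
  rw [← Real.log_sqrt hpos.le] at h5
  rw [← neg_neg (t + 4 * t ^ 2), Real.exp_neg]
  refine inv_anti₀ (Real.exp_pos _) ?_
  calc Real.exp (-(t + 4 * t ^ 2)) ≤ Real.exp (Real.log (Real.sqrt (1 - 2 * t))) :=
        Real.exp_le_exp.2 h5
    _ = _ := Real.exp_log (Real.sqrt_pos.2 hpos)

theorem integral_exp_mul_sq_gaussianReal {t : ℝ} (ht : |t| ≤ 1 / 4) :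
    Integrable (fun x => Real.exp (t * x ^ 2)) (gaussianReal 0 1) ∧
      ∫ x, Real.exp (t * x ^ 2) ∂(gaussianReal 0 1) ≤ Real.exp (t + 4 * t ^ 2) := by
  obtain ⟨h1, h2⟩ := abs_le.1 ht
  have hpos : 0 < 1 - 2 * t := by linarith
  have hval : ∫ x, Real.exp (t * x ^ 2) ∂(gaussianReal 0 1) = (Real.sqrt (1 - 2 * t))⁻¹ := by
    rw [integral_gaussianReal_eq_integral_smul one_ne_zero]
    have : ∀ x : ℝ, gaussianPDFReal 0 1 x • Real.exp (t * x ^ 2) =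
        (Real.sqrt (2 * Real.pi))⁻¹ * Real.exp (-(1 / 2 - t) * x ^ 2) := by
      intro x
      rw [gaussianPDFReal, smul_eq_mul, mul_assoc, ← Real.exp_add]
      simp only [NNReal.coe_one, mul_one, sub_zero]
      congr 2
      ring
    simp only [this]
    rw [integral_const_mul, integral_gaussian, ← Real.sqrt_inv, ← Real.sqrt_mul (by positivity),
      ← Real.sqrt_inv]
    congr 1
    have hpi := Real.pi_ne_zero
    have : 1 / 2 - t ≠ 0 := by intro h; linarith
    have h3 : (1 : ℝ) - 2 * t ≠ 0 := hpos.ne'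
    have h4 : 1 - 2 * t = 2 * (1 / 2 - t) := by ring
    rw [h4]
    field_simp
  refine ⟨?_, hval.le.trans (inv_sqrt_one_sub_le ht)⟩
  -- A non-integrable function has integral 0 by convention, which contradicts the positive value
  -- just computed.
  by_contra h
  rw [integral_undef h] at hval
  have := inv_pos.2 (Real.sqrt_pos.2 hpos)
  linarith

section MGF

variable {ι : Type*} [Fintype ι] [DecidableEq ι]

theorem integral_exp_sum_mul_sq {h : ι → ℝ} (hh : ∀ i, |h i| ≤ 1 / 4) :
    Integrable (fun x : ι → ℝ => Real.exp (∑ i, h i * x i ^ 2)) (stdPi ι) ∧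
      ∫ x, Real.exp (∑ i, h i * x i ^ 2) ∂(stdPi ι) ≤ Real.exp (∑ i, (h i + 4 * h i ^ 2)) := by
  have heq : (fun x : ι → ℝ => Real.exp (∑ i, h i * x i ^ 2)) =
      fun x => ∏ i, Real.exp (h i * x i ^ 2) := by
    funext x; rw [Real.exp_sum]
  rw [heq]
  refine ⟨Integrable.fintype_prod (f := fun i (y : ℝ) => Real.exp (h i * y ^ 2))
    fun i => (integral_exp_mul_sq_gaussianReal (hh i)).1, ?_⟩
  unfold stdPi
  rw [integral_fintype_prod_eq_prod (f := fun i (y : ℝ) => Real.exp (h i * y ^ 2)), Real.exp_sum]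
  exact Finset.prod_le_prod (fun i _ => integral_nonneg fun x => (Real.exp_pos _).le)
    fun i _ => (integral_exp_mul_sq_gaussianReal (hh i)).2

theorem eigenvalue_mem_Icc {H U : Matrix ι ι ℝ} {lam : ι → ℝ} (hU : Uᵀ * U = 1)
    (hH : H = U * diagonal lam * Uᵀ) {Λ : ℝ} (h0 : ∀ x, 0 ≤ x ⬝ᵥ H *ᵥ x)
    (hΛ : ∀ x, x ⬝ᵥ H *ᵥ x ≤ Λ * (x ⬝ᵥ x)) (i : ι) : 0 ≤ lam i ∧ lam i ≤ Λ := by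
  set e : ι → ℝ := U *ᵥ Pi.single i 1 with he
  have hUe : Uᵀ *ᵥ e = Pi.single i 1 := by rw [he, mulVec_mulVec, hU, one_mulVec]
  have h1 : e ⬝ᵥ H *ᵥ e = lam i := by
    rw [hH, dotProduct_diagonal_conj, hUe,
      Finset.sum_eq_single i (fun j _ hj => by simp [hj]) (by simp)]
    simp
  have h2 : e ⬝ᵥ e = 1 := by
    conv_lhs => rw [he]
    rw [dotProduct_mulVec, ← mulVec_transpose, hUe]
    simp
  have h3 := h0 e
  have h4 := hΛ e
  rw [h1] at h3 h4
  rw [h2] at h4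
  exact ⟨h3, by linarith⟩

/-- Rotation to the eigenbasis. -/
theorem integral_exp_quadratic {H : Matrix ι ι ℝ} (hH : Hᵀ = H) {Λ θ : ℝ}
    (h0 : ∀ x, 0 ≤ x ⬝ᵥ H *ᵥ x) (hΛ : ∀ x, x ⬝ᵥ H *ᵥ x ≤ Λ * (x ⬝ᵥ x)) (hθ : 0 ≤ θ)
    (hθΛ : θ * Λ ≤ 1 / 4) :
    Integrable (fun x : ι → ℝ => Real.exp (θ * (x ⬝ᵥ H *ᵥ x))) (stdPi ι) ∧
      ∫ x, Real.exp (θ * (x ⬝ᵥ H *ᵥ x)) ∂(stdPi ι) ≤ Real.exp (2 * θ * H.trace) := by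
  obtain ⟨U, lam, hU1, hU2, hHd⟩ := exists_orthogonal_diagonal hH
  have hlam := eigenvalue_mem_Icc hU2 hHd h0 hΛ
  have hb : ∀ i, 0 ≤ θ * lam i ∧ θ * lam i ≤ 1 / 4 := fun i =>
    ⟨mul_nonneg hθ (hlam i).1, (mul_le_mul_of_nonneg_left (hlam i).2 hθ).trans hθΛ⟩
  obtain ⟨hi, hle⟩ := integral_exp_sum_mul_sq (h := fun i => θ * lam i)
    (fun i => by rw [abs_of_nonneg (hb i).1]; exact (hb i).2)
  have hm : Measurable (fun x : ι → ℝ => Uᵀ *ᵥ x) :=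
    (continuous_const.matrix_mulVec continuous_id).measurable
  have hmap := stdPi_map_mulVec (U := Uᵀ) (by rw [transpose_transpose, hU2])
  have heq : (fun x : ι → ℝ => Real.exp (θ * (x ⬝ᵥ H *ᵥ x))) =
      (fun x : ι → ℝ => Real.exp (∑ i, θ * lam i * x i ^ 2)) ∘ fun x => Uᵀ *ᵥ x := by
    funext x
    simp only [Function.comp]
    rw [hHd, dotProduct_diagonal_conj, Finset.mul_sum]
    simp only [mul_assoc]
  have htr : H.trace = ∑ i, lam i := by rw [hHd, trace_diagonal_conj hU2]
  have hi' := hi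
  rw [← hmap] at hi'
  refine ⟨heq ▸ hi'.comp_measurable hm, ?_⟩
  calc ∫ x, Real.exp (θ * (x ⬝ᵥ H *ᵥ x)) ∂(stdPi ι)
      = ∫ x, Real.exp (∑ i, θ * lam i * x i ^ 2) ∂((stdPi ι).map (fun x => Uᵀ *ᵥ x)) := by
        rw [integral_map hm.aemeasurable hi'.aestronglyMeasurable]
        exact integral_congr_ae (ae_of_all _ fun x => congrFun heq x)
    _ = ∫ x, Real.exp (∑ i, θ * lam i * x i ^ 2) ∂(stdPi ι) := by rw [hmap]
    _ ≤ Real.exp (∑ i, (θ * lam i + 4 * (θ * lam i) ^ 2)) := hle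
    _ ≤ _ := by
        refine Real.exp_le_exp.2 ?_
        rw [htr, Finset.mul_sum]
        refine Finset.sum_le_sum fun i _ => ?_
        -- Since θλ ≤ 1/4, 4(θλ)² ≤ θλ; this is where the factor 2 in front of the trace comes from.
        nlinarith [hb i]

theorem measureReal_ge_le_exp {Ω : Type*} [MeasurableSpace Ω] {μ : Measure Ω}
    [IsProbabilityMeasure μ] {g : Ω → ℝ} {B : ℝ} (hi : Integrable (fun x => Real.exp (g x)) μ)
    (hB : ∫ x, Real.exp (g x) ∂μ ≤ Real.exp B) (a : ℝ) :
    μ.real {x | a ≤ g x} ≤ Real.exp (B - a) := by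
  have h := mul_meas_ge_le_integral_of_nonneg (μ := μ)
    (ae_of_all _ fun x => (Real.exp_pos (g x)).le) hi (Real.exp a)
  simp only [Real.exp_le_exp] at h
  rw [Real.exp_sub, le_div_iff₀ (Real.exp_pos a), mul_comm]
  exact h.trans hB

theorem stdPi_quadratic_tail {H : Matrix ι ι ℝ} (hH : Hᵀ = H) {Λ θ : ℝ}
    (h0 : ∀ x, 0 ≤ x ⬝ᵥ H *ᵥ x) (hΛ : ∀ x, x ⬝ᵥ H *ᵥ x ≤ Λ * (x ⬝ᵥ x)) (hθ : 0 < θ)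
    (hθΛ : θ * Λ ≤ 1 / 4) (a : ℝ) :
    (stdPi ι).real {x | a ≤ x ⬝ᵥ H *ᵥ x} ≤ Real.exp (2 * θ * H.trace - θ * a) := by
  obtain ⟨hi, hle⟩ := integral_exp_quadratic hH h0 hΛ hθ.le hθΛ
  have h := measureReal_ge_le_exp hi hle (θ * a)
  refine le_trans (le_of_eq ?_) h
  congr 1
  ext x
  simp only [Set.mem_ofPred_eq]
  exact (mul_le_mul_iff_right₀ hθ).symm

/-- Centring by the dimension cancels the linear term. Both signs of t are allowed, so both tails of
the squared norm follow. -/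
theorem integral_exp_normSq {t : ℝ} (ht : |t| ≤ 1 / 4) :
    Integrable (fun x : ι → ℝ => Real.exp (t * (x ⬝ᵥ x - Fintype.card ι))) (stdPi ι) ∧
      ∫ x, Real.exp (t * (x ⬝ᵥ x - Fintype.card ι)) ∂(stdPi ι) ≤
        Real.exp (4 * t ^ 2 * Fintype.card ι) := by
  obtain ⟨hi, hle⟩ := integral_exp_sum_mul_sq (ι := ι) (h := fun _ => t) (fun _ => ht)
  have heq : ∀ x : ι → ℝ, Real.exp (t * (x ⬝ᵥ x - Fintype.card ι)) =
      Real.exp (-(t * Fintype.card ι)) * Real.exp (∑ i, t * x i ^ 2) := by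
    intro x
    rw [← Real.exp_add, ← Finset.mul_sum]
    congr 1
    simp only [dotProduct, pow_two]
    ring
  simp only [heq]
  refine ⟨hi.const_mul _, ?_⟩
  rw [integral_const_mul]
  calc Real.exp (-(t * Fintype.card ι)) * ∫ x, Real.exp (∑ i, t * x i ^ 2) ∂(stdPi ι)
      ≤ Real.exp (-(t * Fintype.card ι)) * Real.exp (∑ _i : ι, (t + 4 * t ^ 2)) :=
        mul_le_mul_of_nonneg_left hle (Real.exp_pos _).le
    _ = _ := by
        rw [← Real.exp_add, Finset.sum_const, Finset.card_univ, nsmul_eq_mul]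
        congr 1
        ring

theorem stdPi_normSq_tail {a t : ℝ} (ht : |t| ≤ 1 / 4) :
    (stdPi ι).real {x | a ≤ t * (x ⬝ᵥ x - Fintype.card ι)} ≤
      Real.exp (4 * t ^ 2 * Fintype.card ι - a) :=
  measureReal_ge_le_exp (integral_exp_normSq ht).1 (integral_exp_normSq ht).2 a

end MGF

theorem IsotropicFeature.comp_measurePreserving {V W κ : Type*} [MeasurableSpace V]
    [MeasurableSpace W] [Fintype κ] [DecidableEq κ] {μ : Measure V} {ν : Measure W}
    {f : W → κ → ℝ} {N L p : ℝ} (hF : IsotropicFeature ν f N L p) {e : V → W}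
    (he : MeasurePreserving e μ ν) : IsotropicFeature μ (fun x => f (e x)) N L p where
  measurable := hF.measurable.comp he.measurable
  integrable_four ℓ := he.integrable_comp_of_integrable (hF.integrable_four ℓ)
  moment_two ℓ := by
    rw [← hF.moment_two ℓ, ← he.map_eq, integral_map he.aemeasurable]
    exact ((measurable_dotProduct_feature hF.measurable ℓ).pow_const 2).aestronglyMeasurable
  moment_four ℓ := by
    refine le_trans (le_of_eq ?_) (hF.moment_four ℓ)
    rw [← he.map_eq, integral_map he.aemeasurable]
    exact ((measurable_dotProduct_feature hF.measurable ℓ).pow_const 4).aestronglyMeasurable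
  tail Q hQ hL ht := by
    refine le_trans (le_of_eq ?_) (hF.tail Q hQ hL ht)
    have hf := hF.measurable
    have h1 : Measurable fun x => f x ⬝ᵥ Q *ᵥ f x := by
      simp only [dotProduct, mulVec]
      fun_prop
    have h2 : Measurable fun x => f x ⬝ᵥ f x := by
      simp only [dotProduct]
      fun_prop
    have hs : MeasurableSet {x | 1 / 64 < f x ⬝ᵥ Q *ᵥ f x ∨ f x ⬝ᵥ f x < 11 / 64} :=
      (measurableSet_lt measurable_const h1).union (measurableSet_lt h2 measurable_const)
    rw [← he.measureReal_preimage hs.nullMeasurableSet]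
    rfl

theorem measureReal_prod_le_of_section_le {V W : Type*} [MeasurableSpace V] [MeasurableSpace W]
    {μ : Measure V} {ν : Measure W} [IsProbabilityMeasure μ] [IsProbabilityMeasure ν]
    {s : Set (V × W)} (hs : MeasurableSet s) {c : ℝ} (hc : 0 ≤ c)
    (h : ∀ y, μ.real ((fun x => (x, y)) ⁻¹' s) ≤ c) : (μ.prod ν).real s ≤ c := by
  rw [measureReal_def]
  refine ENNReal.toReal_le_of_le_ofReal hc ?_
  rw [Measure.prod_apply_symm hs]
  calc ∫⁻ y, μ ((fun x => (x, y)) ⁻¹' s) ∂ν ≤ ∫⁻ _y, ENNReal.ofReal c ∂ν :=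
        lintegral_mono fun y => by
          rw [← ofReal_measureReal]
          exact ENNReal.ofReal_le_ofReal (h y)
    _ = ENNReal.ofReal c := by simp

/-! ### Outer products of two independent Gaussian vectors -/

section Product

variable {ι κ : Type*} [Fintype ι] [DecidableEq ι] [Fintype κ] [DecidableEq κ]

/-- The normalised outer product of a pair of vectors. -/
noncomputable def outerFeature (D : ℝ) (z : (ι → ℝ) × (κ → ℝ)) : ι × κ → ℝ :=
  fun ab => z.1 ab.1 * z.2 ab.2 / D

theorem measurable_outerFeature (D : ℝ) :
    Measurable (outerFeature D : (ι → ℝ) × (κ → ℝ) → ι × κ → ℝ) := by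
  unfold outerFeature
  fun_prop

theorem outerFeature_dotProduct (D : ℝ) (ℓ : ι × κ → ℝ) (z : (ι → ℝ) × (κ → ℝ)) :
    ℓ ⬝ᵥ outerFeature D z =
      (fun a => (fun b => ℓ (a, b)) ⬝ᵥ z.2) ⬝ᵥ z.1 / D := by
  simp only [outerFeature, dotProduct, Fintype.sum_prod_type, Finset.sum_mul, Finset.sum_div]
  refine Finset.sum_congr rfl fun a _ => Finset.sum_congr rfl fun b _ => ?_
  ring

theorem outerFeature_normSq (D : ℝ) (z : (ι → ℝ) × (κ → ℝ)) :
    outerFeature D z ⬝ᵥ outerFeature D z = (z.1 ⬝ᵥ z.1) * (z.2 ⬝ᵥ z.2) / D ^ 2 := by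
  simp only [outerFeature, dotProduct, Fintype.sum_prod_type, Finset.sum_mul_sum, Finset.sum_div]
  refine Finset.sum_congr rfl fun a _ => Finset.sum_congr rfl fun b _ => ?_
  ring

theorem dotProduct_self_prod (ℓ : ι × κ → ℝ) :
    ℓ ⬝ᵥ ℓ = ∑ a, (fun b => ℓ (a, b)) ⬝ᵥ (fun b => ℓ (a, b)) := by
  simp only [dotProduct, Fintype.sum_prod_type]

theorem stdPi_sum_sq_moments (ℓ : ι → κ → ℝ) :
    Integrable (fun y : κ → ℝ => (∑ a, (ℓ a ⬝ᵥ y) ^ 2) ^ 2) (stdPi κ) ∧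
    Integrable (fun y : κ → ℝ => ∑ a, (ℓ a ⬝ᵥ y) ^ 2) (stdPi κ) ∧
    ∫ y, ∑ a, (ℓ a ⬝ᵥ y) ^ 2 ∂(stdPi κ) = (∑ a, ℓ a ⬝ᵥ ℓ a) ∧
    ∫ y, (∑ a, (ℓ a ⬝ᵥ y) ^ 2) ^ 2 ∂(stdPi κ) ≤ 3 * (∑ a, ℓ a ⬝ᵥ ℓ a) ^ 2 := by
  have h := sum_sq_moments (μ := stdPi κ) (f := fun y => y) (N := 1) (B := 3) (by norm_num)
    (fun ℓ => integrable_dotProduct_pow_stdPi ℓ 4) measurable_id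
    (fun ℓ => by rw [integral_dotProduct_sq_stdPi, div_one])
    (fun ℓ => by rw [integral_dotProduct_pow_four_stdPi, div_one]) ℓ
  simpa only [div_one] using h

theorem integrable_outer_pow_four (D : ℝ) (ℓ : ι × κ → ℝ) :
    Integrable (fun z => (ℓ ⬝ᵥ outerFeature D z) ^ 4) ((stdPi ι).prod (stdPi κ)) := by
  have hm : Measurable fun z : (ι → ℝ) × (κ → ℝ) => (ℓ ⬝ᵥ outerFeature D z) ^ 4 :=
    (measurable_dotProduct_feature (measurable_outerFeature D) ℓ).pow_const 4
  rw [integrable_prod_iff' hm.aestronglyMeasurable]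
  simp only [outerFeature_dotProduct, div_pow]
  refine ⟨ae_of_all _ fun y => (integrable_dotProduct_pow_stdPi _ 4).div_const _, ?_⟩
  have h := ((stdPi_sum_sq_moments (fun a b => ℓ (a, b))).1.const_mul 3).div_const (D ^ 4)
  refine h.congr (ae_of_all _ fun y => ?_)
  have hn : ∀ x : ι → ℝ, ‖((fun a => (fun b => ℓ (a, b)) ⬝ᵥ y) ⬝ᵥ x) ^ 4 / D ^ 4‖ =
      ((fun a => (fun b => ℓ (a, b)) ⬝ᵥ y) ⬝ᵥ x) ^ 4 / D ^ 4 := fun x => by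
    rw [Real.norm_eq_abs, abs_of_nonneg (by positivity)]
  simp only [hn]
  rw [integral_div, integral_dotProduct_pow_four_stdPi]
  simp only [dotProduct, pow_two]

theorem integrable_outer_pow_two (D : ℝ) (ℓ : ι × κ → ℝ) :
    Integrable (fun z => (ℓ ⬝ᵥ outerFeature D z) ^ 2) ((stdPi ι).prod (stdPi κ)) := by
  have hm : Measurable fun z : (ι → ℝ) × (κ → ℝ) => (ℓ ⬝ᵥ outerFeature D z) ^ 2 :=
    (measurable_dotProduct_feature (measurable_outerFeature D) ℓ).pow_const 2
  refine ((integrable_outer_pow_four D ℓ).add (integrable_const (1 : ℝ))).mono'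
    hm.aestronglyMeasurable (ae_of_all _ fun z => ?_)
  rw [Real.norm_eq_abs, abs_of_nonneg (by positivity)]
  simp only [Pi.add_apply]
  nlinarith [sq_nonneg ((ℓ ⬝ᵥ outerFeature D z) ^ 2 - 1), sq_nonneg ((ℓ ⬝ᵥ outerFeature D z) ^ 2)]

theorem integral_outer_pow_two (D : ℝ) (ℓ : ι × κ → ℝ) :
    ∫ z, (ℓ ⬝ᵥ outerFeature D z) ^ 2 ∂((stdPi ι).prod (stdPi κ)) = (ℓ ⬝ᵥ ℓ) / D ^ 2 := by
  rw [integral_prod_symm _ (integrable_outer_pow_two D ℓ)]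
  simp only [outerFeature_dotProduct, div_pow, integral_div, integral_dotProduct_sq_stdPi]
  rw [dotProduct_self_prod ℓ, ← (stdPi_sum_sq_moments (fun a b => ℓ (a, b))).2.2.1]
  simp only [dotProduct, pow_two]

/-- The constant is 3 · 3. Given the second vector the statistic is Gaussian in the first, and its
conditional variance is a sum of squares of Gaussian statistics of the second. -/
theorem integral_outer_pow_four_le (D : ℝ) (ℓ : ι × κ → ℝ) :
    ∫ z, (ℓ ⬝ᵥ outerFeature D z) ^ 4 ∂((stdPi ι).prod (stdPi κ)) ≤
      9 * ((ℓ ⬝ᵥ ℓ) / D ^ 2) ^ 2 := by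
  rw [integral_prod_symm _ (integrable_outer_pow_four D ℓ)]
  simp only [outerFeature_dotProduct, div_pow, integral_div, integral_dotProduct_pow_four_stdPi,
    integral_const_mul]
  have h := (stdPi_sum_sq_moments (fun a b => ℓ (a, b))).2.2.2
  rw [← dotProduct_self_prod] at h
  have e : ∀ y : κ → ℝ, ((fun a => (fun b => ℓ (a, b)) ⬝ᵥ y) ⬝ᵥ
      (fun a => (fun b => ℓ (a, b)) ⬝ᵥ y)) = ∑ a, ((fun b => ℓ (a, b)) ⬝ᵥ y) ^ 2 := by
    intro y
    simp only [dotProduct, pow_two]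
  simp only [e]
  rw [← pow_mul, mul_div_assoc']
  refine div_le_div_of_nonneg_right ?_ (by positivity)
  linarith

/-- `outerFeature D (x, y) = outerSlice D y *ᵥ x`. -/
noncomputable def outerSlice (D : ℝ) (y : κ → ℝ) : Matrix (ι × κ) ι ℝ :=
  Matrix.of fun ab a => if ab.1 = a then y ab.2 / D else 0

theorem outerSlice_mulVec (D : ℝ) (x : ι → ℝ) (y : κ → ℝ) :
    outerSlice D y *ᵥ x = outerFeature D (x, y) := by
  funext ab
  simp only [outerSlice, mulVec, dotProduct, Matrix.of_apply, outerFeature, ite_mul, zero_mul,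
    Finset.sum_ite_eq, Finset.mem_univ, if_true]
  ring

theorem dotProduct_transpose_mul_mul {α β : Type*} [Fintype α] [Fintype β] (W : Matrix α β ℝ)
    (Q : Matrix α α ℝ) (x : β → ℝ) :
    x ⬝ᵥ (Wᵀ * Q * W) *ᵥ x = (W *ᵥ x) ⬝ᵥ Q *ᵥ (W *ᵥ x) := by
  rw [← mulVec_mulVec, ← mulVec_mulVec, dotProduct_mulVec x Wᵀ, vecMul_transpose]

/-- With y frozen, the form in x has a trace which is itself a quadratic form in y, given by the
partial trace of Q. The tail is therefore taken twice, first in y and then in x. -/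
theorem trace_outerSlice (D : ℝ) (y : κ → ℝ) (Q : Matrix (ι × κ) (ι × κ) ℝ) :
    Matrix.trace ((outerSlice D y : Matrix (ι × κ) ι ℝ)ᵀ * Q *
        (outerSlice D y : Matrix (ι × κ) ι ℝ) : Matrix ι ι ℝ) =
      (y ⬝ᵥ (∑ a, Q.submatrix (Prod.mk a) (Prod.mk a)) *ᵥ y) / D ^ 2 := by
  simp only [trace, diag_apply, mul_apply, transpose_apply, outerSlice, Matrix.of_apply,
    Fintype.sum_prod_type, ite_mul, zero_mul, mul_ite, mul_zero, dotProduct, mulVec,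
    Matrix.sum_apply, submatrix_apply, Finset.sum_mul, Finset.mul_sum, Finset.sum_div]
  simp only [Finset.sum_ite_irrel, Finset.sum_const_zero, Finset.sum_ite_eq', Finset.sum_ite_eq,
    Finset.mem_univ, if_true]
  simp only [Finset.sum_comm (s := (Finset.univ : Finset κ)) (t := (Finset.univ : Finset ι))]
  refine Finset.sum_congr rfl fun a _ => ?_
  rw [Finset.sum_comm]
  refine Finset.sum_congr rfl fun b _ => Finset.sum_congr rfl fun b' _ => ?_
  ring

theorem dotProduct_sum_submatrix (y : κ → ℝ) (Q : Matrix (ι × κ) (ι × κ) ℝ) :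
    y ⬝ᵥ (∑ a, Q.submatrix (Prod.mk a) (Prod.mk a)) *ᵥ y =
      ∑ a, (fun ab : ι × κ => if ab.1 = a then y ab.2 else 0) ⬝ᵥ
        Q *ᵥ (fun ab : ι × κ => if ab.1 = a then y ab.2 else 0) := by
  rw [Matrix.sum_mulVec, dotProduct_sum]
  refine Finset.sum_congr rfl fun a _ => ?_
  simp only [dotProduct, mulVec, Fintype.sum_prod_type, submatrix_apply, ite_mul, zero_mul,
    mul_ite, mul_zero, Finset.sum_ite_irrel, Finset.sum_const_zero, Finset.sum_ite_eq',
    Finset.sum_ite_eq, Finset.mem_univ, if_true]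

theorem dotProduct_self_single_row (a : ι) (y : κ → ℝ) :
    (fun ab : ι × κ => if ab.1 = a then y ab.2 else 0) ⬝ᵥ
      (fun ab : ι × κ => if ab.1 = a then y ab.2 else 0) = y ⬝ᵥ y := by
  simp only [dotProduct, Fintype.sum_prod_type, ite_mul, zero_mul,
    mul_ite, mul_zero, Finset.sum_ite_irrel, Finset.sum_const_zero, Finset.sum_ite_eq',
    Finset.sum_ite_eq, Finset.mem_univ, if_true]

theorem trace_sum_submatrix (Q : Matrix (ι × κ) (ι × κ) ℝ) :
    (∑ a, Q.submatrix (Prod.mk a) (Prod.mk a)).trace = Q.trace := by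
  rw [trace_sum]
  simp only [trace, diag_apply, submatrix_apply, Fintype.sum_prod_type]

/-- The partial trace of `Q` rarely has a large quadratic form. -/
theorem stdPi_partial_trace_tail {Q : Matrix (ι × κ) (ι × κ) ℝ} (hQ : Q.PosSemidef) {D L : ℝ}
    (hD : 0 < D) (hL : 1 ≤ L) (hι : (Fintype.card ι : ℝ) ≤ D)
    (hQL : ∀ ξ : ι × κ → ℝ, ξ ⬝ᵥ Q *ᵥ ξ ≤ 2 * L * (ξ ⬝ᵥ ξ)) (htr : Q.trace ≤ D ^ 2 / 512) :
    (stdPi κ).real {y | 3 * D ^ 2 / 512 ≤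
      y ⬝ᵥ (∑ a, Q.submatrix (Prod.mk a) (Prod.mk a)) *ᵥ y} ≤ Real.exp (-(D / (4096 * L))) := by
  have hLp : 0 < L := by linarith
  have hQs : Qᵀ = Q := by simpa [conjTranspose_eq_transpose_of_trivial] using hQ.1.eq
  -- The partial trace adds at most D blocks, each of norm at most 2L; θ is the largest value
  -- allowed, 1/(4Λ).
  have h := stdPi_quadratic_tail (H := ∑ a, Q.submatrix (Prod.mk a) (Prod.mk a))
    (Λ := 2 * L * D) (θ := 1 / (8 * L * D)) ?_ ?_ ?_ (by positivity)
    (le_of_eq (by field_simp; norm_num)) (3 * D ^ 2 / 512)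
  · refine h.trans (Real.exp_le_exp.2 ?_)
    rw [trace_sum_submatrix]
    have e : -(D / (4096 * L)) = 2 * (1 / (8 * L * D)) * (D ^ 2 / 512) -
      1 / (8 * L * D) * (3 * D ^ 2 / 512) := by field_simp; ring
    rw [e]
    gcongr
  · rw [transpose_sum]
    refine Finset.sum_congr rfl fun a _ => ?_
    rw [transpose_submatrix, hQs]
  · intro y
    rw [dotProduct_sum_submatrix]
    refine Finset.sum_nonneg fun a _ => ?_
    simpa using hQ.dotProduct_mulVec_nonneg (fun ab : ι × κ => if ab.1 = a then y ab.2 else 0)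
  · intro y
    rw [dotProduct_sum_submatrix]
    have hy := dotProduct_self_nonneg_real y
    calc _ ≤ ∑ _a : ι, 2 * L * (y ⬝ᵥ y) := Finset.sum_le_sum fun a _ => by
            rw [← dotProduct_self_single_row a y]; exact hQL _
      _ = (Fintype.card ι : ℝ) * (2 * L * (y ⬝ᵥ y)) := by
            rw [Finset.sum_const, Finset.card_univ, nsmul_eq_mul]
      _ ≤ D * (2 * L * (y ⬝ᵥ y)) := mul_le_mul_of_nonneg_right hι (by positivity)
      _ = _ := by ring

/-- Conditionally on a typical second factor, the quadratic form in the first is small. -/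
theorem stdPi_outer_quadratic_tail {Q : Matrix (ι × κ) (ι × κ) ℝ} (hQ : Q.PosSemidef) {D L : ℝ}
    (hD : 0 < D) (hL : 1 ≤ L)
    (hQL : ∀ ξ : ι × κ → ℝ, ξ ⬝ᵥ Q *ᵥ ξ ≤ 2 * L * (ξ ⬝ᵥ ξ)) {y : κ → ℝ} (hy : y ⬝ᵥ y ≤ 2 * D)
    (hyQ : y ⬝ᵥ (∑ a, Q.submatrix (Prod.mk a) (Prod.mk a)) *ᵥ y ≤ 3 * D ^ 2 / 512) :
    (stdPi ι).real {x | 1 / 64 ≤ outerFeature D (x, y) ⬝ᵥ Q *ᵥ outerFeature D (x, y)} ≤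
      Real.exp (-(D / (4096 * L))) := by
  have hLp : 0 < L := by linarith
  have hQs : Qᵀ = Q := by simpa [conjTranspose_eq_transpose_of_trivial] using hQ.1.eq
  set W : Matrix (ι × κ) ι ℝ := outerSlice D y with hW
  -- Here Λ is 2L · 2D/D² because y·y ≤ 2D, and again θ = 1/(4Λ).
  have h := stdPi_quadratic_tail (H := Wᵀ * Q * W)
    (Λ := 4 * L / D) (θ := D / (16 * L)) ?_ ?_ ?_ (by positivity)
    (le_of_eq (by field_simp; norm_num)) (1 / 64)
  · simp only [dotProduct_transpose_mul_mul, hW, outerSlice_mulVec, trace_outerSlice] at h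
    refine h.trans (Real.exp_le_exp.2 ?_)
    have e : -(D / (4096 * L)) = 2 * (D / (16 * L)) * (3 * D ^ 2 / 512 / D ^ 2) -
      D / (16 * L) * (1 / 64) := by field_simp; ring
    rw [e]
    gcongr
  · rw [transpose_mul, transpose_mul, transpose_transpose, hQs, Matrix.mul_assoc]
  · intro x
    rw [dotProduct_transpose_mul_mul]
    simpa using hQ.dotProduct_mulVec_nonneg (W *ᵥ x)
  · intro x
    rw [dotProduct_transpose_mul_mul]
    refine (hQL _).trans ?_
    rw [hW, outerSlice_mulVec, outerFeature_normSq]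
    have hx := dotProduct_self_nonneg_real x
    calc 2 * L * ((x ⬝ᵥ x) * (y ⬝ᵥ y) / D ^ 2) ≤ 2 * L * ((x ⬝ᵥ x) * (2 * D) / D ^ 2) := by gcongr
      _ = _ := by field_simp; ring

theorem stdPi_normSq_upper_tail {D : ℝ} (hκ : (Fintype.card κ : ℝ) ≤ D) :
    (stdPi κ).real {y | 2 * D ≤ y ⬝ᵥ y} ≤ Real.exp (-(D / 16)) := by
  have h := stdPi_normSq_tail (ι := κ) (a := D / 8) (t := 1 / 8)
    (by rw [abs_of_nonneg] <;> norm_num)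
  refine le_trans (measureReal_mono ?_) (h.trans (Real.exp_le_exp.2 ?_))
  · intro y (hy : 2 * D ≤ y ⬝ᵥ y)
    change D / 8 ≤ 1 / 8 * (y ⬝ᵥ y - Fintype.card κ)
    linarith
  · linarith

theorem stdPi_normSq_lower_tail {D τ : ℝ} (hτ : 0 ≤ τ) (hτ1 : τ ≤ 1)
    (hκ : (Fintype.card κ : ℝ) ≤ D) :
    (stdPi κ).real {y | y ⬝ᵥ y ≤ Fintype.card κ - τ * D} ≤ Real.exp (-(τ ^ 2 * D / 16)) := by
  have h := stdPi_normSq_tail (ι := κ) (a := τ ^ 2 * D / 8) (t := -(τ / 8))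
    (by rw [abs_neg, abs_of_nonneg] <;> linarith)
  refine le_trans (measureReal_mono ?_) (h.trans (Real.exp_le_exp.2 ?_))
  · intro y (hy : y ⬝ᵥ y ≤ Fintype.card κ - τ * D)
    change τ ^ 2 * D / 8 ≤ -(τ / 8) * (y ⬝ᵥ y - Fintype.card κ)
    nlinarith
  · have : τ ^ 2 * Fintype.card κ ≤ τ ^ 2 * D := by gcongr
    nlinarith

/-- The tail is a union of five events: large partial trace in y, large ‖y‖, small ‖y‖, small ‖x‖,
and a large form in x given a typical y. The lower norm tails with deviation 1/128 set the rate,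
since (1/128)²/16 = 2⁻¹⁸. -/
theorem isotropicFeature_outer {D L : ℝ} (hD : 0 < D) (hL : 1 ≤ L)
    (hι : (Fintype.card ι : ℝ) ≤ D) (hκ : (Fintype.card κ : ℝ) ≤ D)
    (hι' : (1 / 4 - 1 / 128) * D ≤ Fintype.card ι) (hκ' : (3 / 4 - 1 / 128) * D ≤ Fintype.card κ) :
    IsotropicFeature ((stdPi ι).prod (stdPi κ)) (outerFeature D) (D ^ 2) L
      (5 * Real.exp (-(D / (2 ^ 18 * L)))) where
  measurable := measurable_outerFeature D
  integrable_four := integrable_outer_pow_four D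
  moment_two := integral_outer_pow_two D
  moment_four := integral_outer_pow_four_le D
  tail Q hQ hQL htr := by
    have hLp : 0 < L := by linarith
    set p := Real.exp (-(D / (2 ^ 18 * L))) with hp
    have hp0 : 0 < p := Real.exp_pos _
    have hmono : ∀ q : ℝ, 0 < q → q ≤ 2 ^ 18 * L → Real.exp (-(D / q)) ≤ p := fun q h0 h1 =>
      Real.exp_le_exp.2 (neg_le_neg (div_le_div_of_nonneg_left hD.le h0 h1))
    set G := ∑ a, Q.submatrix (Prod.mk a) (Prod.mk a) with hG
    have hGm : Measurable fun y : κ → ℝ => y ⬝ᵥ G *ᵥ y := by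
      simp only [dotProduct, mulVec]; fun_prop
    have hnm : Measurable fun y : κ → ℝ => y ⬝ᵥ y := by
      simp only [dotProduct]; fun_prop
    have hfm := measurable_outerFeature (ι := ι) (κ := κ) D
    have hqm : Measurable fun z : (ι → ℝ) × (κ → ℝ) =>
        outerFeature D z ⬝ᵥ Q *ᵥ outerFeature D z := by
      simp only [dotProduct, mulVec]; fun_prop
    set S1 : Set (κ → ℝ) := {y | 3 * D ^ 2 / 512 ≤ y ⬝ᵥ G *ᵥ y} with hS1
    set S2 : Set (κ → ℝ) := {y | 2 * D ≤ y ⬝ᵥ y} with hS2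
    set S3 : Set (κ → ℝ) := {y | y ⬝ᵥ y ≤ Fintype.card κ - 1 / 128 * D} with hS3
    set S4 : Set (ι → ℝ) := {x | x ⬝ᵥ x ≤ Fintype.card ι - 1 / 128 * D} with hS4
    set S5 : Set ((ι → ℝ) × (κ → ℝ)) := {z | (z.2 ⬝ᵥ G *ᵥ z.2 ≤ 3 * D ^ 2 / 512 ∧
      z.2 ⬝ᵥ z.2 ≤ 2 * D) ∧ 1 / 64 ≤ outerFeature D z ⬝ᵥ Q *ᵥ outerFeature D z} with hS5
    have hS5m : MeasurableSet S5 :=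
      ((measurableSet_le (hGm.comp measurable_snd) measurable_const).inter
        (measurableSet_le (hnm.comp measurable_snd) measurable_const)).inter
        (measurableSet_le measurable_const hqm)
    have hsnd : ∀ S : Set (κ → ℝ), ((stdPi ι).prod (stdPi κ)).real (Prod.snd ⁻¹' S) =
        (stdPi κ).real S := fun S => by
      have : (Prod.snd ⁻¹' S : Set ((ι → ℝ) × (κ → ℝ))) = Set.univ ×ˢ S := by ext; simp
      rw [this, measureReal_prod_prod]; simp
    have hfst : ∀ S : Set (ι → ℝ), ((stdPi ι).prod (stdPi κ)).real (Prod.fst ⁻¹' S) =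
        (stdPi ι).real S := fun S => by
      have : (Prod.fst ⁻¹' S : Set ((ι → ℝ) × (κ → ℝ))) = S ×ˢ Set.univ := by ext; simp
      rw [this, measureReal_prod_prod]; simp
    have b1 : (stdPi κ).real S1 ≤ p :=
      (stdPi_partial_trace_tail hQ hD hL hι hQL htr).trans
        (hmono _ (by positivity) (by nlinarith))
    have b2 : (stdPi κ).real S2 ≤ p :=
      (stdPi_normSq_upper_tail hκ).trans (hmono _ (by norm_num) (by nlinarith))
    have e18 : (1 / 128 : ℝ) ^ 2 * D / 16 = D / 2 ^ 18 := by ring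
    have b3 : (stdPi κ).real S3 ≤ p := by
      refine (stdPi_normSq_lower_tail (by norm_num) (by norm_num) hκ).trans ?_
      rw [e18]
      exact hmono _ (by norm_num) (by nlinarith)
    have b4 : (stdPi ι).real S4 ≤ p := by
      refine (stdPi_normSq_lower_tail (by norm_num) (by norm_num) hι).trans ?_
      rw [e18]
      exact hmono _ (by norm_num) (by nlinarith)
    have b5 : ((stdPi ι).prod (stdPi κ)).real S5 ≤ p := by
      refine measureReal_prod_le_of_section_le hS5m hp0.le fun y => ?_
      by_cases hy : y ⬝ᵥ G *ᵥ y ≤ 3 * D ^ 2 / 512 ∧ y ⬝ᵥ y ≤ 2 * D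
      · refine le_trans (measureReal_mono ?_)
          ((stdPi_outer_quadratic_tail (ι := ι) hQ hD hL hQL hy.2 hy.1).trans
            (hmono _ (by positivity) (by nlinarith)))
        exact fun x hx => hx.2
      · have : (fun x : ι → ℝ => (x, y)) ⁻¹' S5 = ∅ := by
          ext x
          simp only [Set.mem_preimage, Set.mem_empty_iff_false, iff_false]
          exact fun hx => hy hx.1
        rw [this]
        simpa using hp0.le
    have hsub : {z | 1 / 64 < outerFeature D z ⬝ᵥ Q *ᵥ outerFeature D z ∨
        outerFeature D z ⬝ᵥ outerFeature D z < 11 / 64} ⊆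
        Prod.snd ⁻¹' S1 ∪ Prod.snd ⁻¹' S2 ∪ Prod.snd ⁻¹' S3 ∪ Prod.fst ⁻¹' S4 ∪ S5 := by
      intro z hz
      by_contra hcon
      simp only [Set.mem_union, not_or, Set.mem_preimage] at hcon
      obtain ⟨⟨⟨⟨n1, n2⟩, n3⟩, n4⟩, n5⟩ := hcon
      have m1 : z.2 ⬝ᵥ G *ᵥ z.2 < 3 * D ^ 2 / 512 := not_le.1 n1
      have m2 : z.2 ⬝ᵥ z.2 < 2 * D := not_le.1 n2
      have m3 : (Fintype.card κ : ℝ) - 1 / 128 * D < z.2 ⬝ᵥ z.2 := not_le.1 n3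
      have m4 : (Fintype.card ι : ℝ) - 1 / 128 * D < z.1 ⬝ᵥ z.1 := not_le.1 n4
      rcases hz with hz | hz
      · exact n5 ⟨⟨m1.le, m2.le⟩, hz.le⟩
      · rw [outerFeature_normSq, div_lt_iff₀ (by positivity)] at hz
        have h1 : (1 / 4 - 1 / 64) * D ≤ z.1 ⬝ᵥ z.1 := by linarith
        have h2 : (3 / 4 - 1 / 64) * D ≤ z.2 ⬝ᵥ z.2 := by linarith
        -- The margins are tight: (15/64)(47/64) = 705/4096, while 11/64 = 704/4096.
        have h3 := mul_le_mul h1 h2 (by nlinarith) (by nlinarith)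
        nlinarith [sq_nonneg D]
    refine (measureReal_mono hsub).trans ?_
    have u1 := measureReal_union_le (μ := (stdPi ι).prod (stdPi κ)) (Prod.snd ⁻¹' S1 ∪
      Prod.snd ⁻¹' S2 ∪ Prod.snd ⁻¹' S3 ∪ Prod.fst ⁻¹' S4) S5
    have u2 := measureReal_union_le (μ := (stdPi ι).prod (stdPi κ)) (Prod.snd ⁻¹' S1 ∪
      Prod.snd ⁻¹' S2 ∪ Prod.snd ⁻¹' S3) (Prod.fst ⁻¹' S4)
    have u3 := measureReal_union_le (μ := (stdPi ι).prod (stdPi κ)) (Prod.snd ⁻¹' S1 ∪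
      Prod.snd ⁻¹' S2) (Prod.snd ⁻¹' S3)
    have u4 := measureReal_union_le (μ := (stdPi ι).prod (stdPi κ)) (Prod.snd ⁻¹' S1)
      (Prod.snd ⁻¹' S2)
    rw [hsnd] at u3
    rw [hsnd, hsnd] at u4
    rw [hfst] at u2
    linarith

end Product

/-- The law of `m` independent standard Gaussian vectors in dimension `d`. -/
noncomputable abbrev samplePi (m d : ℕ) : Measure (Fin m → Fin d → ℝ) :=
  Measure.pi fun _ => stdPi (Fin d)

/-- Events whose probability is bounded by a null sequence uniformly in `m ≤ c d²`. -/
def Negligible (c : ℝ) (bad : ∀ m d : ℕ, Set (Fin m → Fin d → ℝ)) : Prop :=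
  ∃ δ : ℕ → ℝ, Tendsto δ atTop (𝓝 0) ∧
    ∀ m d : ℕ, (m : ℝ) ≤ c * (d : ℝ) ^ 2 → (samplePi m d).real (bad m d) ≤ δ d

/-! ### Calculus of negligible events -/

theorem negligible_of_eventually {c : ℝ} {bad : ∀ m d : ℕ, Set (Fin m → Fin d → ℝ)} {δ : ℕ → ℝ}
    (hδ : Tendsto δ atTop (𝓝 0))
    (h : ∀ᶠ d : ℕ in atTop, ∀ m : ℕ, (m : ℝ) ≤ c * (d : ℝ) ^ 2 →
      (samplePi m d).real (bad m d) ≤ δ d) : Negligible c bad := by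
  obtain ⟨d0, hd0⟩ := eventually_atTop.1 h
  refine ⟨fun d => if d0 ≤ d then δ d else 1, ?_, fun m d hm => ?_⟩
  · refine hδ.congr' ?_
    filter_upwards [eventually_ge_atTop d0] with d hd
    rw [if_pos hd]
  · dsimp only
    split_ifs with hd
    · exact hd0 d hd m hm
    · exact measureReal_le_one

theorem Negligible.mono {c c' : ℝ} {bad bad' : ∀ m d : ℕ, Set (Fin m → Fin d → ℝ)}
    (h : Negligible c bad) (hc : c' ≤ c)
    (hsub : ∀ᶠ d : ℕ in atTop, ∀ m : ℕ, (m : ℝ) ≤ c' * (d : ℝ) ^ 2 → bad' m d ⊆ bad m d) :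
    Negligible c' bad' := by
  obtain ⟨δ, hδ, hb⟩ := h
  refine negligible_of_eventually hδ ?_
  filter_upwards [hsub] with d hd m hm
  exact (measureReal_mono (hd m hm)).trans
    (hb m d (hm.trans (mul_le_mul_of_nonneg_right hc (by positivity))))

theorem Negligible.union {c : ℝ} {bad bad' : ∀ m d : ℕ, Set (Fin m → Fin d → ℝ)}
    (h : Negligible c bad) (h' : Negligible c bad') :
    Negligible c (fun m d => bad m d ∪ bad' m d) := by
  obtain ⟨δ, hδ, hb⟩ := h
  obtain ⟨δ', hδ', hb'⟩ := h'
  refine ⟨fun d => δ d + δ' d, by simpa using hδ.add hδ', fun m d hm => ?_⟩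
  exact (measureReal_union_le _ _).trans (add_le_add (hb m d hm) (hb' m d hm))

/-! ### The spectral gap via coordinate classes modulo four -/

theorem card_fin_mod_four (d p : ℕ) (hp : p < 4) :
    d ≤ 4 * Fintype.card {a : Fin d // a.val % 4 = p} + 3 ∧
      4 * Fintype.card {a : Fin d // a.val % 4 = p} ≤ d + 3 := by
  have h : Fintype.card {a : Fin d // a.val % 4 = p} = Nat.count (fun a => a ≡ p [MOD 4]) d := by
    rw [Nat.count_eq_card_filter_range, Fintype.card_subtype]
    refine Finset.card_bij (fun a _ => a.val) ?_ ?_ ?_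
    · intro a ha
      simp only [Finset.mem_filter, Finset.mem_univ, true_and, Finset.mem_range] at ha ⊢
      exact ⟨a.2, by rw [Nat.ModEq, ha, Nat.mod_eq_of_lt hp]⟩
    · intro a _ b _ h
      exact Fin.ext h
    · intro b hb
      simp only [Finset.mem_filter, Finset.mem_univ, true_and, Finset.mem_range] at hb
      exact ⟨⟨b, hb.1⟩, by simpa [Nat.ModEq, Nat.mod_eq_of_lt hp] using hb.2, rfl⟩
  rw [h, Nat.count_modEq_card _ (by norm_num)]
  split_ifs <;> omega

/-- Products of coordinates with index in class `p` modulo four against the other coordinates. -/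
noncomputable def classFeature (d p : ℕ) (x : Fin d → ℝ) :
    {a : Fin d // a.val % 4 = p} × {a : Fin d // ¬ a.val % 4 = p} → ℝ :=
  fun ab => x ab.1 * x ab.2 / d

/-- Coordinates inside and outside a class are independent Gaussian vectors, so the feature is a
decoupled outer product. For d ≥ 128 the rounding of the class sizes costs less than d/128. -/
theorem isotropicFeature_class {d p : ℕ} (hp : p < 4) (hd : 128 ≤ d) {L : ℝ} (hL : 1 ≤ L) :
    IsotropicFeature (stdPi (Fin d)) (classFeature d p) ((d : ℝ) ^ 2) L
      (5 * Real.exp (-((d : ℝ) / (2 ^ 18 * L)))) := by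
  have hd' : (128 : ℝ) ≤ d := by exact_mod_cast hd
  obtain ⟨h1, h2⟩ := card_fin_mod_four d p hp
  have h3 : Fintype.card {a : Fin d // ¬ a.val % 4 = p} =
      d - Fintype.card {a : Fin d // a.val % 4 = p} := by
    rw [Fintype.card_subtype_compl, Fintype.card_fin]
  have h4 : Fintype.card {a : Fin d // a.val % 4 = p} ≤ d := by omega
  have h1' : (d : ℝ) ≤ 4 * Fintype.card {a : Fin d // a.val % 4 = p} + 3 := by exact_mod_cast h1
  have h2' : 4 * (Fintype.card {a : Fin d // a.val % 4 = p} : ℝ) ≤ d + 3 := by exact_mod_cast h2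
  have h3' : (Fintype.card {a : Fin d // ¬ a.val % 4 = p} : ℝ) =
      d - Fintype.card {a : Fin d // a.val % 4 = p} := by
    rw [h3, Nat.cast_sub h4]
  exact (isotropicFeature_outer (ι := {a : Fin d // a.val % 4 = p})
    (κ := {a : Fin d // ¬ a.val % 4 = p}) (D := d) (L := L) (by linarith) hL (by linarith)
    (by linarith) (by linarith) (by linarith)).comp_measurePreserving
    (measurePreserving_piEquivPiSubtypeProd (fun _ : Fin d => gaussianReal 0 1)
      (fun a : Fin d => a.val % 4 = p))

theorem dotProduct_featureGram {V κ : Type*} [Fintype κ] {ι : Type*} [Fintype ι] (f : V → κ → ℝ)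
    (v : ι → V) (t : ι → ℝ) :
    t ⬝ᵥ featureGram f v *ᵥ t = ∑ k, (∑ i, t i * f (v i) k) ^ 2 := by
  rw [featureGram, ← mulVec_mulVec, dotProduct_mulVec, ← mulVec_transpose]
  simp only [dotProduct, mulVec, transpose_apply, featureMatrix, Matrix.of_apply, pow_two,
    mul_comm (t _)]

/-- The Gram matrix of coordinate products in distinct classes modulo four is at least `1/2`. -/
def SpectralGap {m d : ℕ} (x : Fin m → Fin d → ℝ) : Prop :=
  ∀ t : Fin m → ℝ, (t ⬝ᵥ t) / 2 ≤
    ∑ a, ∑ b, if a.val % 4 = b.val % 4 then 0 else (∑ i, t i * (x i a * x i b / d)) ^ 2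

/-- Ordered pairs from distinct classes are partitioned by the class of the first index, and the
four bounds of 1/8 add up. -/
theorem spectralGap_of_posDef {m d : ℕ} {x : Fin m → Fin d → ℝ}
    (h : ∀ p < 4, (featureGram (classFeature d p) x - (1 / 8 : ℝ) • 1).PosDef) :
    SpectralGap x := by
  intro t
  have hp : ∀ p < 4, (t ⬝ᵥ t) / 8 ≤ ∑ a, ∑ b, if a.val % 4 = p then
      (if b.val % 4 = p then 0 else (∑ i, t i * (x i a * x i b / d)) ^ 2) else 0 := by
    intro p hp
    have h1 := (h p hp).posSemidef.dotProduct_mulVec_nonneg t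
    rw [sub_mulVec, dotProduct_sub, smul_mulVec, one_mulVec, dotProduct_smul] at h1
    simp only [star_trivial, smul_eq_mul, dotProduct_featureGram, Fintype.sum_prod_type,
      classFeature] at h1
    set F : Fin d → Fin d → ℝ := fun a b => (∑ i, t i * (x i a * x i b / d)) ^ 2 with hF
    have e1 : ∀ a, (∑ b : {b : Fin d // ¬ b.val % 4 = p}, F a b) =
        ∑ b, if b.val % 4 = p then 0 else F a b := by
      intro a
      rw [← Finset.sum_subtype (Finset.univ.filter fun b : Fin d => ¬ b.val % 4 = p)
        (by simp) (fun b => F a b), Finset.sum_filter]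
      refine Finset.sum_congr rfl fun b _ => ?_
      by_cases hb : b.val % 4 = p <;> simp [hb]
    have e2 : (∑ a : {a : Fin d // a.val % 4 = p}, ∑ b : {b : Fin d // ¬ b.val % 4 = p}, F a b) =
        ∑ a, ∑ b, if a.val % 4 = p then (if b.val % 4 = p then 0 else F a b) else 0 := by
      simp only [e1]
      rw [← Finset.sum_subtype (Finset.univ.filter fun b : Fin d => b.val % 4 = p)
        (by simp) (fun a => ∑ b : Fin d, if b.val % 4 = p then 0 else F a b), Finset.sum_filter]
      refine Finset.sum_congr rfl fun b _ => ?_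
      by_cases hb : b.val % 4 = p <;> simp [hb]
    change 0 ≤ (∑ a : {a : Fin d // a.val % 4 = p}, ∑ b : {b : Fin d // ¬ b.val % 4 = p}, F a b) -
      1 / 8 * (t ⬝ᵥ t) at h1
    rw [e2] at h1
    change _ ≤ ∑ a, ∑ b, if a.val % 4 = p then (if b.val % 4 = p then 0 else F a b) else 0
    linarith
  have hsum : (∑ a : Fin d, ∑ b : Fin d, if a.val % 4 = b.val % 4 then (0 : ℝ) else
      (∑ i, t i * (x i a * x i b / d)) ^ 2) = ∑ p ∈ Finset.range 4, ∑ a, ∑ b,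
      if a.val % 4 = p then
        (if b.val % 4 = p then 0 else (∑ i, t i * (x i a * x i b / d)) ^ 2) else 0 := by
    symm
    rw [Finset.sum_comm]
    refine Finset.sum_congr rfl fun a _ => ?_
    rw [Finset.sum_comm]
    refine Finset.sum_congr rfl fun b _ => ?_
    rw [Finset.sum_ite_eq, if_pos (Finset.mem_range.2 (Nat.mod_lt _ (by norm_num)))]
    simp only [eq_comm]
  rw [hsum]
  have h0 := hp 0 (by norm_num)
  have h1 := hp 1 (by norm_num)
  have h2 := hp 2 (by norm_num)
  have h3 := hp 3 (by norm_num)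
  simp only [Finset.sum_range_succ, Finset.sum_range_zero]
  linarith

/-- Four classes, at most d² rows each, with N = d² and L = d^(2/3). The tail term is d² exp(-2⁻¹⁸
d^(1/3)), with d² read as the sixth power of d^(1/3), and the variance term is of order d^(-2/3). -/
theorem tendsto_gap_bound :
    Tendsto (fun d : ℕ => 4 * ((d : ℝ) ^ 2 * (5 * Real.exp (-((d : ℝ) /
      (2 ^ 18 * (d : ℝ) ^ (2 / 3 : ℝ)))) +
      36 * 2 ^ 64 * (((d : ℝ) ^ (2 / 3 : ℝ)) ^ 2 / ((d : ℝ) ^ 2) ^ 2)))) atTop (𝓝 0) := by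
  have hcast := tendsto_natCast_atTop_atTop (R := ℝ)
  have h3 : Tendsto (fun d : ℕ => (d : ℝ) ^ (1 / 3 : ℝ)) atTop atTop :=
    (tendsto_rpow_atTop (by norm_num)).comp hcast
  have h1 := (tendsto_rpow_mul_exp_neg_mul_atTop_nhds_zero 6 (1 / 2 ^ 18) (by norm_num)).comp h3
  have h2 := (tendsto_rpow_neg_atTop (y := 2 / 3) (by norm_num)).comp hcast
  have h := ((h1.const_mul 20).add (h2.const_mul (4 * 36 * 2 ^ 64)))
  simp only [mul_zero, add_zero] at h
  refine h.congr' ?_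
  filter_upwards [eventually_ge_atTop 1] with d hd
  have hd0 : (0 : ℝ) < d := by exact_mod_cast hd
  simp only [Function.comp]
  have e1 : ((d : ℝ) ^ (1 / 3 : ℝ)) ^ (6 : ℝ) = (d : ℝ) ^ 2 := by
    rw [← Real.rpow_mul hd0.le, ← Real.rpow_natCast]; norm_num
  have e2 : (d : ℝ) / (2 ^ 18 * (d : ℝ) ^ (2 / 3 : ℝ)) = 1 / 2 ^ 18 * (d : ℝ) ^ (1 / 3 : ℝ) := by
    have : (d : ℝ) ^ (1 / 3 : ℝ) * (d : ℝ) ^ (2 / 3 : ℝ) = d := by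
      rw [← Real.rpow_add hd0]; norm_num
    have hp : 0 < (d : ℝ) ^ (2 / 3 : ℝ) := Real.rpow_pos_of_pos hd0 _
    rw [div_eq_iff (by positivity)]
    calc (d : ℝ) = (d : ℝ) ^ (1 / 3 : ℝ) * (d : ℝ) ^ (2 / 3 : ℝ) := this.symm
      _ = _ := by ring
  have e3 : (d : ℝ) ^ (-(2 / 3) : ℝ) =
      (d : ℝ) ^ 2 * (((d : ℝ) ^ (2 / 3 : ℝ)) ^ 2 / ((d : ℝ) ^ 2) ^ 2) := by
    simp only [← Real.rpow_natCast, ← Real.rpow_mul hd0.le, ← Real.rpow_sub hd0,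
      ← Real.rpow_add hd0]
    norm_num
  rw [e1, e2, e3, neg_mul]
  ring

theorem negligible_not_spectralGap :
    Negligible (1 / 2 ^ 33) (fun _ _ => {x | ¬ SpectralGap x}) := by
  refine negligible_of_eventually tendsto_gap_bound ?_
  filter_upwards [eventually_ge_atTop 128] with d hd m hm
  have hd1 : (1 : ℝ) ≤ d := by exact_mod_cast (by omega : 1 ≤ d)
  have hd0 : (0 : ℝ) < d := by linarith
  set L : ℝ := (d : ℝ) ^ (2 / 3 : ℝ) with hLdef
  have hL : 1 ≤ L := Real.one_le_rpow hd1 (by norm_num)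
  have hL3 : L ^ 3 = (d : ℝ) ^ 2 := by
    rw [hLdef, ← Real.rpow_natCast, ← Real.rpow_mul hd0.le, ← Real.rpow_natCast]; norm_num
  set B : ℝ := 5 * Real.exp (-((d : ℝ) / (2 ^ 18 * L))) +
    36 * 2 ^ 64 * (L ^ 2 / ((d : ℝ) ^ 2) ^ 2) with hB
  have hB0 : 0 ≤ B := by positivity
  have hmd : (m : ℝ) ≤ (d : ℝ) ^ 2 := hm.trans (by nlinarith [sq_nonneg (d : ℝ)])
  have hp : ∀ p < 4, (samplePi m d).real
      {x | ¬ (featureGram (classFeature d p) x - (1 / 8 : ℝ) • 1).PosDef} ≤ (d : ℝ) ^ 2 * B := by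
    intro p hp
    refine (measure_not_posDef_featureGram_le (isotropicFeature_class hp hd hL) hL hL3 m
      (by linarith)).trans ?_
    exact mul_le_mul_of_nonneg_right hmd hB0
  have hsub : {x : Fin m → Fin d → ℝ | ¬ SpectralGap x} ⊆ ⋃ p ∈ Finset.range 4,
      {x | ¬ (featureGram (classFeature d p) x - (1 / 8 : ℝ) • 1).PosDef} := by
    intro x hx
    by_contra hcon
    simp only [Set.mem_iUnion, not_exists, Finset.mem_range, Set.mem_ofPred_eq, not_not] at hcon
    exact hx (spectralGap_of_posDef hcon)
  calc _ ≤ _ := measureReal_mono hsub (measure_ne_top _ _)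
    _ ≤ ∑ p ∈ Finset.range 4, _ := measureReal_biUnion_finset_le _ _
    _ ≤ ∑ p ∈ Finset.range 4, (d : ℝ) ^ 2 * B :=
        Finset.sum_le_sum fun p hp' => hp p (Finset.mem_range.1 hp')
    _ = 4 * ((d : ℝ) ^ 2 * B) := by simp

/-! ### Concentration of squared radii -/

theorem weighted_sum_chebyshev {V : Type*} [MeasurableSpace V] {μ : Measure V}
    [IsProbabilityMeasure μ] {m : ℕ} {φ : V → ℝ} (hφ : MemLp φ 2 μ) {σ : ℝ}
    (hσ : ∫ x, φ x ^ 2 ∂μ ≤ σ) (w : Fin m → ℝ) {a : ℝ} (ha : 0 < a) :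
    (Measure.pi fun _ : Fin m => μ).real
      {x | a ≤ |∑ i, (φ (x i) - ∫ y, φ y ∂μ) * w i|} ≤ σ * (w ⬝ᵥ w) / a ^ 2 := by
  have hX : ∀ i : Fin m, MemLp (fun y => w i * φ y) 2 μ := fun i => hφ.const_mul (w i)
  have hXi : ∀ i : Fin m, MemLp (fun x : Fin m → V => w i * φ (x i)) 2
      (Measure.pi fun _ : Fin m => μ) := fun i =>
    (hX i).comp_measurePreserving (measurePreserving_eval (fun _ : Fin m => μ) i)
  have hS : MemLp (∑ i, fun x : Fin m → V => w i * φ (x i)) 2 (Measure.pi fun _ : Fin m => μ) :=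
    memLp_finsetSum' _ fun i _ => hXi i
  have hmean : ∫ x, (∑ i, fun x : Fin m → V => w i * φ (x i)) x ∂(Measure.pi fun _ : Fin m => μ)
      = ∑ i, w i * ∫ y, φ y ∂μ := by
    simp only [Finset.sum_apply]
    rw [integral_finsetSum _ fun i _ => (hXi i).integrable (by norm_num)]
    refine Finset.sum_congr rfl fun i _ => ?_
    rw [integral_comp_eval (μ := fun _ : Fin m => μ) (f := fun y => w i * φ y)
      (hX i).aestronglyMeasurable, integral_const_mul]
  have hvar : Var[∑ i, fun x : Fin m → V => w i * φ (x i); Measure.pi fun _ : Fin m => μ] ≤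
      σ * (w ⬝ᵥ w) := by
    rw [variance_sum_pi (μ := fun _ : Fin m => μ) (X := fun i y => w i * φ y) hX]
    have hv : Var[φ; μ] ≤ σ := (variance_le_expectation_sq hφ.aestronglyMeasurable).trans
      (by simpa using hσ)
    simp only [variance_const_mul, dotProduct, Finset.mul_sum]
    refine Finset.sum_le_sum fun i _ => ?_
    nlinarith [sq_nonneg (w i)]
  have h := meas_ge_le_variance_div_sq hS ha
  rw [measureReal_def]
  refine ENNReal.toReal_le_of_le_ofReal (div_nonneg ?_ (sq_nonneg a)) ?_
  · exact (variance_nonneg _ _).trans hvar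
  · refine le_trans (le_of_eq ?_) (h.trans (ENNReal.ofReal_le_ofReal
      (div_le_div_of_nonneg_right hvar (sq_nonneg a))))
    rw [hmean]
    congr 1
    ext x
    simp only [Set.mem_ofPred_eq, Finset.sum_apply, ← Finset.sum_sub_distrib]
    have e : ∀ i, (φ (x i) - ∫ y, φ y ∂μ) * w i = w i * φ (x i) - w i * ∫ y, φ y ∂μ :=
      fun i => by ring
    simp only [e]

/-- The normalised squared radius of a standard Gaussian vector. -/
noncomputable def sqRadius {d : ℕ} (x : Fin d → ℝ) : ℝ := x ⬝ᵥ x / d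

theorem sqRadius_nonneg {d : ℕ} (x : Fin d → ℝ) : 0 ≤ sqRadius x :=
  div_nonneg (dotProduct_self_nonneg_real x) (Nat.cast_nonneg d)

theorem measurable_sqRadius {d : ℕ} : Measurable (sqRadius : (Fin d → ℝ) → ℝ) := by
  unfold sqRadius
  simp only [dotProduct]
  fun_prop

/-- One term of the exponential series: gⁿ/n! ≤ e^|g| ≤ e^g + e^(-g). -/
theorem integral_pow_le_of_cosh {Ω : Type*} [MeasurableSpace Ω] {μ : Measure Ω} {g : Ω → ℝ}
    (hg : Measurable g) {B : ℝ}
    (h1 : Integrable (fun x => Real.exp (g x)) μ ∧ ∫ x, Real.exp (g x) ∂μ ≤ B)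
    (h2 : Integrable (fun x => Real.exp (-g x)) μ ∧ ∫ x, Real.exp (-g x) ∂μ ≤ B) {n : ℕ}
    (hn : Even n) :
    Integrable (fun x => g x ^ n) μ ∧ ∫ x, g x ^ n ∂μ ≤ 2 * n.factorial * B := by
  have hpt : ∀ x, g x ^ n ≤ n.factorial * (Real.exp (g x) + Real.exp (-g x)) := by
    intro x
    have h := Real.pow_div_factorial_le_exp |g x| (abs_nonneg _) n
    rw [hn.pow_abs, div_le_iff₀ (by positivity)] at h
    rw [mul_comm]
    refine h.trans (mul_le_mul_of_nonneg_right ?_ (by positivity))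
    rcases abs_choice (g x) with hx | hx <;> rw [hx] <;>
      linarith [Real.exp_pos (g x), Real.exp_pos (-g x)]
  have hi := (h1.1.add h2.1).const_mul (n.factorial : ℝ)
  have hint : Integrable (fun x => g x ^ n) μ := by
    refine hi.mono' (hg.pow_const n).aestronglyMeasurable (ae_of_all _ fun x => ?_)
    rw [Real.norm_eq_abs, abs_of_nonneg (hn.pow_nonneg _)]
    exact hpt x
  refine ⟨hint, (integral_mono hint hi hpt).trans ?_⟩
  rw [integral_const_mul]
  have e := integral_add h1.1 h2.1
  simp only [Pi.add_apply]
  rw [e]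
  have : (0 : ℝ) ≤ n.factorial := Nat.cast_nonneg _
  nlinarith [h1.2, h2.2]

theorem excess_pow_moment {d : ℕ} (hd : 1 ≤ d) {n : ℕ} (hn : Even n) :
    Integrable (fun x : Fin d → ℝ => (sqRadius x - 1) ^ n) (stdPi (Fin d)) ∧
      ∫ x, (sqRadius x - 1) ^ n ∂(stdPi (Fin d)) ≤
        (4 / Real.sqrt d) ^ n * (6 * n.factorial) := by
  have hd1 : (1 : ℝ) ≤ d := by exact_mod_cast hd
  have hs1 : 1 ≤ Real.sqrt d := Real.one_le_sqrt.2 hd1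
  have hs2 : Real.sqrt d ^ 2 = d := Real.sq_sqrt (by linarith)
  -- This scale makes the exponent 4t²d equal to 1/4, so the exponential moments are bounded
  -- independently of d.
  set t : ℝ := 1 / (4 * Real.sqrt d) with ht
  have ht0 : 0 ≤ t := by positivity
  have ht1 : t ≤ 1 / 4 := by
    rw [ht, div_le_div_iff₀ (by positivity) (by norm_num)]; linarith
  have hB : Real.exp (4 * t ^ 2 * Fintype.card (Fin d)) ≤ 3 := by
    have : 4 * t ^ 2 * Fintype.card (Fin d) = 1 / 4 := by
      rw [Fintype.card_fin, ht, div_pow, mul_pow, hs2]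
      field_simp
    rw [this]
    exact (Real.exp_le_exp.2 (by norm_num)).trans Real.exp_one_lt_three.le
  have hm : Measurable fun x : Fin d → ℝ => t * (x ⬝ᵥ x - Fintype.card (Fin d)) := by
    simp only [dotProduct]; fun_prop
  have h1 := integral_exp_normSq (ι := Fin d) (t := t) (by rw [abs_of_nonneg ht0]; exact ht1)
  have h2 := integral_exp_normSq (ι := Fin d) (t := -t)
    (by rw [abs_neg, abs_of_nonneg ht0]; exact ht1)
  simp only [neg_mul, neg_sq] at h2
  obtain ⟨hi, hle⟩ := integral_pow_le_of_cosh hm ⟨h1.1, h1.2.trans hB⟩ ⟨h2.1, h2.2.trans hB⟩ hn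
  have e : ∀ x : Fin d → ℝ, (sqRadius x - 1) ^ n =
      (4 / Real.sqrt d) ^ n * (t * (x ⬝ᵥ x - Fintype.card (Fin d))) ^ n := by
    intro x
    rw [← mul_pow]
    congr 1
    rw [sqRadius, Fintype.card_fin, ht]
    field_simp
    rw [hs2]
    ring
  simp only [e]
  refine ⟨hi.const_mul _, ?_⟩
  rw [integral_const_mul]
  refine mul_le_mul_of_nonneg_left (hle.trans (le_of_eq (by ring))) (by positivity)

theorem excess_sq_moment {d : ℕ} (hd : 1 ≤ d) :
    Integrable (fun x : Fin d → ℝ => (sqRadius x - 1) ^ 2) (stdPi (Fin d)) ∧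
      ∫ x, (sqRadius x - 1) ^ 2 ∂(stdPi (Fin d)) ≤ 192 / (d : ℝ) := by
  obtain ⟨h1, h2⟩ := excess_pow_moment hd (n := 2) even_two
  refine ⟨h1, h2.trans (le_of_eq ?_)⟩
  rw [div_pow, Real.sq_sqrt (by positivity)]
  norm_num [Nat.factorial]
  ring

theorem excess_four_moment {d : ℕ} (hd : 1 ≤ d) :
    Integrable (fun x : Fin d → ℝ => (sqRadius x - 1) ^ 4) (stdPi (Fin d)) ∧
      ∫ x, (sqRadius x - 1) ^ 4 ∂(stdPi (Fin d)) ≤ 36864 / (d : ℝ) ^ 2 := by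
  obtain ⟨h1, h2⟩ := excess_pow_moment hd (n := 4) (by decide)
  refine ⟨h1, h2.trans (le_of_eq ?_)⟩
  rw [div_pow, show Real.sqrt (d : ℝ) ^ 4 = (Real.sqrt d ^ 2) ^ 2 by ring,
    Real.sq_sqrt (by positivity)]
  norm_num [Nat.factorial]
  ring

theorem integral_dotProduct_self_stdPi (ι : Type*) [Fintype ι] [DecidableEq ι] :
    Integrable (fun x : ι → ℝ => x ⬝ᵥ x) (stdPi ι) ∧
      ∫ x, x ⬝ᵥ x ∂(stdPi ι) = Fintype.card ι := by
  have h := stdPi_sum_sq_moments (ι := ι) (κ := ι) (fun a => (Pi.single a (1 : ℝ) : ι → ℝ))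
  have e : ∀ y : ι → ℝ, ∑ a, ((Pi.single a (1 : ℝ) : ι → ℝ) ⬝ᵥ y) ^ 2 = y ⬝ᵥ y := fun y => by
    simp only [single_one_dotProduct]
    simp only [dotProduct, pow_two]
  simp only [e] at h
  refine ⟨h.2.1, h.2.2.1.trans ?_⟩
  simp

theorem integral_excess {d : ℕ} (hd : 1 ≤ d) :
    Integrable (fun x : Fin d → ℝ => sqRadius x - 1) (stdPi (Fin d)) ∧
      ∫ x, (sqRadius x - 1) ∂(stdPi (Fin d)) = 0 := by
  obtain ⟨h1, h2⟩ := integral_dotProduct_self_stdPi (Fin d)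
  have hd0 : (d : ℝ) ≠ 0 := by positivity
  unfold sqRadius
  refine ⟨(h1.div_const _).sub (integrable_const _), ?_⟩
  rw [integral_sub (h1.div_const _) (integrable_const _), integral_div, h2]
  simp [hd0]

/-- The mean is at most 192m/d, below d/128 in this range of m; the fourth moment feeds Chebyshev
for the other d/128. -/
theorem negligible_excess_large :
    Negligible (1 / 2 ^ 33) (fun _ d => {x | (d : ℝ) / 64 ≤ ∑ i, (sqRadius (x i) - 1) ^ 2}) := by
  refine negligible_of_eventually (δ := fun d : ℕ => 128 ^ 2 * ((d : ℝ) ^ 2)⁻¹) ?_ ?_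
  · have := (tendsto_natCast_atTop_atTop (R := ℝ))
    have h := (tendsto_inv_atTop_zero.comp ((tendsto_pow_atTop (two_ne_zero)).comp this)).const_mul
      (128 ^ 2 : ℝ)
    simpa using h
  filter_upwards [eventually_ge_atTop 1] with d hd m hm
  have hd1 : (1 : ℝ) ≤ d := by exact_mod_cast hd
  have hd0 : (0 : ℝ) < d := by linarith
  obtain ⟨h2i, h2⟩ := excess_sq_moment hd
  obtain ⟨h4i, h4⟩ := excess_four_moment hd
  have hmeas : Measurable fun x : Fin d → ℝ => (sqRadius x - 1) ^ 2 :=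
    (measurable_sqRadius.sub_const 1).pow_const 2
  have e4 : ∀ x : Fin d → ℝ, ((sqRadius x - 1) ^ 2) ^ 2 = (sqRadius x - 1) ^ 4 := fun x => by ring
  have hL : MemLp (fun x : Fin d → ℝ => (sqRadius x - 1) ^ 2) 2 (stdPi (Fin d)) := by
    rw [memLp_two_iff_integrable_sq hmeas.aestronglyMeasurable]
    simpa only [e4] using h4i
  have hch := weighted_sum_chebyshev hL (σ := 36864 / (d : ℝ) ^ 2) (by simpa only [e4] using h4)
    (fun _ : Fin m => (1 : ℝ)) (a := d / 128) (by positivity)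
  refine (measureReal_mono ?_).trans (hch.trans ?_)
  · intro x (hx : (d : ℝ) / 64 ≤ ∑ i, (sqRadius (x i) - 1) ^ 2)
    change (d : ℝ) / 128 ≤ |∑ i, ((sqRadius (x i) - 1) ^ 2 -
      ∫ y, (sqRadius y - 1) ^ 2 ∂(stdPi (Fin d))) * (1 : ℝ)|
    refine le_trans ?_ (le_abs_self _)
    simp only [mul_one, Finset.sum_sub_distrib, Finset.sum_const, Finset.card_univ,
      Fintype.card_fin, nsmul_eq_mul]
    have : (m : ℝ) * ∫ y, (sqRadius y - 1) ^ 2 ∂(stdPi (Fin d)) ≤ d / 128 := by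
      calc _ ≤ (m : ℝ) * (192 / d) := by gcongr
        _ ≤ (1 / 2 ^ 33 * (d : ℝ) ^ 2) * (192 / d) := by gcongr
        _ = 192 / 2 ^ 33 * d := by field_simp
        _ ≤ d / 128 := by linarith
    linarith
  · have e : (fun _ : Fin m => (1 : ℝ)) ⬝ᵥ (fun _ => 1) = m := by simp [dotProduct]
    rw [e]
    calc 36864 / (d : ℝ) ^ 2 * m / ((d : ℝ) / 128) ^ 2
        ≤ 36864 / (d : ℝ) ^ 2 * (1 / 2 ^ 33 * (d : ℝ) ^ 2) / ((d : ℝ) / 128) ^ 2 := by gcongr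
      _ = 36864 / 2 ^ 33 * 128 ^ 2 * ((d : ℝ) ^ 2)⁻¹ := by field_simp
      _ ≤ _ := by
        refine mul_le_mul_of_nonneg_right (by norm_num) (by positivity)

theorem measureReal_pi_exists_le {V : Type*} [MeasurableSpace V] {μ : Measure V}
    [IsProbabilityMeasure μ] (m : ℕ) {S : Set V} (hS : MeasurableSet S) :
    (Measure.pi fun _ : Fin m => μ).real {x | ∃ i, x i ∈ S} ≤ m * μ.real S := by
  have e : {x : Fin m → V | ∃ i, x i ∈ S} = ⋃ i, Function.eval i ⁻¹' S := by
    ext x; simp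
  rw [e]
  refine (measureReal_iUnion_fintype_le _).trans ?_
  have h : ∀ i, (Measure.pi fun _ : Fin m => μ).real (Function.eval i ⁻¹' S) = μ.real S :=
    fun i => (measurePreserving_eval (fun _ : Fin m => μ) i).measureReal_preimage
      hS.nullMeasurableSet
  simp [h]

/-- Union bound: the individual tail is exponentially small in d and m ≤ d². -/
theorem negligible_radius_far {τ : ℝ} (hτ : 0 < τ) (hτ1 : τ ≤ 1) :
    Negligible 1 (fun _ _ => {x | ∃ i, τ < |sqRadius (x i) - 1|}) := by
  have hb : (0 : ℝ) < τ ^ 2 / 16 := by positivity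
  have hcast := tendsto_natCast_atTop_atTop (R := ℝ)
  have h := ((tendsto_rpow_mul_exp_neg_mul_atTop_nhds_zero 2 (τ ^ 2 / 16) hb).comp
    hcast).const_mul 2
  rw [mul_zero] at h
  refine negligible_of_eventually h ?_
  filter_upwards [eventually_ge_atTop 1] with d hd m hm
  have hd1 : (1 : ℝ) ≤ d := by exact_mod_cast hd
  have hd0 : (0 : ℝ) < d := by linarith
  simp only [Function.comp, Real.rpow_two, neg_mul]
  have hmS : MeasurableSet {x : Fin d → ℝ | τ < |sqRadius x - 1|} :=
    measurableSet_lt measurable_const (measurable_sqRadius.sub_const 1).abs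
  refine (measureReal_pi_exists_le m hmS).trans ?_
  have hS : (stdPi (Fin d)).real {x : Fin d → ℝ | τ < |sqRadius x - 1|} ≤
      2 * Real.exp (-(τ ^ 2 / 16 * d)) := by
    have hu := stdPi_normSq_tail (ι := Fin d) (a := τ ^ 2 * d / 8) (t := τ / 8)
      (by rw [abs_of_nonneg] <;> linarith)
    have hl := stdPi_normSq_tail (ι := Fin d) (a := τ ^ 2 * d / 8) (t := -(τ / 8))
      (by rw [abs_neg, abs_of_nonneg] <;> linarith)
    rw [Fintype.card_fin] at hu hl
    have eu : 4 * (τ / 8) ^ 2 * (d : ℝ) - τ ^ 2 * d / 8 = -(τ ^ 2 / 16 * d) := by ring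
    have el : 4 * (-(τ / 8)) ^ 2 * (d : ℝ) - τ ^ 2 * d / 8 = -(τ ^ 2 / 16 * d) := by ring
    rw [eu] at hu
    rw [el] at hl
    refine (measureReal_mono ?_).trans ((measureReal_union_le _ _).trans
      ((add_le_add hu hl).trans (le_of_eq (by ring))))
    intro x (hx : τ < |sqRadius x - 1|)
    have ex : x ⬝ᵥ x - d = d * (sqRadius x - 1) := by
      rw [sqRadius]; field_simp
    rcases lt_abs.1 hx with h | h
    · left
      change τ ^ 2 * d / 8 ≤ τ / 8 * (x ⬝ᵥ x - d)
      rw [ex]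
      nlinarith [mul_le_mul_of_nonneg_left h.le (by positivity : 0 ≤ τ / 8 * d)]
    · right
      change τ ^ 2 * d / 8 ≤ -(τ / 8) * (x ⬝ᵥ x - d)
      rw [ex]
      nlinarith [mul_le_mul_of_nonneg_left h.le (by positivity : 0 ≤ τ / 8 * d)]
  calc (m : ℝ) * (stdPi (Fin d)).real {x : Fin d → ℝ | τ < |sqRadius x - 1|}
      ≤ (d : ℝ) ^ 2 * (2 * Real.exp (-(τ ^ 2 / 16 * d))) := by
        refine mul_le_mul (by linarith) hS measureReal_nonneg (by positivity)
    _ = _ := by ring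

/-! ### Second moment of sums over pairs -/

section PairSum

variable {V κ : Type*} [MeasurableSpace V] [Fintype κ] [DecidableEq κ]

/-- The sum over ordered pairs `i ≠ j` of inner products of features. -/
noncomputable def pairSum {m : ℕ} (f : V → κ → ℝ) (v : Fin m → V) : ℝ :=
  (∑ i, f (v i)) ⬝ᵥ (∑ i, f (v i)) - ∑ i, f (v i) ⬝ᵥ f (v i)

theorem pairSum_succ {k : ℕ} (f : V → κ → ℝ) (v : Fin (k + 1) → V) :
    pairSum f v = pairSum f (fun i : Fin k => v i.succ) +
      2 * ((∑ i : Fin k, f (v i.succ)) ⬝ᵥ f (v 0)) := by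
  simp only [pairSum, Fin.sum_univ_succ, add_dotProduct, dotProduct_add]
  rw [dotProduct_comm (f (v 0)) (∑ i : Fin k, f (v i.succ))]
  ring

/-- Centred features with bounded covariance. -/
structure CentredFeature (μ : Measure V) (f : V → κ → ℝ) (σ : ℝ) : Prop where
  memLp : ∀ ℓ : κ → ℝ, MemLp (fun x => ℓ ⬝ᵥ f x) 2 μ
  mean : ∀ ℓ : κ → ℝ, ∫ x, ℓ ⬝ᵥ f x ∂μ = 0
  var_le : ∀ ℓ : κ → ℝ, ∫ x, (ℓ ⬝ᵥ f x) ^ 2 ∂μ ≤ σ * (ℓ ⬝ᵥ ℓ)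

theorem CentredFeature.memLp_coord {μ : Measure V} {f : V → κ → ℝ} {σ : ℝ}
    (hf : CentredFeature μ f σ) (a : κ) : MemLp (fun x => f x a) 2 μ := by
  have h := hf.memLp (Pi.single a 1)
  simpa only [single_one_dotProduct] using h

theorem CentredFeature.sum_memLp {μ : Measure V} [IsProbabilityMeasure μ] {f : V → κ → ℝ} {σ : ℝ}
    (hf : CentredFeature μ f σ) (k : ℕ) (ℓ : κ → ℝ) :
    MemLp (fun v : Fin k → V => ℓ ⬝ᵥ ∑ i, f (v i)) 2 (Measure.pi fun _ : Fin k => μ) := by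
  simp only [dotProduct_sum]
  exact memLp_finsetSum _ fun i _ =>
    (hf.memLp ℓ).comp_measurePreserving (measurePreserving_eval (fun _ : Fin k => μ) i)

theorem CentredFeature.sum_var_le {μ : Measure V} [IsProbabilityMeasure μ] {f : V → κ → ℝ} {σ : ℝ}
    (hf : CentredFeature μ f σ) (k : ℕ) (ℓ : κ → ℝ) :
    ∫ v, (ℓ ⬝ᵥ ∑ i, f (v i)) ^ 2 ∂(Measure.pi fun _ : Fin k => μ) ≤ k * (σ * (ℓ ⬝ᵥ ℓ)) := by
  have e : (fun v : Fin k → V => ℓ ⬝ᵥ ∑ i, f (v i)) = ∑ i, fun v : Fin k → V => ℓ ⬝ᵥ f (v i) := by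
    funext v
    simp only [dotProduct_sum, Finset.sum_apply]
  have hmean : ∫ v, (ℓ ⬝ᵥ ∑ i, f (v i)) ∂(Measure.pi fun _ : Fin k => μ) = 0 := by
    simp only [dotProduct_sum]
    rw [integral_finsetSum]
    · refine Finset.sum_eq_zero fun i _ => ?_
      rw [integral_comp_eval (μ := fun _ : Fin k => μ) (f := fun y => ℓ ⬝ᵥ f y)
        (hf.memLp ℓ).aestronglyMeasurable, hf.mean]
    · exact fun i _ => ((hf.memLp ℓ).comp_measurePreserving
        (measurePreserving_eval (fun _ : Fin k => μ) i)).integrable (by norm_num)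
  have hv := variance_of_integral_eq_zero (hf.sum_memLp k ℓ).aestronglyMeasurable.aemeasurable hmean
  rw [← hv, e, variance_sum_pi (μ := fun _ : Fin k => μ) (X := fun _ y => ℓ ⬝ᵥ f y)
    (fun _ => hf.memLp ℓ)]
  have h1 : Var[fun y => ℓ ⬝ᵥ f y; μ] ≤ σ * (ℓ ⬝ᵥ ℓ) :=
    (variance_le_expectation_sq (hf.memLp ℓ).aestronglyMeasurable).trans
      (by simpa using hf.var_le ℓ)
  calc _ ≤ ∑ _i : Fin k, σ * (ℓ ⬝ᵥ ℓ) := Finset.sum_le_sum fun i _ => h1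
    _ = _ := by simp

theorem CentredFeature.sum_normSq {μ : Measure V} [IsProbabilityMeasure μ] {f : V → κ → ℝ} {σ : ℝ}
    (hf : CentredFeature μ f σ) (k : ℕ) :
    Integrable (fun v : Fin k → V => (∑ i, f (v i)) ⬝ᵥ ∑ i, f (v i))
        (Measure.pi fun _ : Fin k => μ) ∧
      ∫ v, (∑ i, f (v i)) ⬝ᵥ (∑ i, f (v i)) ∂(Measure.pi fun _ : Fin k => μ) ≤
        k * σ * Fintype.card κ := by
  have e : ∀ v : Fin k → V, (∑ i, f (v i)) ⬝ᵥ (∑ i, f (v i)) =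
      ∑ a, ((Pi.single a (1 : ℝ) : κ → ℝ) ⬝ᵥ ∑ i, f (v i)) ^ 2 := by
    intro v
    simp only [single_one_dotProduct]
    simp only [dotProduct, pow_two]
  simp only [e]
  have hi : ∀ a, Integrable (fun v : Fin k → V =>
      ((Pi.single a (1 : ℝ) : κ → ℝ) ⬝ᵥ ∑ i, f (v i)) ^ 2) (Measure.pi fun _ : Fin k => μ) :=
    fun a => (hf.sum_memLp k _).integrable_sq
  refine ⟨integrable_finsetSum _ fun a _ => hi a, ?_⟩
  rw [integral_finsetSum _ fun a _ => hi a]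
  calc _ ≤ ∑ a : κ, k * (σ * ((Pi.single a (1 : ℝ) : κ → ℝ) ⬝ᵥ Pi.single a 1)) :=
        Finset.sum_le_sum fun a _ => hf.sum_var_le k _
    _ = _ := by
        simp only [single_one_dotProduct, Pi.single_eq_same, mul_one, Finset.sum_const,
          Finset.card_univ, nsmul_eq_mul]
        ring

theorem MemLp.mul_prod_two {W : Type*} [MeasurableSpace W] {μ : Measure V} {ν : Measure W}
    [SFinite μ] [SFinite ν] {g : V → ℝ} {h : W → ℝ} (hg : MemLp g 2 μ) (hh : MemLp h 2 ν) :
    MemLp (fun z : V × W => g z.1 * h z.2) 2 (μ.prod ν) := by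
  have hm : AEStronglyMeasurable (fun z : V × W => g z.1 * h z.2) (μ.prod ν) :=
    hg.1.comp_fst.mul hh.1.comp_snd
  rw [memLp_two_iff_integrable_sq hm]
  simp only [mul_pow]
  exact hg.integrable_sq.mul_prod hh.integrable_sq

/-- A martingale computation. Given the other k vectors, the increment from the first is centred, so
the cross term vanishes and the second moment grows by at most 4kσ² times the feature dimension,
with 4k ≤ 2(k + 1)² - 2k². -/
theorem CentredFeature.pairSum_sq {μ : Measure V} [IsProbabilityMeasure μ] {f : V → κ → ℝ} {σ : ℝ}
    (hσ : 0 ≤ σ) (hf : CentredFeature μ f σ) (m : ℕ) :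
    MemLp (fun v : Fin m → V => pairSum f v) 2 (Measure.pi fun _ : Fin m => μ) ∧
      ∫ v, pairSum f v ^ 2 ∂(Measure.pi fun _ : Fin m => μ) ≤
        2 * (m : ℝ) ^ 2 * σ ^ 2 * Fintype.card κ := by
  induction m with
  | zero =>
    have e : ∀ v : Fin 0 → V, pairSum f v = 0 := fun v => by simp [pairSum]
    simp only [e]
    refine ⟨MemLp.zero, ?_⟩
    simp
  | succ k ih =>
    obtain ⟨ihL, ihb⟩ := ih
    set ν := Measure.pi fun _ : Fin k => μ with hν
    set G : V × (Fin k → V) → ℝ := fun z => pairSum f z.2 + 2 * ((∑ i, f (z.2 i)) ⬝ᵥ f z.1) with hG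
    have hmp := measurePreserving_piFinSuccAbove (fun _ : Fin (k + 1) => μ) 0
    have he : ∀ v : Fin (k + 1) → V, pairSum f v =
        G (MeasurableEquiv.piFinSuccAbove (fun _ : Fin (k + 1) => V) 0 v) := fun v => pairSum_succ f v
    have hOL : MemLp (fun z : V × (Fin k → V) => pairSum f z.2) 2 (μ.prod ν) := ihL.comp_snd μ
    have hZL : MemLp (fun z : V × (Fin k → V) => (∑ i, f (z.2 i)) ⬝ᵥ f z.1) 2 (μ.prod ν) := by
      simp only [dotProduct]
      refine memLp_finsetSum _ fun a _ => ?_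
      have h1 := hf.sum_memLp k (Pi.single a 1)
      simp only [single_one_dotProduct] at h1
      refine (MemLp.mul_prod_two (hf.memLp_coord a) h1).congr_norm
        (MemLp.mul_prod_two (hf.memLp_coord a) h1 |>.1.congr ?_) ?_
      · exact ae_of_all _ fun z => mul_comm _ _
      · exact ae_of_all _ fun z => by simp only [mul_comm]
    have hGL : MemLp G 2 (μ.prod ν) := hOL.add (hZL.const_mul 2)
    have hL : MemLp (fun v : Fin (k + 1) → V => pairSum f v) 2
        (Measure.pi fun _ : Fin (k + 1) => μ) := by
      have := hGL.comp_measurePreserving hmp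
      refine this.congr_norm (this.1.congr ?_) ?_
      · exact ae_of_all _ fun v => (he v).symm
      · exact ae_of_all _ fun v => by rw [he v]; rfl
    refine ⟨hL, ?_⟩
    simp only [he]
    rw [hmp.integral_comp' (g := fun z => G z ^ 2), integral_prod_symm _ hGL.integrable_sq]
    obtain ⟨hni, hnb⟩ := hf.sum_normSq k
    have hx : ∀ w : Fin k → V, ∫ x, G (x, w) ^ 2 ∂μ ≤
        pairSum f w ^ 2 + 4 * σ * ((∑ i, f (w i)) ⬝ᵥ ∑ i, f (w i)) := by
      intro w
      set Z := ∑ i, f (w i)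
      have hm1 := (hf.memLp Z).integrable (q := 2) (by norm_num)
      have hm2 := (hf.memLp Z).integrable_sq
      have e : ∀ x, G (x, w) ^ 2 = pairSum f w ^ 2 + (4 * pairSum f w * (Z ⬝ᵥ f x) +
          4 * (Z ⬝ᵥ f x) ^ 2) := fun x => by simp only [hG]; ring
      simp only [e]
      have hs : Integrable (fun x => 4 * pairSum f w * (Z ⬝ᵥ f x) + 4 * (Z ⬝ᵥ f x) ^ 2) μ :=
        (hm1.const_mul _).add (hm2.const_mul _)
      rw [integral_add (integrable_const _) hs,
        integral_add (hm1.const_mul _) (hm2.const_mul _), integral_const_mul, integral_const_mul,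
        hf.mean]
      have := hf.var_le Z
      simp only [integral_const, probReal_univ, smul_eq_mul, one_mul, mul_zero, zero_add]
      linarith
    have hR : Integrable (fun w : Fin k → V =>
        pairSum f w ^ 2 + 4 * σ * ((∑ i, f (w i)) ⬝ᵥ ∑ i, f (w i))) ν :=
      ihL.integrable_sq.add (hni.const_mul _)
    refine (integral_mono hGL.integrable_sq.integral_prod_right hR hx).trans ?_
    rw [integral_add ihL.integrable_sq (hni.const_mul _), integral_const_mul]
    have h1 : 4 * σ * ∫ w, (∑ i, f (w i)) ⬝ᵥ (∑ i, f (w i)) ∂ν ≤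
        4 * σ * (k * σ * Fintype.card κ) := mul_le_mul_of_nonneg_left hnb (by positivity)
    have h2 : (0 : ℝ) ≤ σ ^ 2 * Fintype.card κ := by positivity
    push_cast
    nlinarith

end PairSum

/-! ### Gaussian chaos of order two -/

section Chaos

variable {ι : Type*} [Fintype ι] [DecidableEq ι]

theorem gaussian_sq_sub_one :
    MemLp (fun y : ℝ => y ^ 2 - 1) 2 (gaussianReal 0 1) ∧
      ∫ y, (y ^ 2 - 1) ∂(gaussianReal 0 1) = 0 ∧ Var[fun y : ℝ => y ^ 2 - 1; gaussianReal 0 1] = 2 := by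
  have i4 := integrable_pow_gaussianReal 0 1 4
  have i2 := integrable_pow_gaussianReal 0 1 2
  have e : ∀ y : ℝ, (y ^ 2 - 1) ^ 2 = y ^ 4 - 2 * y ^ 2 + 1 := fun y => by ring
  have hm : Measurable fun y : ℝ => y ^ 2 - 1 := by fun_prop
  have h0 : ∫ y, (y ^ 2 - 1) ∂(gaussianReal 0 1) = 0 := by
    rw [integral_sub i2 (integrable_const _), integral_pow_two_gaussianReal]
    simp
  refine ⟨?_, h0, ?_⟩
  · rw [memLp_two_iff_integrable_sq hm.aestronglyMeasurable]
    simp only [e]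
    exact (i4.sub (i2.const_mul 2)).add (integrable_const _)
  · rw [variance_of_integral_eq_zero hm.aemeasurable h0]
    simp only [e]
    have hs : Integrable (fun y : ℝ => y ^ 4 - 2 * y ^ 2) (gaussianReal 0 1) :=
      i4.sub (i2.const_mul 2)
    rw [integral_add hs (integrable_const _),
      integral_sub i4 (i2.const_mul 2), integral_const_mul, integral_pow_two_gaussianReal,
      integral_pow_four_gaussianReal]
    simp
    norm_num

theorem diagonal_chaos (lam : ι → ℝ) :
    MemLp (fun x : ι → ℝ => ∑ i, lam i * (x i ^ 2 - 1)) 2 (stdPi ι) ∧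
      ∫ x, ∑ i, lam i * (x i ^ 2 - 1) ∂(stdPi ι) = 0 ∧
      ∫ x, (∑ i, lam i * (x i ^ 2 - 1)) ^ 2 ∂(stdPi ι) = 2 * ∑ i, lam i ^ 2 := by
  obtain ⟨g1, g2, g3⟩ := gaussian_sq_sub_one
  have hX : ∀ i, MemLp (fun y : ℝ => lam i * (y ^ 2 - 1)) 2 (gaussianReal 0 1) :=
    fun i => g1.const_mul _
  have hXi : ∀ i, MemLp (fun x : ι → ℝ => lam i * (x i ^ 2 - 1)) 2 (stdPi ι) := fun i =>
    (hX i).comp_measurePreserving (measurePreserving_eval (fun _ : ι => gaussianReal 0 1) i)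
  have hL : MemLp (fun x : ι → ℝ => ∑ i, lam i * (x i ^ 2 - 1)) 2 (stdPi ι) :=
    memLp_finsetSum _ fun i _ => hXi i
  have h0 : ∫ x, ∑ i, lam i * (x i ^ 2 - 1) ∂(stdPi ι) = 0 := by
    rw [integral_finsetSum _ fun i _ => (hXi i).integrable (by norm_num)]
    refine Finset.sum_eq_zero fun i _ => ?_
    rw [stdPi, integral_comp_eval (μ := fun _ : ι => gaussianReal 0 1)
      (f := fun y : ℝ => lam i * (y ^ 2 - 1)) (hX i).aestronglyMeasurable, integral_const_mul, g2,
      mul_zero]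
  refine ⟨hL, h0, ?_⟩
  rw [← variance_of_integral_eq_zero hL.1.aemeasurable h0]
  have e : (fun x : ι → ℝ => ∑ i, lam i * (x i ^ 2 - 1)) =
      ∑ i, fun x : ι → ℝ => lam i * (x i ^ 2 - 1) := by
    funext x; simp only [Finset.sum_apply]
  rw [e, stdPi, variance_sum_pi (μ := fun _ : ι => gaussianReal 0 1)
    (X := fun i y => lam i * (y ^ 2 - 1)) hX, Finset.mul_sum]
  refine Finset.sum_congr rfl fun i _ => ?_
  rw [variance_const_mul, g3]
  ring

/-- Rotating to the eigenbasis leaves independent centred squares, each of variance 2, and ∑ λ² = tr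
H² is the squared Frobenius norm. -/
theorem symmetric_chaos {H : Matrix ι ι ℝ} (hH : Hᵀ = H) :
    MemLp (fun x : ι → ℝ => x ⬝ᵥ H *ᵥ x - H.trace) 2 (stdPi ι) ∧
      ∫ x, (x ⬝ᵥ H *ᵥ x - H.trace) ∂(stdPi ι) = 0 ∧
      ∫ x, (x ⬝ᵥ H *ᵥ x - H.trace) ^ 2 ∂(stdPi ι) = 2 * ∑ i, ∑ j, H i j ^ 2 := by
  obtain ⟨U, lam, hU1, hU2, hHd⟩ := exists_orthogonal_diagonal hH
  have hm : Measurable (fun x : ι → ℝ => Uᵀ *ᵥ x) :=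
    (continuous_const.matrix_mulVec continuous_id).measurable
  have hmp : MeasurePreserving (fun x : ι → ℝ => Uᵀ *ᵥ x) (stdPi ι) (stdPi ι) :=
    ⟨hm, stdPi_map_mulVec (U := Uᵀ) (by rw [transpose_transpose, hU2])⟩
  obtain ⟨d1, d2, d3⟩ := diagonal_chaos lam
  have e : ∀ x : ι → ℝ, x ⬝ᵥ H *ᵥ x - H.trace = ∑ i, lam i * ((Uᵀ *ᵥ x) i ^ 2 - 1) := by
    intro x
    rw [hHd, dotProduct_diagonal_conj, trace_diagonal_conj hU2, ← Finset.sum_sub_distrib]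
    exact Finset.sum_congr rfl fun i _ => by ring
  have hcomp : ∀ g : (ι → ℝ) → ℝ, AEStronglyMeasurable g (stdPi ι) →
      ∫ x, g (Uᵀ *ᵥ x) ∂(stdPi ι) = ∫ x, g x ∂(stdPi ι) := by
    intro g hg
    have h := integral_map (μ := stdPi ι) (φ := fun x : ι → ℝ => Uᵀ *ᵥ x) (f := g) hm.aemeasurable
      (by rw [hmp.map_eq]; exact hg)
    rw [hmp.map_eq] at h
    exact h.symm
  simp only [e]
  refine ⟨d1.comp_measurePreserving hmp, ?_, ?_⟩
  · rw [hcomp _ d1.1, d2]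
  · rw [hcomp (fun x => (∑ i, lam i * (x i ^ 2 - 1)) ^ 2) (d1.1.pow 2), d3]
    have hHH : H * H = U * diagonal (fun i => lam i ^ 2) * Uᵀ := by
      rw [hHd]
      calc U * diagonal lam * Uᵀ * (U * diagonal lam * Uᵀ)
          = U * diagonal lam * (Uᵀ * U) * (diagonal lam * Uᵀ) := by
            simp only [Matrix.mul_assoc]
        _ = U * (diagonal lam * diagonal lam) * Uᵀ := by
            rw [hU2, Matrix.mul_one]; simp only [Matrix.mul_assoc]
        _ = _ := by rw [diagonal_mul_diagonal]; simp only [pow_two]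
    have htr := congrArg Matrix.trace hHH
    rw [trace_diagonal_conj hU2] at htr
    rw [← htr]
    simp only [trace, diag_apply, mul_apply, pow_two]
    congr 1
    refine Finset.sum_congr rfl fun i _ => Finset.sum_congr rfl fun j _ => ?_
    rw [show H j i = Hᵀ i j from rfl, hH]

/-- The centred rank-one feature `(x xᵀ - I) / d`. -/
noncomputable def centredOuter (d : ℕ) (x : Fin d → ℝ) : Fin d × Fin d → ℝ :=
  fun ab => (x ab.1 * x ab.2 - if ab.1 = ab.2 then 1 else 0) / d

/-- The coefficients are symmetrised so that the chaos variance formula applies; symmetrising does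
not increase the Frobenius norm. -/
theorem centredOuter_dotProduct {d : ℕ} (ℓ : Fin d × Fin d → ℝ) (x : Fin d → ℝ) :
    ℓ ⬝ᵥ centredOuter d x =
      (x ⬝ᵥ (Matrix.of fun a b => (ℓ (a, b) + ℓ (b, a)) / (2 * d)) *ᵥ x -
        (Matrix.of fun a b => (ℓ (a, b) + ℓ (b, a)) / (2 * (d : ℝ))).trace) := by
  have e1 : x ⬝ᵥ (Matrix.of fun a b => (ℓ (a, b) + ℓ (b, a)) / (2 * (d : ℝ))) *ᵥ x =
      ∑ a, ∑ b, ℓ (a, b) * (x a * x b) / d := by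
    have h : ∑ a, ∑ b, ℓ (b, a) * (x a * x b) / (2 * d) =
        ∑ a, ∑ b, ℓ (a, b) * (x a * x b) / (2 * (d : ℝ)) := by
      rw [Finset.sum_comm]
      exact Finset.sum_congr rfl fun a _ => Finset.sum_congr rfl fun b _ => by ring
    have h' : ∑ a, ∑ b, ℓ (a, b) * (x a * x b) / (d : ℝ) =
        ∑ a, ∑ b, ℓ (a, b) * (x a * x b) / (2 * d) +
          ∑ a, ∑ b, ℓ (a, b) * (x a * x b) / (2 * d) := by
      simp only [← Finset.sum_add_distrib]
      refine Finset.sum_congr rfl fun a _ => Finset.sum_congr rfl fun b _ => ?_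
      rw [← add_div, ← two_mul, mul_div_mul_left _ _ two_ne_zero]
    rw [h']
    nth_rewrite 2 [← h]
    simp only [dotProduct, mulVec, Matrix.of_apply, Finset.mul_sum, ← Finset.sum_add_distrib]
    refine Finset.sum_congr rfl fun a _ => Finset.sum_congr rfl fun b _ => ?_
    ring
  have e2 : (Matrix.of fun a b => (ℓ (a, b) + ℓ (b, a)) / (2 * (d : ℝ))).trace =
      ∑ a, ∑ b, ℓ (a, b) * (if a = b then 1 else 0) / d := by
    simp only [trace, diag_apply, Matrix.of_apply, mul_ite, mul_one, mul_zero]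
    refine Finset.sum_congr rfl fun a _ => ?_
    rw [← two_mul, mul_div_mul_left _ _ two_ne_zero]
    simp [ite_div]
  rw [e1, e2]
  simp only [dotProduct, centredOuter, Fintype.sum_prod_type, ← Finset.sum_sub_distrib]
  refine Finset.sum_congr rfl fun a _ => Finset.sum_congr rfl fun b _ => ?_
  ring

theorem centredFeature_centredOuter (d : ℕ) :
    CentredFeature (stdPi (Fin d)) (centredOuter d) (2 / (d : ℝ) ^ 2) := by
  have hS : ∀ ℓ : Fin d × Fin d → ℝ,
      (Matrix.of fun a b => (ℓ (a, b) + ℓ (b, a)) / (2 * (d : ℝ)))ᵀ =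
        Matrix.of fun a b => (ℓ (a, b) + ℓ (b, a)) / (2 * (d : ℝ)) := by
    intro ℓ
    ext a b
    simp [add_comm]
  refine ⟨fun ℓ => ?_, fun ℓ => ?_, fun ℓ => ?_⟩
  · simp only [centredOuter_dotProduct]
    exact (symmetric_chaos (hS ℓ)).1
  · simp only [centredOuter_dotProduct]
    exact (symmetric_chaos (hS ℓ)).2.1
  · simp only [centredOuter_dotProduct]
    rw [(symmetric_chaos (hS ℓ)).2.2]
    simp only [Matrix.of_apply, dotProduct, Fintype.sum_prod_type, Finset.mul_sum]
    have hsw : ∑ a, ∑ b, ℓ (b, a) ^ 2 = ∑ a, ∑ b, ℓ (a, b) ^ 2 := Finset.sum_comm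
    have hle : ∀ a b, 2 * ((ℓ (a, b) + ℓ (b, a)) / (2 * (d : ℝ))) ^ 2 ≤
        1 / (d : ℝ) ^ 2 * (ℓ (a, b) ^ 2) + 1 / (d : ℝ) ^ 2 * (ℓ (b, a) ^ 2) := by
      intro a b
      rw [div_pow, mul_pow]
      rcases eq_or_ne (d : ℝ) 0 with h | h
      · simp [h]
      · rw [← mul_add, ← sub_nonneg]
        have : 1 / (d : ℝ) ^ 2 * (ℓ (a, b) ^ 2 + ℓ (b, a) ^ 2) -
            2 * ((ℓ (a, b) + ℓ (b, a)) ^ 2 / (2 ^ 2 * (d : ℝ) ^ 2)) =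
            (ℓ (a, b) - ℓ (b, a)) ^ 2 / (2 * (d : ℝ) ^ 2) := by
          field_simp
          ring
        rw [this]
        positivity
    calc _ ≤ ∑ a, ∑ b, (1 / (d : ℝ) ^ 2 * (ℓ (a, b) ^ 2) + 1 / (d : ℝ) ^ 2 * (ℓ (b, a) ^ 2)) :=
          Finset.sum_le_sum fun a _ => Finset.sum_le_sum fun b _ => hle a b
      _ = 1 / (d : ℝ) ^ 2 * ∑ a, ∑ b, ℓ (a, b) ^ 2 + 1 / (d : ℝ) ^ 2 * ∑ a, ∑ b, ℓ (b, a) ^ 2 := by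
          simp only [Finset.sum_add_distrib, Finset.mul_sum]
      _ = 2 / (d : ℝ) ^ 2 * ∑ a, ∑ b, ℓ (a, b) ^ 2 := by rw [hsw]; ring
      _ = _ := by
          simp only [Finset.mul_sum, pow_two]

/-- The second moment is at most 2m²(2/d²)²d² = 8m²/d², and Markov's inequality at (m/5)² leaves
200/d². -/
theorem negligible_pairSum_large :
    Negligible 1 (fun m d => {x | 0 < m ∧ (m : ℝ) / 5 ≤ pairSum (centredOuter d) x}) := by
  refine negligible_of_eventually (δ := fun d : ℕ => 200 * ((d : ℝ) ^ 2)⁻¹) ?_ ?_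
  · have := (tendsto_natCast_atTop_atTop (R := ℝ))
    have h := (tendsto_inv_atTop_zero.comp ((tendsto_pow_atTop (two_ne_zero)).comp this)).const_mul
      (200 : ℝ)
    simpa using h
  filter_upwards [eventually_ge_atTop 1] with d hd m hm
  have hd1 : (1 : ℝ) ≤ d := by exact_mod_cast hd
  have hd0 : (0 : ℝ) < d := by linarith
  rcases Nat.eq_zero_or_pos m with hm0 | hm0
  · have : {x : Fin m → Fin d → ℝ | 0 < m ∧ (m : ℝ) / 5 ≤ pairSum (centredOuter d) x} = ∅ := by
      ext x; simp [hm0]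
    rw [this]
    simp only [measureReal_empty]
    positivity
  have hm1 : (0 : ℝ) < m := by exact_mod_cast hm0
  obtain ⟨hL, hb⟩ := (centredFeature_centredOuter d).pairSum_sq (by positivity) m
  have hmk := mul_meas_ge_le_integral_of_nonneg (μ := samplePi m d)
    (ae_of_all _ fun x => sq_nonneg (pairSum (centredOuter d) x)) hL.integrable_sq
    (((m : ℝ) / 5) ^ 2)
  have hsub : {x : Fin m → Fin d → ℝ | 0 < m ∧ (m : ℝ) / 5 ≤ pairSum (centredOuter d) x} ⊆
      {x | ((m : ℝ) / 5) ^ 2 ≤ pairSum (centredOuter d) x ^ 2} := fun x hx =>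
    pow_le_pow_left₀ (by positivity) hx.2 2
  refine (measureReal_mono hsub).trans ?_
  have h2 := hmk.trans hb
  rw [mul_comm, ← le_div_iff₀ (by positivity)] at h2
  refine h2.trans (le_of_eq ?_)
  simp only [Fintype.card_prod, Fintype.card_fin, Nat.cast_mul]
  field_simp
  norm_num

end Chaos

/-! ### Independence of length and direction -/

theorem stdPi_eq_withDensity (ι : Type*) [Fintype ι] [DecidableEq ι] :
    stdPi ι = (volume : Measure (ι → ℝ)).withDensity
      (fun x => ENNReal.ofReal (∏ i, gaussianPDFReal 0 1 (x i))) := by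
  refine Measure.pi_eq (μ := fun _ : ι => gaussianReal 0 1) (fun s hs => ?_)
  rw [withDensity_apply _ (MeasurableSet.univ_pi hs), volume_pi, Measure.restrict_pi_pi]
  have hint : ∀ i, Integrable (gaussianPDFReal 0 1) ((volume : Measure ℝ).restrict (s i)) :=
    fun i => (integrable_gaussianPDFReal 0 1).integrableOn
  rw [← ofReal_integral_eq_lintegral_ofReal (Integrable.fintype_prod hint)
    (ae_of_all _ fun x => Finset.prod_nonneg fun i _ => gaussianPDFReal_nonneg _ _ _),
    integral_fintype_prod_eq_prod (fun _ : ι => gaussianPDFReal 0 1),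
    ENNReal.ofReal_prod_of_nonneg fun i _ =>
      integral_nonneg fun x => gaussianPDFReal_nonneg _ _ _]
  exact Finset.prod_congr rfl fun i _ => (gaussianReal_apply_eq_integral 0 one_ne_zero (s i)).symm

/-- The radial profile of the standard Gaussian density in dimension `n`. -/
noncomputable def gaussianProfile (n : ℕ) (r : ℝ) : ENNReal :=
  ENNReal.ofReal ((Real.sqrt (2 * Real.pi))⁻¹ ^ n * Real.exp (-r ^ 2 / 2))

theorem measurable_gaussianProfile (n : ℕ) : Measurable (gaussianProfile n) := by
  unfold gaussianProfile
  fun_prop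

theorem prod_gaussianPDFReal {ι : Type*} [Fintype ι] (x : EuclideanSpace ℝ ι) :
    ENNReal.ofReal (∏ i, gaussianPDFReal 0 1 (x i)) = gaussianProfile (Fintype.card ι) ‖x‖ := by
  unfold gaussianProfile gaussianPDFReal
  congr 1
  rw [Finset.prod_mul_distrib, Finset.prod_const, Finset.card_univ, ← Real.exp_sum]
  congr 2
  · simp
  · rw [EuclideanSpace.real_norm_sq_eq, neg_div, Finset.sum_div, ← Finset.sum_neg_distrib]
    refine Finset.sum_congr rfl fun i _ => ?_
    simp [neg_div]

/-- The Euclidean length of a raw vector. -/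
noncomputable def vecLength {ι : Type*} [Fintype ι] (x : ι → ℝ) : ℝ := Real.sqrt (x ⬝ᵥ x)

theorem vecLength_eq_norm {ι : Type*} [Fintype ι] (x : EuclideanSpace ℝ ι) :
    vecLength (WithLp.ofLp x) = ‖x‖ := by
  rw [vecLength, EuclideanSpace.norm_eq]
  simp [dotProduct, pow_two]

/-- The direction of a raw vector. -/
noncomputable def vecDirection {ι : Type*} [Fintype ι] (x : ι → ℝ) : ι → ℝ :=
  (vecLength x)⁻¹ • x

theorem measurable_vecLength {ι : Type*} [Fintype ι] :
    Measurable (vecLength : (ι → ℝ) → ℝ) := by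
  unfold vecLength
  simp only [dotProduct]
  fun_prop

theorem measurable_vecDirection {ι : Type*} [Fintype ι] :
    Measurable (vecDirection : (ι → ℝ) → ι → ℝ) :=
  measurable_vecLength.inv.smul measurable_id

theorem vecLength_smul_vecDirection {ι : Type*} [Fintype ι] (x : ι → ℝ) :
    vecLength x • vecDirection x = x := by
  rcases eq_or_ne (vecLength x) 0 with h | h
  · have h2 : x ⬝ᵥ x = 0 := by
      rwa [vecLength, Real.sqrt_eq_zero (by
        simpa [dotProduct] using Finset.sum_nonneg fun i (_ : i ∈ Finset.univ) =>
          mul_self_nonneg (x i))] at h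
    rw [h, zero_smul, dotProduct_self_eq_zero.1 h2]
  · rw [vecDirection, smul_smul, mul_inv_cancel₀ h, one_smul]

/-- Polar coordinates turn Lebesgue measure into a product, and the Gaussian density is radial. The
two factors need no normalisation, since this form already yields independence. -/
theorem stdPi_polar_measure (ι : Type*) [Fintype ι] [DecidableEq ι] [Nonempty ι] :
    ∃ (σ : Set (ι → ℝ) → ENNReal) (τ : Set ℝ → ENNReal), ∀ A B, MeasurableSet A → MeasurableSet B →
      stdPi ι (vecLength ⁻¹' B ∩ vecDirection ⁻¹' A) = τ B * σ A := by
  set E := EuclideanSpace ℝ ι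
  set S := (volume : Measure E).toSphere
  set R := Measure.volumeIoiPow (Module.finrank ℝ E - 1)
  refine ⟨fun A => ∫⁻ u, A.indicator 1 (WithLp.ofLp (u : E)) ∂S,
    fun B => ∫⁻ r, B.indicator 1 (r : ℝ) * gaussianProfile (Fintype.card ι) (r : ℝ) ∂(R), ?_⟩
  intro A B hA hB
  have hmE : Measurable (WithLp.ofLp : E → ι → ℝ) := (PiLp.volume_preserving_ofLp ι).measurable
  have hC : MeasurableSet (vecLength ⁻¹' B ∩ vecDirection ⁻¹' A : Set (ι → ℝ)) :=
    (measurable_vecLength hB).inter (measurable_vecDirection hA)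
  have hdm : Measurable fun x : ι → ℝ => ENNReal.ofReal (∏ i, gaussianPDFReal 0 1 (x i)) :=
    (Finset.measurable_prod _ fun i _ =>
      (measurable_gaussianPDFReal 0 1).comp (measurable_pi_apply i)).ennreal_ofReal
  set F : E → ENNReal := fun x => (B.indicator 1 ‖x‖ * gaussianProfile (Fintype.card ι) ‖x‖) *
    A.indicator 1 (WithLp.ofLp (‖x‖⁻¹ • x)) with hF
  have hstep : stdPi ι (vecLength ⁻¹' B ∩ vecDirection ⁻¹' A) = ∫⁻ x, F x := by
    rw [stdPi_eq_withDensity, withDensity_apply _ hC, ← lintegral_indicator hC,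
      ← (PiLp.volume_preserving_ofLp ι).lintegral_comp (hdm.indicator hC)]
    refine lintegral_congr fun x => ?_
    have hd : vecDirection (WithLp.ofLp x) = WithLp.ofLp (‖x‖⁻¹ • x) := by
      rw [vecDirection, vecLength_eq_norm]; rfl
    have hmem : WithLp.ofLp x ∈ (vecLength ⁻¹' B ∩ vecDirection ⁻¹' A : Set (ι → ℝ)) ↔
        ‖x‖ ∈ B ∧ WithLp.ofLp (‖x‖⁻¹ • x) ∈ A := by
      rw [Set.mem_inter_iff, Set.mem_preimage, Set.mem_preimage, vecLength_eq_norm, hd]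
    by_cases h1 : ‖x‖ ∈ B
    · by_cases h2 : WithLp.ofLp (‖x‖⁻¹ • x) ∈ A
      · rw [Set.indicator_of_mem (hmem.2 ⟨h1, h2⟩), prod_gaussianPDFReal, hF]
        dsimp only
        rw [Set.indicator_of_mem h1, Set.indicator_of_mem h2, Pi.one_apply, Pi.one_apply, one_mul,
          mul_one]
      · rw [Set.indicator_of_notMem (fun h => h2 (hmem.1 h).2), hF]
        dsimp only
        rw [Set.indicator_of_notMem h2, mul_zero]
    · rw [Set.indicator_of_notMem (fun h => h1 (hmem.1 h).1), hF]
      dsimp only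
      rw [Set.indicator_of_notMem h1, zero_mul, zero_mul]
  rw [hstep]
  have h0 : ∫⁻ x, F x = ∫⁻ x : ({(0 : E)}ᶜ : Set E), F x ∂(Measure.comap Subtype.val volume) := by
    rw [lintegral_subtype_comap (measurableSet_singleton _).compl, restrict_compl_singleton]
  rw [h0]
  have hmp := (volume : Measure E).measurePreserving_homeomorphUnitSphereProd
  set G : Metric.sphere (0 : E) 1 × Set.Ioi (0 : ℝ) → ENNReal := fun z =>
    A.indicator 1 (WithLp.ofLp (z.1 : E)) *
      (B.indicator 1 (z.2 : ℝ) * gaussianProfile (Fintype.card ι) z.2) with hG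
  have hGe : ∀ x : ({(0 : E)}ᶜ : Set E), F x = G (homeomorphUnitSphereProd E x) := by
    intro x
    simp only [hF, hG, homeomorphUnitSphereProd_apply_snd_coe,
      homeomorphUnitSphereProd_apply_fst_coe]
    rw [mul_comm]
  simp only [hGe]
  rw [hmp.lintegral_comp_emb (Homeomorph.measurableEmbedding _)]
  have hm1 : Measurable fun u : Metric.sphere (0 : E) 1 =>
      A.indicator (1 : (ι → ℝ) → ENNReal) (WithLp.ofLp (u : E)) :=
    (measurable_one.indicator hA).comp (hmE.comp measurable_subtype_coe)
  have hm2 : Measurable fun r : Set.Ioi (0 : ℝ) =>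
      B.indicator (1 : ℝ → ENNReal) (r : ℝ) * gaussianProfile (Fintype.card ι) r :=
    ((measurable_one.indicator hB).mul (measurable_gaussianProfile _)).comp measurable_subtype_coe
  rw [mul_comm]
  exact lintegral_prod_mul hm1.aemeasurable hm2.aemeasurable

/-- Length and direction of a standard Gaussian vector are independent. -/
theorem indepFun_vecLength_vecDirection (ι : Type*) [Fintype ι] [DecidableEq ι] [Nonempty ι] :
    IndepFun (vecLength : (ι → ℝ) → ℝ) vecDirection (stdPi ι) := by
  obtain ⟨σ, τ, h⟩ := stdPi_polar_measure ι
  rw [indepFun_iff_measure_inter_preimage_eq_mul]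
  intro B A hB hA
  have h1 := h A Set.univ hA MeasurableSet.univ
  have h2 := h Set.univ B MeasurableSet.univ hB
  have h3 := h Set.univ Set.univ MeasurableSet.univ MeasurableSet.univ
  simp only [Set.preimage_univ, Set.univ_inter, Set.inter_univ, measure_univ] at h1 h2 h3
  rw [h A B hA hB, h1, h2]
  -- The unnormalised factors satisfy τ(univ) σ(univ) = 1, which lets the product be regrouped.
  calc τ B * σ A = τ B * σ A * 1 := (mul_one _).symm
    _ = τ B * σ A * (τ Set.univ * σ Set.univ) := by rw [← h3]
    _ = _ := by ring

/-- The length of the first vector in the direction of the second. -/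
noncomputable def polarCombine {ι : Type*} [Fintype ι] (z : (ι → ℝ) × (ι → ℝ)) : ι → ℝ :=
  vecLength z.1 • vecDirection z.2

/-- Independence of length and direction as a decoupling: lengths may be taken from one sample and
directions from an independent one. -/
theorem measurePreserving_polarCombine (ι : Type*) [Fintype ι] [DecidableEq ι] [Nonempty ι] :
    MeasurePreserving (polarCombine : (ι → ℝ) × (ι → ℝ) → ι → ℝ)
      ((stdPi ι).prod (stdPi ι)) (stdPi ι) := by
  have hl := measurable_vecLength (ι := ι)
  have hg := measurable_vecDirection (ι := ι)
  have hs : Measurable fun p : ℝ × (ι → ℝ) => p.1 • p.2 := measurable_fst.smul measurable_snd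
  have hi := (indepFun_iff_map_prod_eq_prod_map_map hl.aemeasurable hg.aemeasurable).1
    (indepFun_vecLength_vecDirection ι)
  refine ⟨hs.comp ((hl.comp measurable_fst).prodMk (hg.comp measurable_snd)), ?_⟩
  have e1 : (polarCombine : (ι → ℝ) × (ι → ℝ) → ι → ℝ) =
      (fun p : ℝ × (ι → ℝ) => p.1 • p.2) ∘ Prod.map vecLength vecDirection := rfl
  rw [e1, ← Measure.map_map hs (hl.prodMap hg), ← Measure.map_prod_map _ _ hl hg, ← hi,
    Measure.map_map hs (hl.prodMk hg)]
  have e2 : (fun p : ℝ × (ι → ℝ) => p.1 • p.2) ∘ (fun ω : ι → ℝ => (vecLength ω, vecDirection ω)) =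
      id := funext fun x => vecLength_smul_vecDirection x
  rw [e2, Measure.map_id]

/-- The coordinatewise polar combination of two samples is again a sample. -/
theorem measurePreserving_polarCombine_pi {m d : ℕ} (hd : 1 ≤ d) :
    MeasurePreserving (fun (z : (Fin m → Fin d → ℝ) × (Fin m → Fin d → ℝ)) i =>
      polarCombine (z.1 i, z.2 i)) ((samplePi m d).prod (samplePi m d)) (samplePi m d) := by
  have : Nonempty (Fin d) := ⟨⟨0, hd⟩⟩
  have h1 := (measurePreserving_arrowProdEquivProdArrow (Fin d → ℝ) (Fin d → ℝ) (Fin m)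
    (fun _ => stdPi (Fin d)) (fun _ => stdPi (Fin d))).symm
  have h2 := measurePreserving_pi (fun _ : Fin m => (stdPi (Fin d)).prod (stdPi (Fin d)))
    (fun _ : Fin m => stdPi (Fin d)) (f := fun _ => polarCombine)
    (fun _ => measurePreserving_polarCombine (Fin d))
  exact h2.comp h1

/-- The Gram matrix of the traceless parts of the direction projections. -/
noncomputable def dirGram {m d : ℕ} (x : Fin m → Fin d → ℝ) : Matrix (Fin m) (Fin m) ℝ :=
  Matrix.of fun i j => (x i ⬝ᵥ x j) ^ 2 / ((x i ⬝ᵥ x i) * (x j ⬝ᵥ x j)) - 1 / d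

/-- The solution of `dirGram x *ᵥ w = 1`. -/
noncomputable def dirSolution {m d : ℕ} (x : Fin m → Fin d → ℝ) : Fin m → ℝ :=
  (dirGram x)⁻¹ *ᵥ fun _ => 1

/-! ### Direction Gram matrix and radial fluctuations -/

theorem dirGram_smul {m d : ℕ} (x : Fin m → Fin d → ℝ) {c : Fin m → ℝ} (hc : ∀ i, c i ≠ 0) :
    dirGram (fun i => c i • x i) = dirGram x := by
  ext i j
  simp only [dirGram, Matrix.of_apply, smul_dotProduct, dotProduct_smul, smul_eq_mul]
  congr 1
  have hi := hc i
  have hj := hc j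
  calc (c j * (c i * (x i ⬝ᵥ x j))) ^ 2 /
        (c i * (c i * (x i ⬝ᵥ x i)) * (c j * (c j * (x j ⬝ᵥ x j))))
      = ((c i * c j) ^ 2 * (x i ⬝ᵥ x j) ^ 2) /
        ((c i * c j) ^ 2 * ((x i ⬝ᵥ x i) * (x j ⬝ᵥ x j))) := by
        congr 1 <;> ring
    _ = _ := mul_div_mul_left _ _ (pow_ne_zero 2 (mul_ne_zero hi hj))

theorem measurable_dirSolution {m d : ℕ} :
    Measurable (dirSolution : (Fin m → Fin d → ℝ) → Fin m → ℝ) := by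
  have h1 : Measurable (dirGram : (Fin m → Fin d → ℝ) → Matrix (Fin m) (Fin m) ℝ) := by
    refine measurable_pi_lambda _ fun i => measurable_pi_lambda _ fun j => ?_
    simp only [dirGram, Matrix.of_apply, dotProduct]
    fun_prop
  have h2 := measurable_matrix_inv.comp h1
  refine measurable_pi_lambda _ fun i => ?_
  simp only [dirSolution, mulVec, dotProduct, mul_one]
  exact Finset.measurable_sum _ fun j _ =>
    (measurable_pi_apply j).comp ((measurable_pi_apply i).comp h2)

/-- The relative excess `1 - 1/ρ` of the squared radius, truncated at `ρ = 1/2`. -/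
noncomputable def relExcess {d : ℕ} (x : Fin d → ℝ) : ℝ := 1 - 1 / max (sqRadius x) (1 / 2)

/-- The truncation at 1/2 makes the excess bounded, hence square integrable. It is inactive on good
samples, where ρ ≥ 9/10. -/
theorem relExcess_bounds (ρ : ℝ) (hρ : 0 ≤ ρ) :
    1 - 1 / max ρ (1 / 2) ≤ ρ - 1 ∧ (ρ - 1) - 2 * (ρ - 1) ^ 2 ≤ 1 - 1 / max ρ (1 / 2) ∧
      (1 - 1 / max ρ (1 / 2)) ^ 2 ≤ 4 * (ρ - 1) ^ 2 ∧ |1 - 1 / max ρ (1 / 2)| ≤ 1 := by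
  rcases le_total (1 / 2) ρ with h | h
  · rw [max_eq_left h]
    have hp : 0 < ρ := by linarith
    have hi : 0 < 1 / ρ := by positivity
    have hi2 : 1 / ρ ≤ 2 := by rw [div_le_iff₀ hp]; linarith
    have e1 : (ρ - 1) - (1 - 1 / ρ) = (ρ - 1) ^ 2 * (1 / ρ) := by field_simp
    have e2 : 1 - 1 / ρ = (ρ - 1) * (1 / ρ) := by field_simp
    refine ⟨?_, ?_, ?_, ?_⟩
    · have : 0 ≤ (ρ - 1) ^ 2 * (1 / ρ) := by positivity
      linarith
    · have : (ρ - 1) ^ 2 * (1 / ρ) ≤ (ρ - 1) ^ 2 * 2 :=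
        mul_le_mul_of_nonneg_left hi2 (sq_nonneg _)
      linarith
    · rw [e2, mul_pow]
      have : (1 / ρ) ^ 2 ≤ 4 := by nlinarith
      nlinarith [mul_le_mul_of_nonneg_left this (sq_nonneg (ρ - 1))]
    · rw [abs_le]; constructor <;> linarith
  · rw [max_eq_right h]
    norm_num
    refine ⟨hρ, ?_, ?_⟩ <;> nlinarith

theorem measurable_relExcess {d : ℕ} : Measurable (relExcess : (Fin d → ℝ) → ℝ) := by
  have := measurable_sqRadius (d := d)
  unfold relExcess
  fun_prop

theorem memLp_relExcess (d : ℕ) : MemLp (relExcess : (Fin d → ℝ) → ℝ) 2 (stdPi (Fin d)) :=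
  MemLp.of_bound measurable_relExcess.aestronglyMeasurable 1
    (ae_of_all _ fun x => (relExcess_bounds _ (sqRadius_nonneg x)).2.2.2)

theorem integral_relExcess_sq_le {d : ℕ} (hd : 1 ≤ d) :
    ∫ x, relExcess x ^ 2 ∂(stdPi (Fin d)) ≤ 768 / (d : ℝ) := by
  obtain ⟨h1, h2⟩ := excess_sq_moment hd
  calc ∫ x, relExcess x ^ 2 ∂(stdPi (Fin d)) ≤ ∫ x, 4 * (sqRadius x - 1) ^ 2 ∂(stdPi (Fin d)) :=
        integral_mono (memLp_relExcess d).integrable_sq (h1.const_mul 4)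
          fun x => (relExcess_bounds _ (sqRadius_nonneg x)).2.2.1
    _ ≤ 4 * (192 / (d : ℝ)) := by
        rw [integral_const_mul]
        exact mul_le_mul_of_nonneg_left h2 (by norm_num)
    _ = _ := by ring

/-- The first-order part ρ - 1 has mean 0, so only a second-order term of size 1/d remains. Its sign
is what later keeps s below 1 + o(1). -/
theorem integral_relExcess_mem {d : ℕ} (hd : 1 ≤ d) :
    -(384 / (d : ℝ)) ≤ ∫ x, relExcess x ∂(stdPi (Fin d)) ∧
      ∫ x, relExcess x ∂(stdPi (Fin d)) ≤ 0 := by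
  obtain ⟨h1, h2⟩ := excess_sq_moment hd
  obtain ⟨e1, e2⟩ := integral_excess hd
  have hi := (memLp_relExcess d).integrable (by norm_num)
  constructor
  · have h : ∫ x, ((sqRadius x - 1) - 2 * (sqRadius x - 1) ^ 2) ∂(stdPi (Fin d)) ≤
        ∫ x, relExcess x ∂(stdPi (Fin d)) := integral_mono (e1.sub (h1.const_mul 2)) hi
      fun x => (relExcess_bounds _ (sqRadius_nonneg x)).2.1
    rw [integral_sub e1 (h1.const_mul 2), integral_const_mul, e2] at h
    have : 384 / (d : ℝ) = 2 * (192 / d) := by ring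
    linarith
  · rw [← e2]
    exact integral_mono hi e1 fun x => (relExcess_bounds _ (sqRadius_nonneg x)).1

theorem vecLength_ne_zero {ι : Type*} [Fintype ι] {x : ι → ℝ} (hx : x ≠ 0) : vecLength x ≠ 0 := by
  intro h
  rw [← vecLength_smul_vecDirection x, h, zero_smul] at hx
  exact hx rfl

theorem dotProduct_self_polarCombine {ι : Type*} [Fintype ι] [DecidableEq ι]
    {z : (ι → ℝ) × (ι → ℝ)} (hz : z.2 ≠ 0) :
    polarCombine z ⬝ᵥ polarCombine z = z.1 ⬝ᵥ z.1 := by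
  have h2 := vecLength_ne_zero hz
  have hs : ∀ x : ι → ℝ, vecLength x ^ 2 = x ⬝ᵥ x := fun x =>
    Real.sq_sqrt (dotProduct_self_nonneg_real x)
  rw [polarCombine, vecDirection, smul_smul, smul_dotProduct, dotProduct_smul, ← hs z.2, ← hs z.1,
    smul_eq_mul, smul_eq_mul]
  field_simp

/-- The centred radial fluctuations weighted by the direction solution. -/
noncomputable def radialFluctuation {m d : ℕ} (x y : Fin m → Fin d → ℝ) : ℝ :=
  ∑ i, (relExcess (x i) - ∫ z, relExcess z ∂(stdPi (Fin d))) * dirSolution y i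

theorem measurable_radialFluctuation {m d : ℕ} :
    Measurable fun z : (Fin m → Fin d → ℝ) × (Fin m → Fin d → ℝ) =>
      radialFluctuation z.1 z.2 := by
  unfold radialFluctuation
  refine Finset.measurable_sum _ fun i _ => Measurable.mul ?_ ?_
  · exact (measurable_relExcess.comp ((measurable_pi_apply i).comp measurable_fst)).sub_const _
  · exact (measurable_pi_apply i).comp (measurable_dirSolution.comp measurable_snd)

/-- With the direction sample frozen, the weights are constants and Chebyshev applies to the radii.
-/
theorem radialFluctuation_prod_tail {m d : ℕ} (hd : 1 ≤ d) {a : ℝ} (ha : 0 < a) :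
    ((samplePi m d).prod (samplePi m d)).real {z | dirSolution z.2 ⬝ᵥ dirSolution z.2 ≤ 16 * m ∧
      a ≤ |radialFluctuation z.1 z.2|} ≤ 768 / (d : ℝ) * (16 * m) / a ^ 2 := by
  have hw : Measurable fun z : (Fin m → Fin d → ℝ) × (Fin m → Fin d → ℝ) =>
      dirSolution z.2 ⬝ᵥ dirSolution z.2 := by
    have h := measurable_dirSolution (m := m) (d := d)
    simp only [dotProduct]
    fun_prop
  have hms : MeasurableSet {z : (Fin m → Fin d → ℝ) × (Fin m → Fin d → ℝ) |
      dirSolution z.2 ⬝ᵥ dirSolution z.2 ≤ 16 * m ∧ a ≤ |radialFluctuation z.1 z.2|} :=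
    (measurableSet_le hw measurable_const).inter
      (measurableSet_le measurable_const measurable_radialFluctuation.abs)
  refine measureReal_prod_le_of_section_le hms (by positivity) fun y => ?_
  by_cases hy : dirSolution y ⬝ᵥ dirSolution y ≤ 16 * m
  · refine le_trans (measureReal_mono ?_) ((weighted_sum_chebyshev (memLp_relExcess d)
      (integral_relExcess_sq_le hd) (dirSolution y) ha).trans ?_)
    · exact fun x hx => hx.2
    · gcongr
  · have : (fun x : Fin m → Fin d → ℝ => (x, y)) ⁻¹' {z | dirSolution z.2 ⬝ᵥ dirSolution z.2 ≤
        16 * m ∧ a ≤ |radialFluctuation z.1 z.2|} = ∅ := by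
      ext x
      simp only [Set.mem_preimage, Set.mem_empty_iff_false, iff_false]
      exact fun hx => hy hx.1
    rw [this, measureReal_empty]
    positivity

/-- Realise the sample by polar combination of two independent ones: the weights see only the
second, the radial excesses only the first. Nonzero vectors are required for the directions to
exist. -/
theorem radialFluctuation_tail {m d : ℕ} (hd : 1 ≤ d) {a : ℝ} (ha : 0 < a) :
    (samplePi m d).real {x | (∀ i, x i ≠ 0) ∧ dirSolution x ⬝ᵥ dirSolution x ≤ 16 * m ∧
      a ≤ |radialFluctuation x x|} ≤ 768 / (d : ℝ) * (16 * m) / a ^ 2 := by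
  refine le_trans ?_ (radialFluctuation_prod_tail hd ha)
  have hmp := measurePreserving_polarCombine_pi (m := m) hd
  have hw : Measurable fun x : Fin m → Fin d → ℝ => dirSolution x ⬝ᵥ dirSolution x := by
    have h := measurable_dirSolution (m := m) (d := d)
    simp only [dotProduct]
    fun_prop
  have h0 : MeasurableSet {x : Fin m → Fin d → ℝ | ∀ i, x i ≠ 0} := by
    have : {x : Fin m → Fin d → ℝ | ∀ i, x i ≠ 0} = ⋂ i, Function.eval i ⁻¹' {0}ᶜ := by
      ext x; simp
    rw [this]
    exact MeasurableSet.iInter fun i => measurable_pi_apply i (measurableSet_singleton _).compl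
  have hms : MeasurableSet {x : Fin m → Fin d → ℝ | (∀ i, x i ≠ 0) ∧
      dirSolution x ⬝ᵥ dirSolution x ≤ 16 * m ∧ a ≤ |radialFluctuation x x|} :=
    h0.inter ((measurableSet_le hw measurable_const).inter
      (measurableSet_le measurable_const
        (measurable_radialFluctuation.comp (measurable_id.prodMk measurable_id)).abs))
  rw [← hmp.measureReal_preimage hms.nullMeasurableSet]
  refine measureReal_mono ?_
  rintro z ⟨hz0, hzw, hza⟩
  have h1 : ∀ i, z.1 i ≠ 0 ∧ z.2 i ≠ 0 := by
    intro i
    have h := hz0 i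
    constructor
    · rintro h1
      exact h (by simp [polarCombine, h1, vecLength])
    · rintro h1
      exact h (by simp [polarCombine, h1, vecDirection])
  have hg : dirGram (fun i => polarCombine (z.1 i, z.2 i)) = dirGram z.2 := by
    have e : (fun i => polarCombine (z.1 i, z.2 i)) =
        fun i => (vecLength (z.1 i) * (vecLength (z.2 i))⁻¹) • z.2 i := by
      funext i
      rw [polarCombine, vecDirection, smul_smul]
    rw [e]
    exact dirGram_smul z.2 fun i =>
      mul_ne_zero (vecLength_ne_zero (h1 i).1) (inv_ne_zero (vecLength_ne_zero (h1 i).2))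
  have hsol : dirSolution (fun i => polarCombine (z.1 i, z.2 i)) = dirSolution z.2 := by
    rw [dirSolution, dirSolution, hg]
  have hrel : ∀ i, relExcess (polarCombine (z.1 i, z.2 i)) = relExcess (z.1 i) := by
    intro i
    rw [relExcess, relExcess, sqRadius, sqRadius,
      dotProduct_self_polarCombine (z := (z.1 i, z.2 i)) (h1 i).2]
  have hfl : radialFluctuation (fun i => polarCombine (z.1 i, z.2 i))
      (fun i => polarCombine (z.1 i, z.2 i)) = radialFluctuation z.1 z.2 := by
    simp only [radialFluctuation, hsol, hrel]
  simp only [hsol] at hzw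
  rw [hfl] at hza
  exact ⟨hzw, hza⟩

/-- The variance is of order m/d ≤ d, so the threshold d^(3/4) leaves probability of order d^(-1/2)
and is still o(d). -/
theorem negligible_radialFluctuation :
    Negligible 1 (fun m d => {x | (∀ i, x i ≠ 0) ∧ dirSolution x ⬝ᵥ dirSolution x ≤ 16 * m ∧
      (d : ℝ) ^ (3 / 4 : ℝ) ≤ |radialFluctuation x x|}) := by
  have hcast := tendsto_natCast_atTop_atTop (R := ℝ)
  have h := ((tendsto_rpow_neg_atTop (y := 1 / 2) (by norm_num)).comp hcast).const_mul (768 * 16)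
  rw [mul_zero] at h
  refine negligible_of_eventually h ?_
  filter_upwards [eventually_ge_atTop 1] with d hd m hm
  have hd1 : (1 : ℝ) ≤ d := by exact_mod_cast hd
  have hd0 : (0 : ℝ) < d := by linarith
  refine (radialFluctuation_tail hd (Real.rpow_pos_of_pos hd0 _)).trans ?_
  simp only [Function.comp]
  have e1 : ((d : ℝ) ^ (3 / 4 : ℝ)) ^ 2 = (d : ℝ) * (d : ℝ) ^ (1 / 2 : ℝ) := by
    rw [← Real.rpow_natCast, ← Real.rpow_mul hd0.le, ← Real.rpow_one_add' hd0.le (by norm_num)]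
    norm_num
  have hq : 0 < (d : ℝ) ^ (1 / 2 : ℝ) := Real.rpow_pos_of_pos hd0 _
  rw [e1, Real.rpow_neg hd0.le]
  calc 768 / (d : ℝ) * (16 * m) / (d * (d : ℝ) ^ (1 / 2 : ℝ))
      ≤ 768 / (d : ℝ) * (16 * (1 * (d : ℝ) ^ 2)) / (d * (d : ℝ) ^ (1 / 2 : ℝ)) := by gcongr
    _ = _ := by field_simp

/-! ### Coercive matrices and forms of their inverses -/

section Coercive

variable {ι : Type*} [Fintype ι] [DecidableEq ι]

theorem posDef_of_coercive {P : Matrix ι ι ℝ} (hP : Pᵀ = P) {c : ℝ} (hc : 0 < c)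
    (h : ∀ t : ι → ℝ, c * (t ⬝ᵥ t) ≤ t ⬝ᵥ P *ᵥ t) : P.PosDef := by
  refine Matrix.PosDef.of_dotProduct_mulVec_pos (by
    rw [IsHermitian, conjTranspose_eq_transpose_of_trivial, hP]) fun x hx => ?_
  rw [star_trivial]
  refine lt_of_lt_of_le (mul_pos hc ?_) (h x)
  exact lt_of_le_of_ne (dotProduct_self_nonneg_real x)
    fun h0 => hx (dotProduct_self_eq_zero.1 h0.symm)

theorem mulVec_inv_mulVec {P : Matrix ι ι ℝ} (hP : IsUnit P) (b : ι → ℝ) :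
    P *ᵥ (P⁻¹ *ᵥ b) = b := by
  rw [mulVec_mulVec, Matrix.mul_nonsing_inv _ ((Matrix.isUnit_iff_isUnit_det _).1 hP), one_mulVec]

/-- Everything follows from coercivity at y = P⁻¹b together with expanded squares. The last bound is
Cauchy–Schwarz for the inner product of P, obtained from nonnegativity of its form at b - sy. -/
theorem inv_form_bounds {P : Matrix ι ι ℝ} (hP : Pᵀ = P) {c : ℝ} (hc : 0 < c)
    (h : ∀ t : ι → ℝ, c * (t ⬝ᵥ t) ≤ t ⬝ᵥ P *ᵥ t) (b : ι → ℝ) :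
    0 ≤ b ⬝ᵥ P⁻¹ *ᵥ b ∧ c * (b ⬝ᵥ P⁻¹ *ᵥ b) ≤ b ⬝ᵥ b ∧
      c ^ 2 * ((P⁻¹ *ᵥ b) ⬝ᵥ (P⁻¹ *ᵥ b)) ≤ b ⬝ᵥ b ∧
      (b ⬝ᵥ b) ^ 2 ≤ (b ⬝ᵥ P *ᵥ b) * (b ⬝ᵥ P⁻¹ *ᵥ b) := by
  have hU := (posDef_of_coercive hP hc h).isUnit
  set y := P⁻¹ *ᵥ b with hy
  have hPy : P *ᵥ y = b := mulVec_inv_mulVec hU b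
  have h1 := h y
  rw [hPy, dotProduct_comm y b] at h1
  have hyy := dotProduct_self_nonneg_real y
  have h0 : 0 ≤ b ⬝ᵥ y := (mul_nonneg hc.le hyy).trans h1
  have hsq : 0 ≤ (b - c • y) ⬝ᵥ (b - c • y) := dotProduct_self_nonneg_real _
  simp only [sub_dotProduct, dotProduct_sub, smul_dotProduct, dotProduct_smul, smul_eq_mul,
    dotProduct_comm y b] at hsq
  have h2 : c * (b ⬝ᵥ y) ≤ b ⬝ᵥ b := by nlinarith
  refine ⟨h0, h2, by nlinarith, ?_⟩
  have hyPb : y ⬝ᵥ P *ᵥ b = b ⬝ᵥ b := by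
    rw [dotProduct_mulVec, ← mulVec_transpose, hP, hPy]
  have hq : ∀ s : ℝ, 0 ≤ b ⬝ᵥ P *ᵥ b - 2 * s * (b ⬝ᵥ b) + s ^ 2 * (b ⬝ᵥ y) := by
    intro s
    have h3 := (mul_nonneg hc.le (dotProduct_self_nonneg_real (b - s • y))).trans (h (b - s • y))
    rw [mulVec_sub, mulVec_smul, hPy] at h3
    simp only [sub_dotProduct, dotProduct_sub, smul_dotProduct, dotProduct_smul, smul_eq_mul,
      hyPb, dotProduct_comm y b] at h3
    linarith
  rcases h0.eq_or_lt with h4 | h4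
  · have hy0 : y = 0 := by
      refine dotProduct_self_eq_zero.1 (le_antisymm ?_ hyy)
      rw [← h4] at h1
      nlinarith
    have hb0 : b = 0 := by rw [← hPy, hy0, mulVec_zero]
    simp [hb0]
  -- This s minimises the quadratic polynomial in s.
  · have h5 := hq ((b ⬝ᵥ b) / (b ⬝ᵥ y))
    have e : b ⬝ᵥ P *ᵥ b - 2 * ((b ⬝ᵥ b) / (b ⬝ᵥ y)) * (b ⬝ᵥ b) +
        ((b ⬝ᵥ b) / (b ⬝ᵥ y)) ^ 2 * (b ⬝ᵥ y) =
        ((b ⬝ᵥ P *ᵥ b) * (b ⬝ᵥ y) - (b ⬝ᵥ b) ^ 2) / (b ⬝ᵥ y) := by field_simp; ring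
    rw [e] at h5
    have h6 := mul_nonneg h5 h4.le
    rw [div_mul_cancel₀ _ h4.ne'] at h6
    linarith

theorem dotProduct_inv_mulVec_comm {P : Matrix ι ι ℝ} (hP : Pᵀ = P) (a b : ι → ℝ) :
    a ⬝ᵥ P⁻¹ *ᵥ b = b ⬝ᵥ P⁻¹ *ᵥ a := by
  rw [dotProduct_mulVec, ← mulVec_transpose, transpose_nonsing_inv, hP, dotProduct_comm]

end Coercive

/-! ### The matrices A, M and K as Gram matrices of shifted features -/

section Matrices

variable {m d : ℕ}

/-- Rank-one features shifted by multiples of the identity. -/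
noncomputable def shiftedOuter (x : Fin m → Fin d → ℝ) (c : Fin m → ℝ) (i : Fin m) :
    Fin d × Fin d → ℝ :=
  fun ab => x i ab.1 * x i ab.2 / d - if ab.1 = ab.2 then c i else 0

theorem shiftedOuter_dotProduct (hd : 1 ≤ d) (x : Fin m → Fin d → ℝ) (c : Fin m → ℝ)
    (i j : Fin m) :
    shiftedOuter x c i ⬝ᵥ shiftedOuter x c j =
      (x i ⬝ᵥ x j / d) ^ 2 - c j * sqRadius (x i) - c i * sqRadius (x j) + d * (c i * c j) := by
  have hd0 : (d : ℝ) ≠ 0 := by positivity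
  have e1 : shiftedOuter x c i ⬝ᵥ shiftedOuter x c j =
      ∑ a, ∑ b, (x i a * x j a) * (x i b * x j b) / (d : ℝ) ^ 2 -
        ∑ a, c j * (x i a * x i a / d) - ∑ a, c i * (x j a * x j a / d) +
        ∑ _a : Fin d, c i * c j := by
    simp only [shiftedOuter, dotProduct, Fintype.sum_prod_type, ← Finset.sum_sub_distrib,
      ← Finset.sum_add_distrib]
    refine Finset.sum_congr rfl fun a _ => ?_
    have e : ∀ b, (x i a * x i b / d - if a = b then c i else 0) *
        (x j a * x j b / d - if a = b then c j else 0) =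
        (x i a * x j a) * (x i b * x j b) / (d : ℝ) ^ 2 +
          if a = b then c i * c j - c j * (x i a * x i b / d) - c i * (x j a * x j b / d) else 0 := by
      intro b
      split_ifs
      · field_simp; ring
      · field_simp; ring
    simp only [e, Finset.sum_add_distrib, Finset.sum_ite_eq, Finset.mem_univ, if_true]
    ring
  rw [e1]
  simp only [sqRadius, dotProduct, ← Finset.mul_sum, ← Finset.sum_div, Finset.sum_const,
    Finset.card_univ, Fintype.card_fin, nsmul_eq_mul, ← Finset.sum_mul]
  field_simp

/-- The shift affects only the coordinates (a, a), which the gap ignores. One gap thus serves M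
(shift 0), A (shift 1/d) and K (shift ρ/d). -/
theorem SpectralGap.shifted {x : Fin m → Fin d → ℝ} (hx : SpectralGap x) (c : Fin m → ℝ)
    (t : Fin m → ℝ) :
    1 / 2 * (t ⬝ᵥ t) ≤ t ⬝ᵥ featureGram (shiftedOuter x c) id *ᵥ t := by
  rw [dotProduct_featureGram, Fintype.sum_prod_type]
  have h := hx t
  refine le_trans (by linarith) (h.trans ?_)
  refine Finset.sum_le_sum fun a _ => Finset.sum_le_sum fun b _ => ?_
  split_ifs with hab
  · positivity
  · have hne : a ≠ b := fun h => hab (by rw [h])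
    simp only [shiftedOuter, id, if_neg hne, sub_zero]
    exact le_rfl

variable {x : Fin m → Fin d → ℝ} {v : Fin m → EuclideanSpace ℝ (Fin d)}

/-- `v` is the sample `x` rescaled by `1 / √d`. -/
def IsScaled (x : Fin m → Fin d → ℝ) (v : Fin m → EuclideanSpace ℝ (Fin d)) : Prop :=
  ∀ i a, v i a = x i a / Real.sqrt d

theorem IsScaled.inner_eq (h : IsScaled x v) (i j : Fin m) :
    inner ℝ (v i) (v j) = x i ⬝ᵥ x j / d := by
  rw [PiLp.inner_apply]
  simp only [dotProduct, Finset.sum_div]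
  refine Finset.sum_congr rfl fun a _ => ?_
  simp only [h _ _, RCLike.inner_apply, conj_trivial]
  rw [div_mul_div_comm, Real.mul_self_sqrt (Nat.cast_nonneg d)]
  ring

theorem IsScaled.norm_sq_eq (h : IsScaled x v) (i : Fin m) : ‖v i‖ ^ 2 = sqRadius (x i) := by
  rw [← real_inner_self_eq_norm_sq, h.inner_eq]; rfl

theorem IsScaled.eta_eq (h : IsScaled x v) (i : Fin m) : eta v i = sqRadius (x i) - 1 := by
  rw [eta, h.norm_sq_eq]

theorem IsScaled.matM_apply (h : IsScaled x v) (i j : Fin m) :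
    matM v i j = (x i ⬝ᵥ x j / d) ^ 2 := by
  rw [matM, Matrix.of_apply, h.inner_eq]

/-- Off the diagonal, `matMbeta` restores the a = b terms omitted from `matMalpha`, up to
lower-order corrections. The diagonal `matMD` is chosen so that the same formula holds there. -/
theorem IsScaled.matA_apply (hd : 1 ≤ d) (h : IsScaled x v) (i j : Fin m) :
    matA v i j = (x i ⬝ᵥ x j / d) ^ 2 - (sqRadius (x i) + sqRadius (x j)) / d + 1 / d := by
  have hd0 : (d : ℝ) ≠ 0 := by positivity
  have hs : Real.sqrt d ^ 2 = d := Real.sq_sqrt (Nat.cast_nonneg d)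
  have hs4 : Real.sqrt d ^ 4 = (d : ℝ) ^ 2 := by
    rw [show Real.sqrt (d : ℝ) ^ 4 = (Real.sqrt d ^ 2) ^ 2 by ring, hs]
  simp only [matA, Matrix.add_apply, Matrix.smul_apply, matMalpha, matMbeta, matMD,
    Matrix.of_apply]
  by_cases hij : i = j
  · subst hij
    simp only [if_true, diagonal_apply_eq, one_apply_eq, smul_eq_mul, mul_one]
    rw [show ‖v i‖ ^ 4 = (‖v i‖ ^ 2) ^ 2 by ring, h.norm_sq_eq]
    simp only [sqRadius]
    ring
  · simp only [if_neg hij, diagonal_apply_ne _ hij, one_apply_ne hij, smul_zero, add_zero]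
    have hα : (∑ a, ∑ b, if a = b then (0 : ℝ) else v i a * v i b * v j a * v j b) =
        (x i ⬝ᵥ x j / d) ^ 2 - ∑ a, (x i a * x j a) * (x i a * x j a) / (d : ℝ) ^ 2 := by
      have e1 : (x i ⬝ᵥ x j / d) ^ 2 =
          ∑ a, ∑ b, (x i a * x j a) * (x i b * x j b) / (d : ℝ) ^ 2 := by
        rw [div_pow, pow_two (x i ⬝ᵥ x j)]
        simp only [dotProduct, Finset.sum_mul_sum, Finset.sum_div]
      rw [e1, ← Finset.sum_sub_distrib]
      refine Finset.sum_congr rfl fun a _ => ?_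
      have e4 : ∀ b, (if a = b then (0 : ℝ) else v i a * v i b * v j a * v j b) =
          (x i a * x j a) * (x i b * x j b) / (d : ℝ) ^ 2 -
            if a = b then (x i a * x j a) * (x i b * x j b) / (d : ℝ) ^ 2 else 0 := by
        intro b
        split_ifs
        · ring
        · simp only [h _ _, sub_zero]
          rw [← hs4]
          ring
      simp only [e4]
      rw [Finset.sum_sub_distrib, Finset.sum_ite_eq, if_pos (Finset.mem_univ _)]
    have hβ : ∑ a, ((v i a) ^ 2 - 1 / (d : ℝ)) * ((v j a) ^ 2 - 1 / (d : ℝ)) =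
        ∑ a, (x i a * x j a) * (x i a * x j a) / (d : ℝ) ^ 2 -
          (sqRadius (x i) + sqRadius (x j)) / d + 1 / d := by
      have e5 : ∀ a, ((v i a) ^ 2 - 1 / (d : ℝ)) * ((v j a) ^ 2 - 1 / (d : ℝ)) =
          (x i a * x j a) * (x i a * x j a) / (d : ℝ) ^ 2 - x i a * x i a / d / d -
            x j a * x j a / d / d + 1 / (d : ℝ) ^ 2 := by
        intro a
        rw [h i a, h j a, div_pow, div_pow, hs]
        ring
      simp only [e5, Finset.sum_add_distrib, Finset.sum_sub_distrib, ← Finset.sum_div]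
      simp only [sqRadius, dotProduct, Finset.sum_const, Finset.card_univ, Fintype.card_fin,
        nsmul_eq_mul]
      field_simp
      ring
    rw [hα, hβ]
    ring

theorem IsScaled.matA_eq_featureGram (hd : 1 ≤ d) (h : IsScaled x v) :
    matA v = featureGram (shiftedOuter x fun _ => 1 / d) id := by
  have hd0 : (d : ℝ) ≠ 0 := by positivity
  ext i j
  rw [h.matA_apply hd, featureGram_apply, id, id, shiftedOuter_dotProduct hd]
  field_simp
  ring

theorem IsScaled.matM_eq_featureGram (hd : 1 ≤ d) (h : IsScaled x v) :
    matM v = featureGram (shiftedOuter x fun _ => 0) id := by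
  ext i j
  rw [h.matM_apply, featureGram_apply, id, id, shiftedOuter_dotProduct hd]
  ring

theorem matM_eq_add (hd : 1 ≤ d) (h : IsScaled x v) :
    matM v = matA v + matU v * matC * (matU v)ᵀ := by
  have hd0 : (d : ℝ) ≠ 0 := by positivity
  have hs : Real.sqrt d * Real.sqrt d = d := Real.mul_self_sqrt (Nat.cast_nonneg d)
  ext i j
  have e : (matU v * matC * (matU v)ᵀ) i j =
      1 / (Real.sqrt d * Real.sqrt d) * (1 + eta v i + eta v j) := by
    simp only [matU, matC, Matrix.mul_apply, Fin.sum_univ_two, Matrix.smul_apply, transpose_apply,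
      Matrix.of_apply, cons_val_zero, cons_val_one, smul_eq_mul]
    ring
  rw [Matrix.add_apply, e, hs, h.matM_apply, h.matA_apply hd, h.eta_eq, h.eta_eq]
  field_simp
  ring

theorem capacitance_eq (hd : 1 ≤ d) (hA : (matA v)ᵀ = matA v) :
    capacitance v = !![rr v, ss v; ss v, uu v] := by
  have hd0 : (d : ℝ) ≠ 0 := by positivity
  have hs : Real.sqrt d * Real.sqrt d = d := Real.mul_self_sqrt (Nat.cast_nonneg d)
  have hC : matC⁻¹ = !![0, 1; 1, -1] := by
    refine Matrix.inv_eq_right_inv ?_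
    ext i j
    fin_cases i <;> fin_cases j <;> simp [matC, Matrix.mul_apply, Fin.sum_univ_two]
  have e : ∀ k l : Fin 2, ((matU v)ᵀ * (matA v)⁻¹ * matU v) k l =
      ((fun i => ![1, eta v i] k) ⬝ᵥ ((matA v)⁻¹ *ᵥ fun i => ![1, eta v i] l)) / d := by
    intro k l
    rw [Matrix.mul_assoc]
    simp only [Matrix.mul_apply, transpose_apply, matU, Matrix.smul_apply, Matrix.of_apply,
      smul_eq_mul, dotProduct, mulVec, Finset.mul_sum, Finset.sum_div]
    refine Finset.sum_congr rfl fun i _ => Finset.sum_congr rfl fun j _ => ?_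
    calc _ = 1 / (Real.sqrt d * Real.sqrt d) *
          (![1, eta v i] k * ((matA v)⁻¹ i j * ![1, eta v j] l)) := by ring
      _ = _ := by rw [hs]; ring
  have hcomm := dotProduct_inv_mulVec_comm hA (fun _ => 1) (eta v)
  ext k l
  rw [capacitance, Matrix.add_apply, e, hC]
  fin_cases k <;> fin_cases l
  · simp [rr]
  · have : (fun _ => (1 : ℝ)) ⬝ᵥ (matA v)⁻¹ *ᵥ (fun i => eta v i) =
        eta v ⬝ᵥ (matA v)⁻¹ *ᵥ fun _ => 1 := hcomm
    simp [ss, this]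
  · have : (fun i => eta v i) ⬝ᵥ (matA v)⁻¹ *ᵥ (fun _ => (1 : ℝ)) =
        eta v ⬝ᵥ (matA v)⁻¹ *ᵥ fun _ => 1 := rfl
    simp [ss, this]
  · have : (fun i => eta v i) ⬝ᵥ (matA v)⁻¹ *ᵥ (fun i => eta v i) =
        eta v ⬝ᵥ (matA v)⁻¹ *ᵥ eta v := rfl
    simp [uu, this]

end Matrices

/-! ### Deterministic conclusions on a good sample -/

section Conclusion

variable {m d : ℕ}

/-- The deterministic conditions on the sample from which the conclusions are derived. -/
structure GoodSample (x : Fin m → Fin d → ℝ) : Prop where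
  gap : SpectralGap x
  excess : ∑ i, (sqRadius (x i) - 1) ^ 2 < (d : ℝ) / 64
  radius : ∀ i, |sqRadius (x i) - 1| ≤ 1 / 10
  pair : 0 < m → pairSum (centredOuter d) x < (m : ℝ) / 5
  fluct : dirSolution x ⬝ᵥ dirSolution x ≤ 16 * m → |radialFluctuation x x| < (d : ℝ) ^ (3 / 4 : ℝ)

variable {x : Fin m → Fin d → ℝ} {v : Fin m → EuclideanSpace ℝ (Fin d)}

theorem one_dotProduct_one : (fun _ : Fin m => (1 : ℝ)) ⬝ᵥ (fun _ => 1) = m := by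
  simp [dotProduct]

theorem IsScaled.transpose_matA (hd : 1 ≤ d) (h : IsScaled x v) : (matA v)ᵀ = matA v := by
  rw [h.matA_eq_featureGram hd, featureGram_symm]

theorem IsScaled.matA_coercive (hd : 1 ≤ d) (h : IsScaled x v) (hx : SpectralGap x)
    (t : Fin m → ℝ) : 1 / 2 * (t ⬝ᵥ t) ≤ t ⬝ᵥ matA v *ᵥ t := by
  rw [h.matA_eq_featureGram hd]
  exact hx.shifted _ t

theorem IsScaled.isUnit_matM (hd : 1 ≤ d) (h : IsScaled x v) (hx : SpectralGap x) :
    IsUnit (matM v) := by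
  rw [h.matM_eq_featureGram hd]
  exact (posDef_of_coercive (featureGram_symm _ _) one_half_pos (hx.shifted _)).isUnit

/-- The form at the all-ones vector is the squared norm of the feature sum: off-diagonal pairs give
at most m/5 and the diagonal at most 13m/10. -/
theorem one_matA_one_le (hd : 100 ≤ d) (h : IsScaled x v) (hx : GoodSample x) :
    (fun _ => 1) ⬝ᵥ matA v *ᵥ (fun _ => 1) ≤ 3 / 2 * (m : ℝ) := by
  have hd1 : 1 ≤ d := by omega
  have hd0 : (0 : ℝ) < d := by exact_mod_cast hd1
  have hA : matA v = featureGram (centredOuter d) x := by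
    ext i j
    rw [h.matA_eq_featureGram hd1, featureGram_apply, featureGram_apply]
    have e : ∀ k, shiftedOuter x (fun _ => 1 / (d : ℝ)) k = centredOuter d (x k) := by
      intro k
      funext ab
      simp only [shiftedOuter, centredOuter, sub_div, ite_div, zero_div]
    rw [id, id, e, e]
  have hsum : (fun _ => 1) ⬝ᵥ matA v *ᵥ (fun _ => 1) =
      pairSum (centredOuter d) x + ∑ i, matA v i i := by
    have e1 : (∑ i, matA v i i) = ∑ i, centredOuter d (x i) ⬝ᵥ centredOuter d (x i) := by
      rw [hA]; simp only [featureGram_apply]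
    rw [e1, hA, dotProduct_featureGram, pairSum, sub_add_cancel]
    simp only [one_mul, dotProduct, Finset.sum_apply, pow_two]
  have hdiag : ∀ i, matA v i i ≤ 13 / 10 := by
    intro i
    have h1 := h.matA_apply hd1 i i
    have h2 := hx.radius i
    have h3 : (1 : ℝ) / d ≤ 1 / 100 := by
      refine one_div_le_one_div_of_le (by norm_num) ?_
      exact_mod_cast hd
    have h4 := sqRadius_nonneg (x i)
    obtain ⟨h5, h6⟩ := abs_le.1 h2
    have h7 : 0 ≤ (sqRadius (x i) + sqRadius (x i)) / d := by positivity
    change matA v i i = sqRadius (x i) ^ 2 - _ + _ at h1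
    nlinarith
  rcases Nat.eq_zero_or_pos m with hm | hm
  · subst hm
    simp
  · have := hx.pair hm
    have h8 : ∑ i, matA v i i ≤ m * (13 / 10) := by
      calc _ ≤ ∑ _i : Fin m, (13 / 10 : ℝ) := Finset.sum_le_sum fun i _ => hdiag i
        _ = _ := by simp
    linarith

/-- The upper bound is the gap; the lower bound is m² ≤ (1ᵀA1)(1ᵀA⁻¹1) with 1ᵀA1 ≤ 3m/2. -/
theorem rr_mem (hd : 100 ≤ d) (h : IsScaled x v) (hx : GoodSample x) :
    rr v ∈ Set.Icc ((m : ℝ) / d * (2 / 3)) ((m : ℝ) / d * 2) := by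
  have hd1 : 1 ≤ d := by omega
  have hd0 : (0 : ℝ) < d := by exact_mod_cast hd1
  obtain ⟨h0, h1, -, h2⟩ := inv_form_bounds (h.transpose_matA hd1) one_half_pos
    (h.matA_coercive hd1 hx.gap) (fun _ => 1)
  rw [one_dotProduct_one] at h1 h2
  have h3 := one_matA_one_le hd h hx
  have hm0 : (0 : ℝ) ≤ m := Nat.cast_nonneg m
  have hlow : (m : ℝ) * (2 / 3) ≤ (fun _ => 1) ⬝ᵥ (matA v)⁻¹ *ᵥ (fun _ => 1) := by
    rcases hm0.eq_or_lt with hm | hm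
    · rw [← hm, zero_mul]; exact h0
    · have h4 := h2.trans (mul_le_mul_of_nonneg_right h3 h0)
      have h5 : (m : ℝ) * m ≤ m * (3 / 2 * ((fun _ => 1) ⬝ᵥ (matA v)⁻¹ *ᵥ (fun _ => 1))) := by
        linarith
      have h6 := le_of_mul_le_mul_left h5 hm
      linarith
  constructor
  · rw [rr, div_mul_eq_mul_div]
    exact div_le_div_of_nonneg_right hlow hd0.le
  · rw [rr, div_mul_eq_mul_div]
    exact div_le_div_of_nonneg_right (by linarith) hd0.le

theorem IsScaled.eta_normSq (h : IsScaled x v) :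
    eta v ⬝ᵥ eta v = ∑ i, (sqRadius (x i) - 1) ^ 2 := by
  simp only [dotProduct, h.eta_eq, pow_two]

theorem uu_mem (hd : 1 ≤ d) (h : IsScaled x v) (hx : GoodSample x) :
    uu v ∈ Set.Icc (-1 : ℝ) (-1 / 2) := by
  have hd0 : (0 : ℝ) < d := by exact_mod_cast hd
  obtain ⟨h0, h1, -, -⟩ := inv_form_bounds (h.transpose_matA hd) one_half_pos
    (h.matA_coercive hd hx.gap) (eta v)
  rw [h.eta_normSq] at h1
  have h2 := hx.excess
  constructor
  · rw [uu]
    have := div_nonneg h0 hd0.le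
    linarith
  · rw [uu]
    have : (eta v ⬝ᵥ (matA v)⁻¹ *ᵥ eta v) / d ≤ 1 / 2 := by
      rw [div_le_iff₀ hd0]
      linarith
    linarith

/-- Removing a rank-one term changes the bilinear form of the inverse by a scalar factor. -/
theorem rank_one_inverse_form {ι : Type*} [Fintype ι] [DecidableEq ι] {A K : Matrix ι ι ℝ}
    (hA : IsUnit A) (hK : IsUnit K) (hKs : Kᵀ = K) {η b : ι → ℝ} {δ : ℝ}
    (h : A = K + δ • vecMulVec η η) :
    (1 + δ * (η ⬝ᵥ K⁻¹ *ᵥ η)) * (η ⬝ᵥ A⁻¹ *ᵥ b) = η ⬝ᵥ K⁻¹ *ᵥ b := by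
  set X := A⁻¹ *ᵥ b with hX
  have h1 : A *ᵥ X = b := mulVec_inv_mulVec hA b
  rw [h, add_mulVec, smul_mulVec, vecMulVec_mulVec] at h1
  have h2 := congrArg (fun z => (K⁻¹ *ᵥ η) ⬝ᵥ z) h1
  have h3 : (K⁻¹ *ᵥ η) ⬝ᵥ K *ᵥ X = η ⬝ᵥ X := by
    rw [dotProduct_mulVec, ← mulVec_transpose, hKs, mulVec_inv_mulVec hK]
  have h4 : (K⁻¹ *ᵥ η) ⬝ᵥ b = η ⬝ᵥ K⁻¹ *ᵥ b := by
    rw [dotProduct_comm, dotProduct_inv_mulVec_comm hKs]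
  simp only [dotProduct_add, dotProduct_smul, h3, h4, smul_eq_mul,
    MulOpposite.smul_eq_mul_unop, MulOpposite.unop_op] at h2
  rw [dotProduct_comm (K⁻¹ *ᵥ η) η] at h2
  linarith

/-- The factorisation K = DBD with D = diag ρ. Testing K at D⁻¹t transfers coercivity to B, with 1/2
falling to 1/4 because ρ² ≤ 2. -/
theorem dirGram_bounds (hd : 1 ≤ d) (hx : GoodSample x) :
    (dirGram x)ᵀ = dirGram x ∧ (∀ t, 1 / 4 * (t ⬝ᵥ t) ≤ t ⬝ᵥ dirGram x *ᵥ t) ∧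
      ∀ i j, featureGram (shiftedOuter x fun i => sqRadius (x i) / d) id i j =
        sqRadius (x i) * dirGram x i j * sqRadius (x j) := by
  have hd0 : (d : ℝ) ≠ 0 := by positivity
  have hρ : ∀ i, 9 / 10 ≤ sqRadius (x i) ∧ sqRadius (x i) ≤ 11 / 10 := fun i => by
    obtain ⟨h1, h2⟩ := abs_le.1 (hx.radius i)
    constructor <;> linarith
  have hent : ∀ i j, featureGram (shiftedOuter x fun i => sqRadius (x i) / d) id i j =
        sqRadius (x i) * dirGram x i j * sqRadius (x j) := by
    intro i j
    rw [featureGram_apply, id, id, shiftedOuter_dotProduct hd, dirGram, Matrix.of_apply]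
    have hi : x i ⬝ᵥ x i = d * sqRadius (x i) := by rw [sqRadius]; field_simp
    have hj : x j ⬝ᵥ x j = d * sqRadius (x j) := by rw [sqRadius]; field_simp
    have h1 : sqRadius (x i) ≠ 0 := by linarith [(hρ i).1]
    have h2 : sqRadius (x j) ≠ 0 := by linarith [(hρ j).1]
    rw [hi, hj]
    field_simp
    ring
  refine ⟨?_, fun t => ?_, hent⟩
  · ext i j
    simp only [transpose_apply, dirGram, Matrix.of_apply, dotProduct_comm (x j) (x i),
      mul_comm (x j ⬝ᵥ x j)]
  · have h := hx.gap.shifted (fun i => sqRadius (x i) / d) fun i => t i / sqRadius (x i)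
    have e : (fun i => t i / sqRadius (x i)) ⬝ᵥ
        featureGram (shiftedOuter x fun i => sqRadius (x i) / d) id *ᵥ
          (fun i => t i / sqRadius (x i)) = t ⬝ᵥ dirGram x *ᵥ t := by
      simp only [dotProduct, mulVec, hent, Finset.mul_sum]
      refine Finset.sum_congr rfl fun i _ => Finset.sum_congr rfl fun j _ => ?_
      have h1 : sqRadius (x i) ≠ 0 := by linarith [(hρ i).1]
      have h2 : sqRadius (x j) ≠ 0 := by linarith [(hρ j).1]
      field_simp
    rw [e] at h
    refine le_trans ?_ h
    simp only [dotProduct, Finset.mul_sum]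
    refine Finset.sum_le_sum fun i _ => ?_
    obtain ⟨h1, h2⟩ := hρ i
    have h3 : 0 < sqRadius (x i) := by linarith
    rw [div_mul_div_comm, ← mul_div_assoc, le_div_iff₀ (by positivity)]
    have : sqRadius (x i) * sqRadius (x i) ≤ 2 := by nlinarith
    nlinarith [mul_self_nonneg (t i), mul_le_mul_of_nonneg_left this (mul_self_nonneg (t i))]

/-- With a = D⁻¹η and D⁻¹1 = 1 - a, the form equals a·w - aᵀB⁻¹a for w = B⁻¹1. The term a·w is a
fluctuation below d^(3/4) plus a mean in [-d/4, 0], and aᵀB⁻¹a lies in [0, d/4]. Only the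
fluctuation can be positive. -/
theorem eta_inverse_form_bounds (hd : 1 ≤ d) (hm : (m : ℝ) ≤ 1 / 2 ^ 33 * (d : ℝ) ^ 2)
    (h : IsScaled x v) (hx : GoodSample x) :
    eta v ⬝ᵥ (featureGram (shiftedOuter x fun i => sqRadius (x i) / d) id)⁻¹ *ᵥ (fun _ => 1) ≤
        (d : ℝ) ^ (3 / 4 : ℝ) ∧
      -(d : ℝ) ^ (3 / 4 : ℝ) - d ≤
        eta v ⬝ᵥ (featureGram (shiftedOuter x fun i => sqRadius (x i) / d) id)⁻¹ *ᵥ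
          (fun _ => 1) := by
  have hd0 : (0 : ℝ) < d := by exact_mod_cast hd
  obtain ⟨hBs, hB, hent⟩ := dirGram_bounds hd hx
  set K := featureGram (shiftedOuter x fun i => sqRadius (x i) / d) id with hK
  have hKs : Kᵀ = K := featureGram_symm _ _
  have hKu : IsUnit K := (posDef_of_coercive hKs one_half_pos (hx.gap.shifted _)).isUnit
  have hBu : IsUnit (dirGram x) := (posDef_of_coercive hBs (by norm_num) hB).isUnit
  have hρ : ∀ i, 9 / 10 ≤ sqRadius (x i) ∧ sqRadius (x i) ≤ 11 / 10 := fun i => by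
    obtain ⟨h1, h2⟩ := abs_le.1 (hx.radius i)
    constructor <;> linarith
  have hρ0 : ∀ i, sqRadius (x i) ≠ 0 := fun i => by linarith [(hρ i).1]
  set a : Fin m → ℝ := fun i => relExcess (x i) with ha
  have hai : ∀ i, a i = 1 - 1 / sqRadius (x i) := fun i => by
    rw [ha]
    dsimp only
    rw [relExcess, max_eq_left (by linarith [(hρ i).1])]
  set z := K⁻¹ *ᵥ eta v with hz
  have hKz : K *ᵥ z = eta v := mulVec_inv_mulVec hKu _
  have hBz : dirGram x *ᵥ (fun i => sqRadius (x i) * z i) = a := by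
    funext i
    have h1 := congrFun hKz i
    simp only [mulVec, dotProduct, hent] at h1
    have h2 : sqRadius (x i) * (∑ j, dirGram x i j * (sqRadius (x j) * z j)) =
        sqRadius (x i) - 1 := by
      rw [← h.eta_eq, ← h1, Finset.mul_sum]
      exact Finset.sum_congr rfl fun j _ => by ring
    rw [hai]
    simp only [mulVec, dotProduct]
    have h3 := hρ0 i
    refine mul_left_cancel₀ h3 (h2.trans ?_)
    field_simp
  have hzB : (fun i => sqRadius (x i) * z i) = (dirGram x)⁻¹ *ᵥ a := by
    rw [← hBz, mulVec_mulVec,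
      Matrix.nonsing_inv_mul _ ((Matrix.isUnit_iff_isUnit_det _).1 hBu), one_mulVec]
  have hq : eta v ⬝ᵥ K⁻¹ *ᵥ (fun _ => 1) =
      a ⬝ᵥ dirSolution x - a ⬝ᵥ (dirGram x)⁻¹ *ᵥ a := by
    rw [dotProduct_inv_mulVec_comm hKs, ← hz, dirSolution, dotProduct_inv_mulVec_comm hBs a,
      ← sub_dotProduct, ← hzB]
    simp only [dotProduct, Pi.sub_apply]
    refine Finset.sum_congr rfl fun i _ => ?_
    rw [hai]
    have h3 := hρ0 i
    field_simp
    ring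
  set θ := ∫ y, relExcess y ∂(stdPi (Fin d)) with hθ
  obtain ⟨hθ1, hθ2⟩ := integral_relExcess_mem hd
  rw [← hθ] at hθ1 hθ2
  obtain ⟨w0, w1, w2, -⟩ := inv_form_bounds hBs (by norm_num) hB (fun _ => 1)
  rw [one_dotProduct_one] at w1 w2
  obtain ⟨a0, a1, -, -⟩ := inv_form_bounds hBs (by norm_num) hB a
  have hfl := hx.fluct (by
    change (1 / 4) ^ 2 * (dirSolution x ⬝ᵥ dirSolution x) ≤ (m : ℝ) at w2
    linarith)
  have haw : a ⬝ᵥ dirSolution x =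
      radialFluctuation x x + θ * ((fun _ => 1) ⬝ᵥ (dirGram x)⁻¹ *ᵥ fun _ => 1) := by
    rw [radialFluctuation, ← dirSolution]
    simp only [dotProduct, Finset.mul_sum, ← Finset.sum_add_distrib]
    refine Finset.sum_congr rfl fun i _ => ?_
    ring
  have haa : a ⬝ᵥ a ≤ d / 16 := by
    have h1 : a ⬝ᵥ a ≤ ∑ i, 4 * (sqRadius (x i) - 1) ^ 2 := by
      simp only [dotProduct, ← pow_two]
      exact Finset.sum_le_sum fun i _ => (relExcess_bounds _ (sqRadius_nonneg (x i))).2.2.1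
    rw [← Finset.mul_sum] at h1
    have := hx.excess
    linarith
  obtain ⟨f1, f2⟩ := abs_lt.1 hfl
  set W := (fun _ => 1) ⬝ᵥ (dirGram x)⁻¹ *ᵥ fun _ => 1 with hW
  have hθW : θ * W ≤ 0 := mul_nonpos_of_nonpos_of_nonneg hθ2 w0
  have hθW' : -(d / 4 : ℝ) ≤ θ * W := by
    have h1 : -(384 / (d : ℝ)) * W ≤ θ * W := mul_le_mul_of_nonneg_right hθ1 w0
    have h2 : 384 / (d : ℝ) * W ≤ 384 / (d : ℝ) * (4 * (1 / 2 ^ 33 * (d : ℝ) ^ 2)) := by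
      refine mul_le_mul_of_nonneg_left ?_ (by positivity)
      linarith
    have h3 : 384 / (d : ℝ) * (4 * (1 / 2 ^ 33 * (d : ℝ) ^ 2)) = 1536 / 2 ^ 33 * d := by
      field_simp
      norm_num
    linarith
  rw [hq, haw]
  constructor <;> linarith

/-- Since s = 1 + X/d, the asymmetric bounds -d - d^(3/4) ≤ X ≤ d^(3/4) suffice: a negative shift as
large as d only brings s down to about 0. -/
theorem abs_ss_le (hd : 1 ≤ d) (hm : (m : ℝ) ≤ 1 / 2 ^ 33 * (d : ℝ) ^ 2)
    (h : IsScaled x v) (hx : GoodSample x) : |ss v| ≤ 1 + (d : ℝ) ^ (-(1 / 4) : ℝ) := by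
  have hd0 : (0 : ℝ) < d := by exact_mod_cast hd
  obtain ⟨q1, q2⟩ := eta_inverse_form_bounds hd hm h hx
  set K := featureGram (shiftedOuter x fun i => sqRadius (x i) / d) id with hK
  have hKs : Kᵀ = K := featureGram_symm _ _
  have hKc := hx.gap.shifted (fun i => sqRadius (x i) / d)
  have hKu : IsUnit K := (posDef_of_coercive hKs one_half_pos hKc).isUnit
  have hAu : IsUnit (matA v) := (posDef_of_coercive (h.transpose_matA hd) one_half_pos
    (h.matA_coercive hd hx.gap)).isUnit
  have hAK : matA v = K + (1 / (d : ℝ)) • vecMulVec (eta v) (eta v) := by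
    ext i j
    rw [h.matA_apply hd, Matrix.add_apply, Matrix.smul_apply, vecMulVec_apply, hK,
      featureGram_apply, id, id, shiftedOuter_dotProduct hd, h.eta_eq, h.eta_eq, smul_eq_mul]
    field_simp
    ring
  have hr := rank_one_inverse_form hAu hKu hKs hAK (b := fun _ => 1)
  obtain ⟨p0, -⟩ := inv_form_bounds hKs one_half_pos hKc (eta v)
  set p := 1 / (d : ℝ) * (eta v ⬝ᵥ K⁻¹ *ᵥ eta v) with hp
  have hp0 : 0 ≤ p := by positivity
  set X := eta v ⬝ᵥ (matA v)⁻¹ *ᵥ fun _ => 1 with hX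
  set q := eta v ⬝ᵥ K⁻¹ *ᵥ fun _ => 1 with hq
  have hδ : 0 < (d : ℝ) ^ (3 / 4 : ℝ) := Real.rpow_pos_of_pos hd0 _
  -- X is q divided by 1 + p ≥ 1, so a nonnegative upper bound and a nonpositive lower bound both
  -- pass from q to X.
  have hX1 : X ≤ (d : ℝ) ^ (3 / 4 : ℝ) := by
    by_contra hcon
    push Not at hcon
    nlinarith [mul_nonneg hp0 (hδ.le.trans hcon.le)]
  have hX2 : -(d : ℝ) ^ (3 / 4 : ℝ) - d ≤ X := by
    by_contra hcon
    push Not at hcon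
    have : X ≤ 0 := by linarith
    nlinarith [mul_nonpos_of_nonneg_of_nonpos hp0 this]
  have e : (d : ℝ) ^ (-(1 / 4) : ℝ) = (d : ℝ) ^ (3 / 4 : ℝ) / d := by
    rw [← Real.rpow_sub_one hd0.ne']
    norm_num
  rw [ss, e]
  have b1 : X / d ≤ (d : ℝ) ^ (3 / 4 : ℝ) / d := div_le_div_of_nonneg_right hX1 hd0.le
  have b2 : -((d : ℝ) ^ (3 / 4 : ℝ) / d) - 1 ≤ X / d := by
    have := div_le_div_of_nonneg_right hX2 hd0.le
    rw [sub_div, neg_div, div_self hd0.ne'] at this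
    exact this
  have b3 : 0 ≤ (d : ℝ) ^ (3 / 4 : ℝ) / d := by positivity
  rw [abs_le]
  constructor <;> linarith

theorem conclusion_of_goodSample (hd : 100 ≤ d) (hm : (m : ℝ) ≤ 1 / 2 ^ 33 * (d : ℝ) ^ 2)
    (h : IsScaled x v) (hx : GoodSample x) :
    IsUnit (matA v) ∧ capacitance v = !![rr v, ss v; ss v, uu v] ∧
      rr v ∈ Set.Icc ((m : ℝ) / d * (2 / 3)) ((m : ℝ) / d * 2) ∧
      |ss v| ≤ 1 + (d : ℝ) ^ (-(1 / 4) : ℝ) ∧ uu v ∈ Set.Icc (-1 : ℝ) (-1 / 2) ∧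
      1 / 3 * ((m : ℝ) / d) ≤ ss v ^ 2 - rr v * uu v ∧
      matM v = matA v + matU v * matC * (matU v)ᵀ ∧ IsUnit (matM v) := by
  have hd1 : 1 ≤ d := by omega
  have hA := h.transpose_matA hd1
  have hr := rr_mem hd h hx
  have hu := uu_mem hd1 h hx
  refine ⟨(posDef_of_coercive hA one_half_pos (h.matA_coercive hd1 hx.gap)).isUnit,
    capacitance_eq hd1 hA, hr, abs_ss_le hd1 hm h hx, hu, ?_, matM_eq_add hd1 h,
    h.isUnit_matM hd1 hx.gap⟩
  have hmd : 0 ≤ (m : ℝ) / d := by positivity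
  -- The square s² is discarded; r ≥ (2/3) m/d and -u ≥ 1/2 already give the constant 1/3.
  have h1 : (m : ℝ) / d * (2 / 3) * (1 / 2) ≤ rr v * (-uu v) :=
    mul_le_mul hr.1 (by linarith [hu.2]) (by norm_num) (le_trans (by positivity) hr.1)
  nlinarith [sq_nonneg (ss v)]

end Conclusion

/-! ### Transfer to the given law and assembly -/

section Law

open scoped MatrixOrder

theorem sqrt_smul_one (d : ℕ) :
    CFC.sqrt ((1 / (d : ℝ)) • (1 : Matrix (Fin d) (Fin d) ℝ)) =
      (Real.sqrt d)⁻¹ • (1 : Matrix (Fin d) (Fin d) ℝ) := by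
  have hs : (Real.sqrt d)⁻¹ * (Real.sqrt d)⁻¹ = 1 / (d : ℝ) := by
    rw [← mul_inv, Real.mul_self_sqrt (Nat.cast_nonneg d), one_div]
  refine CFC.sqrt_unique ?_ ?_
  · rw [smul_mul_smul_comm, one_mul, hs]
  · rw [Matrix.nonneg_iff_posSemidef]
    exact Matrix.PosSemidef.one.smul (by positivity)

theorem sampleLaw_map_rescale {d : ℕ} (hd : 1 ≤ d) :
    (sampleLaw d).map (fun y => Real.sqrt d • WithLp.ofLp y) = stdPi (Fin d) := by
  have hd0 : (0 : ℝ) < d := by exact_mod_cast hd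
  have hs : Real.sqrt d ≠ 0 := (Real.sqrt_pos.2 hd0).ne'
  have hm1 : Measurable fun y : EuclideanSpace ℝ (Fin d) => Real.sqrt d • WithLp.ofLp y :=
    (measurable_const_smul (Real.sqrt d)).comp (PiLp.volume_preserving_ofLp (Fin d)).measurable
  have hm2 : Measurable (WithLp.toLp 2 : (Fin d → ℝ) → EuclideanSpace ℝ (Fin d)) :=
    (PiLp.volume_preserving_toLp (Fin d)).measurable
  have hm3 : Measurable fun y : EuclideanSpace ℝ (Fin d) =>
      (0 : EuclideanSpace ℝ (Fin d)) + toEuclideanCLM (𝕜 := ℝ)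
        ((Real.sqrt d)⁻¹ • (1 : Matrix (Fin d) (Fin d) ℝ)) y := by fun_prop
  rw [sampleLaw, multivariateGaussian, sqrt_smul_one, ← stdPi_map_toLp, Measure.map_map hm3 hm2,
    Measure.map_map hm1 (hm3.comp hm2)]
  convert Measure.map_id
  funext x
  simp only [Function.comp, map_smul, map_one, zero_add, id]
  simp [smul_smul, hs]

end Law

theorem isScaled_rescale {m d : ℕ} (hd : 1 ≤ d) (v : Fin m → EuclideanSpace ℝ (Fin d)) :
    IsScaled (fun i => Real.sqrt d • WithLp.ofLp (v i)) v := by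
  intro i a
  have hs : Real.sqrt d ≠ 0 := (Real.sqrt_pos.2 (by exact_mod_cast hd)).ne'
  simp [hs]

theorem negligible_not_goodSample :
    Negligible (1 / 2 ^ 33) (fun _ _ => {x | ¬ GoodSample x}) := by
  have h1 := negligible_not_spectralGap
  have h2 := negligible_excess_large
  have h3 := (negligible_radius_far (τ := 1 / 10) (by norm_num) (by norm_num)).mono
    (c' := 1 / 2 ^ 33) (by norm_num) (Eventually.of_forall fun d m _ => subset_rfl)
  have h4 := negligible_pairSum_large.mono (c' := 1 / 2 ^ 33) (by norm_num)
    (Eventually.of_forall fun d m _ => subset_rfl)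
  have h5 := negligible_radialFluctuation.mono (c' := 1 / 2 ^ 33) (by norm_num)
    (Eventually.of_forall fun d m _ => subset_rfl)
  refine ((((h1.union h2).union h3).union h4).union h5).mono le_rfl
    (Eventually.of_forall fun d m _ x hx => ?_)
  by_contra hcon
  simp only [Set.mem_union, not_or] at hcon
  obtain ⟨⟨⟨⟨n1, n2⟩, n3⟩, n4⟩, n5⟩ := hcon
  have hr : ∀ i, |sqRadius (x i) - 1| ≤ 1 / 10 := fun i => by
    by_contra hi
    exact n3 ⟨i, not_le.1 hi⟩
  refine hx ⟨not_not.1 n1, not_le.1 n2, hr, fun hm => ?_, fun hw => ?_⟩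
  · by_contra hp
    exact n4 ⟨hm, not_lt.1 hp⟩
  · by_contra hf
    refine n5 ⟨fun i hi => ?_, hw, not_lt.1 hf⟩
    have h := hr i
    rw [hi, sqRadius] at h
    norm_num at h

theorem measureReal_not_goodSample_le {m d : ℕ} (hd : 1 ≤ d) {Ω : Type*} [MeasurableSpace Ω]
    {P : Measure Ω} [IsProbabilityMeasure P] {v : Fin m → Ω → EuclideanSpace ℝ (Fin d)}
    (hv : ∀ i, HasLaw (v i) (sampleLaw d) P) (hind : iIndepFun v P) :
    P.real {ω | ¬ GoodSample (fun i => Real.sqrt d • WithLp.ofLp (v i ω))} ≤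
      (samplePi m d).real {x | ¬ GoodSample x} := by
  have hm1 : Measurable fun y : EuclideanSpace ℝ (Fin d) => Real.sqrt d • WithLp.ofLp y :=
    (measurable_const_smul (Real.sqrt d)).comp (PiLp.volume_preserving_ofLp (Fin d)).measurable
  set X : Fin m → Ω → Fin d → ℝ := fun i ω => Real.sqrt d • WithLp.ofLp (v i ω) with hX
  have hXm : ∀ i, AEMeasurable (X i) P := fun i => hm1.comp_aemeasurable (hv i).aemeasurable
  have hXlaw : ∀ i, P.map (X i) = stdPi (Fin d) := fun i => by
    rw [← sampleLaw_map_rescale hd, ← (hv i).map_eq,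
      AEMeasurable.map_map_of_aemeasurable hm1.aemeasurable (hv i).aemeasurable]
    rfl
  have hXi : iIndepFun X P := hind.comp (fun _ y => Real.sqrt d • WithLp.ofLp y) fun _ => hm1
  have hlaw : P.map (fun ω i => X i ω) = samplePi m d := by
    rw [(iIndepFun_iff_map_fun_eq_pi_map hXm).1 hXi]
    simp only [hXlaw]
  -- The bad event is replaced by a measurable hull of equal measure, so its own measurability need
  -- not be shown.
  set T := toMeasurable (samplePi m d) {x | ¬ GoodSample x}
  have hT : MeasurableSet T := measurableSet_toMeasurable _ _
  have hTe : (samplePi m d).real T = (samplePi m d).real {x | ¬ GoodSample x} := by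
    rw [measureReal_def, measureReal_def, measure_toMeasurable]
  rw [← hTe, ← hlaw, map_measureReal_apply_of_aemeasurable (aemeasurable_pi_lambda _ hXm) hT]
  exact measureReal_mono fun ω hω => subset_toMeasurable _ _ hω

end EllipsoidFitting

theorem mainTheorem4 :
    ∃ c : ℝ, 0 < c ∧ ∃ κ : ℝ, 0 < κ ∧ ∃ ε δ : ℕ → ℝ,
      Tendsto ε atTop (𝓝 0) ∧ Tendsto δ atTop (𝓝 0) ∧
      ∀ (m d : ℕ), (m : ℝ) ≤ c * (d : ℝ) ^ 2 →
      ∀ (Ω : Type*) [MeasurableSpace Ω] (P : Measure Ω) [IsProbabilityMeasure P]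
        (v : Fin m → Ω → EuclideanSpace ℝ (Fin d)),
        (∀ i, HasLaw (v i) (sampleLaw d) P) → iIndepFun v P →
        1 - δ d ≤ P.real {ω |
          IsUnit (matA (v · ω)) ∧
          capacitance (v · ω) =
            !![rr (v · ω), ss (v · ω); ss (v · ω), uu (v · ω)] ∧
          rr (v · ω) ∈ Set.Icc ((m : ℝ) / d * (2 / 3)) ((m : ℝ) / d * 2) ∧
          |ss (v · ω)| ≤ 1 + ε d ∧
          uu (v · ω) ∈ Set.Icc (-1 : ℝ) (-1 / 2) ∧
          κ * ((m : ℝ) / d) ≤ ss (v · ω) ^ 2 - rr (v · ω) * uu (v · ω) ∧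
          matM (v · ω) = matA (v · ω) + matU (v · ω) * matC * (matU (v · ω))ᵀ ∧
          IsUnit (matM (v · ω))} := by
  obtain ⟨δ, hδ, hbad⟩ := negligible_not_goodSample
  -- The constant c is the row budget N/2³³ of the barrier at N = d². For d < 100 the failure bound
  -- is set to 1, which makes the claim trivial.
  refine ⟨1 / 2 ^ 33, by norm_num, 1 / 3, by norm_num, fun d => (d : ℝ) ^ (-(1 / 4) : ℝ),
    fun d => if 100 ≤ d then δ d else 1,
    (tendsto_rpow_neg_atTop (by norm_num)).comp tendsto_natCast_atTop_atTop, ?_, ?_⟩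
  · refine hδ.congr' ?_
    filter_upwards [eventually_ge_atTop 100] with d hd
    rw [if_pos hd]
  intro m d hm Ω _ P _ v hv hind
  dsimp only
  split_ifs with hd
  · have hd1 : 1 ≤ d := by omega
    have h1 := (measureReal_not_goodSample_le hd1 hv hind).trans (hbad m d hm)
    have h2 : (1 : ℝ) ≤ P.real {ω | ¬ GoodSample (fun i => Real.sqrt d • WithLp.ofLp (v i ω))} +
        P.real {ω | GoodSample (fun i => Real.sqrt d • WithLp.ofLp (v i ω))} := by
      refine le_trans (le_of_eq ?_) (measureReal_union_le _ _)
      rw [← probReal_univ (μ := P)]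
      congr 1
      ext ω
      simp [em']
    have h3 : P.real {ω | GoodSample (fun i => Real.sqrt d • WithLp.ofLp (v i ω))} ≤ _ :=
      measureReal_mono fun ω hω => conclusion_of_goodSample hd hm (isScaled_rescale hd1 _) hω
    refine le_trans ?_ h3
    linarith
  · simp only [sub_self]
    exact measureReal_nonneg
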